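/- **Theorem 3.5.** Let $\Phi$ be an irreducible reduced (crystallographic, finite) root system of rank $r$ with Weyl group $W$, simple roots $\alpha_1,\dots,\alpha_r$, simple reflections $\sigma_1,\dots,\sigma_r$ and root lattice $\Lambda$. Let $\|\cdot\|$ be the norm of the $W$-invariant inner product for which short roots have squared length $1$, and put $d(\sum_i k_i\alpha_i)=\sum_i k_i$. Fix integers $n,q\ge 1$, an $r$-tuple $\ell=(l_1,\dots,l_r)$ of nonnegative integers, and complex numbers $\gamma(k)$, $k\in\mathbb Z/n\mathbb Z$, with $\gamma(0)=-1$ and $\gamma(k)\gamma(-k)=1/q$ for $k\ne 0$. For a root $\alpha$ put $m(\alpha)=n/\gcd(n,\|\alpha\|^2)$, and let $\Lambda'\subset\Lambda$ be the sublattice generated by all $m(\alpha)\alpha$. Let $A=\mathbb C[\Lambda]$ with monomials $\mathbf x^\beta$, $x_i=\mathbf x^{\alpha_i}$, and let $\widetilde A$ be its field of fractions. For $w\in W$ let $f(\mathbf x)\mapsto f(w\mathbf x)$ be the automorphism of $\widetilde A$ with $\mathbf x^\beta\mapsto q^{d(w^{-1}\beta-\beta)}\mathbf x^{w^{-1}\beta}$.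 For $\beta\in\Lambda$ let $\widetilde A_\beta$ be the space of all quotients $f/g$ with $f,g\in A$, $g\neq0$, $g$ supported in $\Lambda'$ and $f$ supported in $\beta+\Lambda'$; then $\widetilde A=\bigoplus_{\beta\in\Lambda/\Lambda'}\widetilde A_\beta$. Put $\sigma_i\bullet\beta=\sigma_i\beta+(l_i+1)\alpha_i$, $\mu_i(\beta)=d(\sigma_i\bullet\beta-\beta)$, and, with $m=m(\alpha_i)$ and $(k)_m\in\{0,\dots,m-1\}$ the residue of $k$ modulo $m$, $$\mathcal P_{\beta,i}(x)=(qx)^{l_i+1-(\mu_i(\beta))_m}\frac{1-1/q}{1-(qx)^m/q},\qquad \mathcal Q_{\beta,i}(x)=-\gamma(-\|\alpha_i\|^2\mu_i(\beta))\,(qx)^{l_i+1-m}\,\frac{1-(qx)^m}{1-(qx)^m/q}.$$ Let $f\mapsto f|_\ell\sigma_i$ be the linear operator on $\widetilde A$ with $(f|_\ell\sigma_i)(\mathbf x)=\bigl(\mathcal P_{\beta,i}(x_i)+\mathcal Q_{\sigma_i\bullet\beta,i}(x_i)\bigr)f(\sigma_i\mathbf x)$ for $f\in\widetilde A_\beta$.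 Put $$\Delta(\mathbf x)=\prod_{\alpha>0}\bigl(1-q^{m(\alpha)d(\alpha)}\mathbf x^{m(\alpha)\alpha}\bigr),\quad D(\mathbf x)=\prod_{\alpha>0}\bigl(1-q^{m(\alpha)d(\alpha)-1}\mathbf x^{m(\alpha)\alpha}\bigr),\quad j(w,\mathbf x)=\frac{\Delta(\mathbf x)}{\Delta(w\mathbf x)}.$$ Then the operators $|_\ell\sigma_i$ extend to a right action $f\mapsto f|_\ell w$ of $W$ on $\widetilde A$, i.e. $f|_\ell\sigma_{i_1}|_\ell\cdots|_\ell\sigma_{i_k}$ depends only on $f$ and on the product $w=\sigma_{i_1}\cdots\sigma_{i_k}$. The rational function $$h(\mathbf x;\ell)=\Delta(\mathbf x)^{-1}\sum_{w\in W}j(w,\mathbf x)\,(1|_\ell w)(\mathbf x)$$ satisfies $h|_\ell w=h$ for all $w\in W$, and $N(\mathbf x;\ell)=h(\mathbf x;\ell)D(\mathbf x)$ is a polynomial in $x_1,\dots,x_r$. Finally, let $\ell=(0,\dots,0)$ and $m=m(\alpha_i)$. Then $h$ can be restricted to the line on which all variables except $x_i$ vanish, and $$h(0,\dots,0,x_i,0,\dots,0;\ell)=\frac{1+\gamma(\|\alpha_i\|^2)\,q\,x_i}{1-q^{m-1}x_i^m}\quad\text{if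 } m\ne 1,$$ while $h(0,\dots,0,x_i,0,\dots,0;\ell)=1$ if $m=1$ (that is, if $n$ divides $\|\alpha_i\|^2$). -/

import Mathlib

set_option linter.unusedSectionVars false

noncomputable section

namespace ChintaGunnells


section Graded

/-! ### Laurent polynomials on a lattice, their fraction field, and its grading -/

variable {Λ : Type*} [AddCommGroup Λ]

/-- The ring `ℂ[Λ]` of Laurent polynomials on `Λ`; the monomial `x ^ β` is
`AddMonoidAlgebra.single β 1`. -/
abbrev Laurent (Λ : Type*) [AddCommGroup Λ] : Type _ := AddMonoidAlgebra ℂ Λ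

/-- The field of fractions of `ℂ[Λ]`. -/
abbrev RatFn (Λ : Type*) [AddCommGroup Λ] : Type _ := FractionRing (Laurent Λ)

/-- The inclusion of Laurent polynomials in rational functions. -/
abbrev toRat (f : Laurent Λ) : RatFn Λ := algebraMap (Laurent Λ) (RatFn Λ) f

/-- The monomial `x ^ β` as a rational function. -/
def mono (β : Λ) : RatFn Λ := toRat (AddMonoidAlgebra.single β (1 : ℂ))

/-- The Laurent polynomial `f` has its support in the coset `c` of `Λ'`. -/
def SuppIn (Λ' : AddSubgroup Λ) (c : Λ ⧸ Λ') (f : Laurent Λ) : Prop :=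
  ∀ β ∈ f.coeff.support, (QuotientAddGroup.mk β : Λ ⧸ Λ') = c

lemma SuppIn.add {Λ' : AddSubgroup Λ} {c : Λ ⧸ Λ'} {f g : Laurent Λ}
    (hf : SuppIn Λ' c f) (hg : SuppIn Λ' c g) : SuppIn Λ' c (f + g) := by
  classical
  intro β hβ
  rcases Finset.mem_union.mp (Finsupp.support_add hβ) with h | h
  exacts [hf β h, hg β h]

lemma SuppIn.mul {Λ' : AddSubgroup Λ} {c d : Λ ⧸ Λ'} {f g : Laurent Λ}
    (hf : SuppIn Λ' c f) (hg : SuppIn Λ' d g) : SuppIn Λ' (c + d) (f * g) := by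
  classical
  intro β hβ
  obtain ⟨a, ha, e, he, rfl⟩ :=
    Finset.mem_add.mp (AddMonoidAlgebra.support_coeff_mul_subset f g hβ)
  rw [← hf a ha, ← hg e he]
  rfl

lemma SuppIn.smul {Λ' : AddSubgroup Λ} {c : Λ ⧸ Λ'} {f : Laurent Λ} (z : ℂ)
    (hf : SuppIn Λ' c f) : SuppIn Λ' c (z • f) := fun β hβ ↦
  hf β (Finsupp.support_smul hβ)

lemma SuppIn.single {Λ' : AddSubgroup Λ} (β : Λ) (z : ℂ) :
    SuppIn Λ' (QuotientAddGroup.mk β) (AddMonoidAlgebra.single β z) := by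
  intro a ha
  have : a = β := by
    by_contra h
    simp [AddMonoidAlgebra.coeff_single, Ne.symm h] at ha
  rw [this]

lemma SuppIn.one {Λ' : AddSubgroup Λ} : SuppIn Λ' 0 (1 : Laurent Λ) :=
  SuppIn.single (Λ' := Λ') 0 1

lemma SuppIn.prod {Λ' : AddSubgroup Λ} {κ : Type*} (s : Finset κ) (f : κ → Laurent Λ)
    (h : ∀ k ∈ s, SuppIn Λ' 0 (f k)) : SuppIn Λ' 0 (∏ k ∈ s, f k) := by
  classical
  induction s using Finset.induction_on with
  | empty => simpa using SuppIn.one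
  | insert a s ha ih =>
    rw [Finset.prod_insert ha]
    simpa using (h a (by simp)).mul (ih fun k hk ↦ h k (by simp [hk]))

variable [UniqueSums Λ]

/-- For a coset `c ∈ Λ / Λ'`, the space of rational functions `f / g` with `f` supported in `c`
and `g ≠ 0` supported in `Λ'`. -/
def piece (Λ' : AddSubgroup Λ) (c : Λ ⧸ Λ') : Submodule ℂ (RatFn Λ) where
  carrier := {z | ∃ f g : Laurent Λ, g ≠ 0 ∧ SuppIn Λ' 0 g ∧ SuppIn Λ' c f ∧
    z = toRat f / toRat g}
  zero_mem' := ⟨0, 1, one_ne_zero, SuppIn.one, by intro β hβ; simp at hβ, by simp⟩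
  add_mem' := by
    rintro _ _ ⟨f, g, hg, hg0, hf, rfl⟩ ⟨f', g', hg', hg0', hf', rfl⟩
    refine ⟨f * g' + g * f', g * g', mul_ne_zero hg hg', by simpa using hg0.mul hg0',
      SuppIn.add (by simpa using hf.mul hg0') (by simpa using hg0.mul hf'), ?_⟩
    have h1 : toRat g ≠ 0 := by simpa using hg
    have h2 : toRat g' ≠ 0 := by simpa using hg'
    simp only [toRat, map_add, map_mul] at *
    field_simp
  smul_mem' := by
    rintro z _ ⟨f, g, hg, hg0, hf, rfl⟩
    refine ⟨z • f, g, hg, hg0, hf.smul z, ?_⟩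
    rw [toRat, toRat, toRat, ← algebraMap_smul (Laurent Λ) z (_ / _ : RatFn Λ),
      ← algebraMap_smul (Laurent Λ) z f]
    simp only [Algebra.smul_def, Algebra.algebraMap_self, RingHom.id_apply, map_mul, mul_div_assoc]

lemma exists_mul_suppIn (Λ' : AddSubgroup Λ) {N : ℕ} (hN : 0 < N) (hΛ : ∀ β : Λ, N • β ∈ Λ')
    {g : Laurent Λ} (hg : g ≠ 0) : ∃ g' : Laurent Λ, g * g' ≠ 0 ∧ SuppIn Λ' 0 (g * g') := by
  let S : Subalgebra ℂ (Laurent Λ) :=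
    { carrier := {f | SuppIn Λ' 0 f}
      mul_mem' := fun hf hg ↦ by simpa using hf.mul hg
      add_mem' := fun hf hg ↦ hf.add hg
      algebraMap_mem' := fun z ↦ by
        have := SuppIn.single (Λ' := Λ') 0 z
        simpa using this }
  have hint : ∀ f : Laurent Λ, IsIntegral S f := by
    intro f
    induction f using AddMonoidAlgebra.induction_linear with
    | zero => exact isIntegral_zero
    | add f g hf hg => exact hf.add hg
    | single β z =>
      refine IsIntegral.of_pow hN ?_
      rw [AddMonoidAlgebra.single_pow]
      have hmem : AddMonoidAlgebra.single (N • β) (z ^ N) ∈ S := by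
        have := SuppIn.single (Λ' := Λ') (N • β) (z ^ N)
        rwa [(QuotientAddGroup.eq_zero_iff _).mpr (hΛ β)] at this
      exact isIntegral_algebraMap (x := (⟨_, hmem⟩ : S))
  obtain ⟨r, hr, g', hg'⟩ := (hint g).isAlgebraic.exists_nonzero_dvd (mem_nonZeroDivisors_of_ne_zero hg)
  have hr' : g * g' = (r : Laurent Λ) := hg'.symm
  refine ⟨g', ?_, ?_⟩
  · rw [hr']
    simpa using hr
  · rw [hr']
    exact r.2

lemma toRat_injective : Function.Injective (toRat (Λ := Λ)) :=
  IsFractionRing.injective (Laurent Λ) (RatFn Λ)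

open scoped Classical in
/-- The field of rational functions is the direct sum of the pieces attached to the cosets
of a subgroup of finite exponent in `Λ`. -/
theorem piece_isInternal (Λ' : AddSubgroup Λ) {N : ℕ} (hN : 0 < N) (hΛ : ∀ β : Λ, N • β ∈ Λ') :
    DirectSum.IsInternal (piece Λ') := by
  rw [DirectSum.isInternal_submodule_iff_iSupIndep_and_iSup_eq_top]
  constructor
  · apply iSupIndep_of_dfinsupp_lsum_injective
    rw [injective_iff_map_eq_zero]
    intro v hv
    have hv' : ∑ c ∈ v.support, (v c : RatFn Λ) = 0 := by
      simpa [DFinsupp.lsum_apply_apply, DFinsupp.sumAddHom_apply, DFinsupp.sum] using hv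
    choose f g hg hg0 hf hfg using fun c ↦ (v c).2
    let F : Λ ⧸ Λ' → Laurent Λ := fun c ↦ f c * ∏ d ∈ v.support.erase c, g d
    have hF : ∀ c, SuppIn Λ' c (F c) := fun c ↦ by
      simpa using (hf c).mul (SuppIn.prod (v.support.erase c) g fun d _ ↦ hg0 d)
    have hgr : ∀ c, toRat (g c) ≠ 0 := fun c ↦ by simpa using hg c
    have hFv : ∀ c ∈ v.support, toRat (F c) = toRat (∏ d ∈ v.support, g d) * (v c : RatFn Λ) := by
      intro c hc
      rw [hfg c, ← Finset.mul_prod_erase _ _ hc]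
      have := hgr c
      simp only [toRat, F, map_mul] at *
      field_simp
    have hsum : ∑ c ∈ v.support, F c = 0 := by
      apply toRat_injective
      rw [toRat, toRat, map_sum, map_zero, Finset.sum_congr rfl hFv, ← Finset.mul_sum, hv', mul_zero]
    have hF0 : ∀ c ∈ v.support, F c = 0 := by
      intro c hc
      ext β
      by_contra hβ
      have hβ' : β ∈ (F c).coeff.support := by simpa using hβ
      have hco := congrArg (fun p : Laurent Λ ↦ p.coeff β) hsum
      simp only [AddMonoidAlgebra.coeff_sum, Finsupp.coe_finsetSum, Finset.sum_apply,
        AddMonoidAlgebra.coeff_zero, Finsupp.coe_zero, Pi.zero_apply] at hco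
      rw [Finset.sum_eq_single_of_mem c hc] at hco
      · exact hβ (by simpa using hco)
      · intro d _ hdc
        by_contra hd
        exact hdc ((hF d β (by simpa using hd)).symm.trans (hF c β hβ'))
    ext c
    by_contra hc
    have hcs : c ∈ v.support := by
      rw [DFinsupp.mem_support_iff]
      intro h
      exact hc (by simp [h])
    have h1 := hFv c hcs
    rw [hF0 c hcs, toRat, map_zero] at h1
    rcases mul_eq_zero.mp h1.symm with h2 | h2
    · have : ∏ d ∈ v.support, g d = 0 := toRat_injective (by simpa [toRat] using h2)
      exact (Finset.prod_ne_zero_iff.mpr fun d _ ↦ hg d) this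
    · exact hc (by simpa using h2)
  · rw [eq_top_iff]
    rintro z -
    obtain ⟨a, g, hg, rfl⟩ := IsFractionRing.div_surjective (A := Laurent Λ) z
    obtain ⟨g', hgg, hs⟩ := exists_mul_suppIn Λ' hN hΛ (nonZeroDivisors.ne_zero hg)
    have key : ∀ f : Laurent Λ, toRat f / toRat (g * g') ∈ ⨆ c, piece Λ' c := by
      intro f
      induction f using AddMonoidAlgebra.induction_linear with
      | zero => simp [toRat]
      | add f₁ f₂ h₁ h₂ =>
        rw [toRat, map_add, add_div]
        exact Submodule.add_mem _ h₁ h₂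
      | single β z =>
        exact Submodule.mem_iSup_of_mem (QuotientAddGroup.mk β)
          ⟨_, _, hgg, hs, SuppIn.single β z, rfl⟩
    have := key (a * g')
    have h1 : toRat g ≠ 0 := by simpa using nonZeroDivisors.ne_zero hg
    have h2 : toRat g' ≠ 0 := by simpa using right_ne_zero_of_mul hgg
    simp only [toRat, map_mul] at *
    rwa [mul_div_mul_right _ _ h2] at this

open scoped Classical in
/-- The decomposition of the field of rational functions into the pieces, as an isomorphism. -/
def pieceEquiv (Λ' : AddSubgroup Λ) {N : ℕ} (hN : 0 < N) (hΛ : ∀ β : Λ, N • β ∈ Λ') :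
    (DirectSum (Λ ⧸ Λ') fun c ↦ piece Λ' c) ≃ₗ[ℂ] RatFn Λ :=
  LinearEquiv.ofBijective (DirectSum.coeLinearMap (piece Λ')) (by
    exact piece_isInternal Λ' hN hΛ)

open scoped Classical in
lemma pieceEquiv_lof (Λ' : AddSubgroup Λ) {N : ℕ} (hN : 0 < N) (hΛ : ∀ β : Λ, N • β ∈ Λ')
    (c : Λ ⧸ Λ') (z : piece Λ' c) :
    pieceEquiv Λ' hN hΛ (DirectSum.lof ℂ _ (fun c ↦ piece Λ' c) c z) = z :=
  DirectSum.coeLinearMap_lof (piece Λ') c z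

end Graded

section Roots

/-! ### Root system data -/

variable {ι M N : Type*} [Fintype ι] [AddCommGroup M] [Module ℝ M] [AddCommGroup N] [Module ℝ N]

/-- The root lattice `Λ`, the subgroup generated by the roots. -/
abbrev Lat (P : RootPairing ι ℝ M N) : Type _ := P.rootSpan ℤ

instance (P : RootPairing ι ℝ M N) : UniqueSums (P.rootSpan ℤ) := by
  let : Module ℚ M := Module.compHom M (algebraMap ℚ ℝ)
  have : TwoUniqueSums (P.rootSpan ℤ) :=
    TwoUniqueSums.of_injective_addHom (P.rootSpan ℤ).subtype.toAddMonoidHom.toAddHom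
      Subtype.val_injective inferInstance
  infer_instance

variable {P : RootPairing ι ℝ M N}

/-- The roots `α_k` as elements of `Λ`. -/
abbrev rt (P : RootPairing ι ℝ M N) (k : ι) : Lat P := P.rootSpanMem ℤ k

/-- The action of the Weyl group on `Λ`. -/
def weylMap (w : P.weylGroup) : Lat P →+ Lat P where
  toFun β := ⟨w • (β : M), by
    obtain ⟨β, hβ⟩ := β
    induction hβ using Submodule.span_induction with
    | mem x hx =>
      obtain ⟨k, rfl⟩ := hx
      rw [P.weylGroup_apply_root]
      exact Submodule.subset_span ⟨_, rfl⟩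
    | zero => simp
    | add x y _ _ hx hy => simpa only [smul_add] using add_mem hx hy
    | smul t x _ hx =>
      have : w • (t • x) = t • (w • x) := map_zsmul (DistribSMul.toAddMonoidHom M w) t x
      simpa only [this] using Submodule.smul_mem _ t hx⟩
  map_zero' := by ext; simp
  map_add' x y := by ext; simp

lemma weylMap_mul (w w' : P.weylGroup) (β : Lat P) :
    weylMap (w * w') β = weylMap w (weylMap w' β) := by
  ext; simp [weylMap, mul_smul]

lemma weylMap_one (β : Lat P) : weylMap (1 : P.weylGroup) β = β := by
  ext; simp [weylMap]

/-- The height `d(∑ kᵢ αᵢ) = ∑ kᵢ`. -/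
def ht (b : P.Base) : Lat P →ₗ[ℤ] ℤ := ∑ i, b.toWeightBasisInt.coord i

lemma ht_rt (b : P.Base) (i : b.support) : ht b (rt P i) = 1 := by
  have : rt P i = b.toWeightBasisInt i := Subtype.ext (b.coe_toWeightBasisInt_apply i).symm
  rw [this]
  rw [ht, LinearMap.sum_apply, Finset.sum_eq_single i]
  · simp
  · intro j _ hj
    simp [hj.symm]
  · simp

/-- The simple reflection `σᵢ`. -/
abbrev simpleRefl (b : P.Base) (i : b.support) : P.weylGroup :=
  RootPairing.weylGroup.ofIdx P i

instance [P.IsRootSystem] : Finite P.weylGroup := by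
  apply Finite.of_injective (fun w : P.weylGroup ↦ P.weylGroupToPerm w)
  intro w w' h
  have hr : ∀ k, w • P.root k = w' • P.root k := fun k ↦ by
    rw [P.weylGroup_apply_root, P.weylGroup_apply_root]
    exact congrArg P.root (DFunLike.congr_fun h k)
  apply Subtype.ext
  apply RootPairing.Equiv.weightHom_injective P
  ext x
  have hx : x ∈ Submodule.span ℝ (Set.range P.root) := by
    rw [RootPairing.IsRootSystem.span_root_eq_top]
    trivial
  change w • x = w' • x
  induction hx using Submodule.span_induction with
  | mem x hx => obtain ⟨k, rfl⟩ := hx; exact hr k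
  | zero => simp
  | add x y _ _ hx hy => simp only [smul_add, hx, hy]
  | smul t x _ hx => simp only [smul_comm w t, smul_comm w' t, hx]

instance [P.IsRootSystem] : Fintype P.weylGroup := Fintype.ofFinite _

lemma exists_word [P.IsCrystallographic] [P.IsReduced] (b : P.Base) (w : P.weylGroup) :
    ∃ L : List b.support, (L.map (simpleRefl b)).prod = w := by
  let H : Subgroup P.Aut := Subgroup.closure (Set.range fun i : b.support ↦
    RootPairing.Equiv.reflection P i)
  have hH : ∀ k, RootPairing.Equiv.reflection P k ∈ H := by
    intro k
    refine b.induction_reflect k (p := fun k ↦ RootPairing.Equiv.reflection P k ∈ H) ?_ ?_ ?_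
    · intro i hi
      have : RootPairing.Equiv.reflection P (P.reflectionPerm i i) =
          RootPairing.Equiv.reflection P i := by
        apply RootPairing.Equiv.weightHom_injective P
        ext x
        change P.reflection (P.reflectionPerm i i) x = P.reflection i x
        simp [RootPairing.reflection_reflectionPerm]
      rwa [this]
    · intro i hi
      exact Subgroup.subset_closure ⟨⟨i, hi⟩, rfl⟩
    · intro i j hi hj
      have : RootPairing.Equiv.reflection P (P.reflectionPerm j i) =
          RootPairing.Equiv.reflection P j * RootPairing.Equiv.reflection P i *
            RootPairing.Equiv.reflection P j := by
        apply RootPairing.Equiv.weightHom_injective P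
        ext x
        change P.reflection (P.reflectionPerm j i) x =
          P.reflection j (P.reflection i (P.reflection j x))
        simp [RootPairing.reflection_reflectionPerm]
      have hj' : RootPairing.Equiv.reflection P j ∈ H := Subgroup.subset_closure ⟨⟨j, hj⟩, rfl⟩
      rw [this]
      exact mul_mem (mul_mem hj' hi) hj'
  have hw : (w : P.Aut) ∈ H := (Subgroup.closure_le H).mpr (by rintro _ ⟨k, rfl⟩; exact hH k) w.2
  have hL : ∀ g ∈ H, ∃ L : List b.support,
      (L.map fun i : b.support ↦ RootPairing.Equiv.reflection P i).prod = g := by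
    intro g hg
    induction hg using Subgroup.closure_induction with
    | mem g hg => obtain ⟨i, rfl⟩ := hg; exact ⟨[i], by simp⟩
    | one => exact ⟨[], rfl⟩
    | mul g g' _ _ h h' =>
      obtain ⟨L, rfl⟩ := h
      obtain ⟨L', rfl⟩ := h'
      exact ⟨L ++ L', by simp⟩
    | inv g _ h =>
      obtain ⟨L, rfl⟩ := h
      refine ⟨L.reverse, ?_⟩
      rw [List.prod_inv_reverse, List.map_map, List.map_reverse]
      congr 2
      exact List.map_congr_left fun i _ ↦ (RootPairing.Equiv.reflection_inv P i).symm
  obtain ⟨L, hL⟩ := hL _ hw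
  refine ⟨L, Subtype.ext ?_⟩
  rw [← hL, Subgroup.val_list_prod, List.map_map]
  rfl

/-- The squared length `‖α_k‖²` for the Weyl group invariant inner product in which the short
roots have squared length `1`: the ratio of the length of `α_k` to the minimal length of a root,
computed with the canonical invariant form `∑_j ⟨x, α_j^∨⟩ ⟨y, α_j^∨⟩`. -/
def normSq (P : RootPairing ι ℝ M N) [P.IsCrystallographic] (k : ι) : ℕ :=
  ((P.posRootForm ℤ).rootLength k / ⨅ j, (P.posRootForm ℤ).rootLength j).toNat

/-- The integer division in the definition of `normSq` is exact. -/
lemma normSq_mul [P.IsRootSystem] [P.IsCrystallographic] [P.IsReduced] [P.IsIrreducible] (k : ι) :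
    (normSq P k : ℤ) * (⨅ j, (P.posRootForm ℤ).rootLength j) = (P.posRootForm ℤ).rootLength k := by
  have : Nonempty ι := ⟨k⟩
  set B := P.posRootForm ℤ with hB
  obtain ⟨j, hj⟩ := exists_eq_ciInf_of_finite (f := B.rootLength)
  have hmin : ∀ i, B.rootLength j ≤ B.rootLength i := fun i ↦ by
    rw [hj]
    exact ciInf_le (Set.finite_range _).bddBelow i
  have hpos := B.rootLength_pos j
  obtain ⟨k', h1, h2⟩ := P.exists_form_eq_form_and_form_ne_zero B.toInvariantForm k j
  have h1' : B.rootLength k' = B.rootLength j := by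
    have := B.algebraMap_rootLength (S := ℤ) k'
    rw [show B.form (P.root k') (P.root k') = _ from h1] at this
    rw [show B.toInvariantForm.form (P.root j) (P.root j) = _ from
      (B.algebraMap_rootLength j).symm] at this
    exact FaithfulSMul.algebraMap_injective ℤ ℝ this
  have h3 : P.pairingIn ℤ k k' ≠ 0 := by
    intro h0
    apply h2
    rw [RootPairing.InvariantForm.apply_root_root_zero_iff, ← P.algebraMap_pairingIn ℤ, h0, map_zero]
  have h4 := B.pairingIn_mul_eq_pairingIn_mul_swap k k'
  rw [h1'] at h4
  have h5 := hmin k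
  have h6 := P.pairingIn_pairingIn_mem_set_of_isCrystal_of_isRed k k'
  have hdvd : B.rootLength j ∣ B.rootLength k := by
    simp only [Set.mem_insert_iff, Set.mem_singleton_iff, Prod.mk.injEq] at h6
    rcases h6 with h | h | h | h | h | h | h | h | h | h | h | h | h <;>
      rw [h.1, h.2] at h4 <;>
      first
      | exact absurd h.1 h3
      | exact ⟨1, by lia⟩
      | exact ⟨2, by lia⟩
      | exact ⟨3, by lia⟩
  obtain ⟨t, ht⟩ := hdvd
  have htp : 0 ≤ t := by
    by_contra hneg
    have := B.rootLength_pos k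
    nlinarith
  rw [normSq, ← hB, ← hj, ht, Int.mul_ediv_cancel_left _ hpos.ne', Int.toNat_of_nonneg htp,
    mul_comm]

lemma normSq_mul_pairing [P.IsRootSystem] [P.IsCrystallographic] [P.IsReduced] [P.IsIrreducible]
    (k i : ι) : P.pairingIn ℤ i k * (normSq P k : ℤ) = P.pairingIn ℤ k i * (normSq P i : ℤ) := by
  have h := (P.posRootForm ℤ).pairingIn_mul_eq_pairingIn_mul_swap k i
  have hne : (⨅ j, (P.posRootForm ℤ).rootLength j) ≠ 0 := by
    intro h0
    have h1 := normSq_mul (P := P) k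
    have h2 := (P.posRootForm ℤ).rootLength_pos k
    rw [h0, mul_zero] at h1
    lia
  rw [← normSq_mul k, ← normSq_mul i, ← mul_assoc, ← mul_assoc] at h
  exact mul_right_cancel₀ hne h

/-- `m(α_k) = n / gcd(n, ‖α_k‖²)`. -/
def mInt (P : RootPairing ι ℝ M N) [P.IsCrystallographic] (n : ℕ) (k : ι) : ℕ :=
  n / n.gcd (normSq P k)

/-- The sublattice `Λ'` generated by the `m(α) α`. -/
def subLat (P : RootPairing ι ℝ M N) [P.IsCrystallographic] (n : ℕ) : AddSubgroup (Lat P) :=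
  AddSubgroup.closure (Set.range fun k ↦ mInt P n k • rt P k)

lemma dvd_normSq_mul_mInt [P.IsCrystallographic] (n : ℕ) (k : ι) :
    n ∣ normSq P k * mInt P n k := by
  have h : n = n.gcd (normSq P k) * mInt P n k := (Nat.mul_div_cancel' (Nat.gcd_dvd_left _ _)).symm
  conv_lhs => rw [h]
  exact Nat.mul_dvd_mul_right (Nat.gcd_dvd_right _ _) _

lemma nsmul_mem_subLat [P.IsCrystallographic] (n : ℕ) (β : Lat P) : n • β ∈ subLat P n := by
  have hr : ∀ k, n • rt P k ∈ subLat P n := fun k ↦ by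
    have h : n = n.gcd (normSq P k) * mInt P n k := (Nat.mul_div_cancel' (Nat.gcd_dvd_left _ _)).symm
    have h' : n • rt P k = n.gcd (normSq P k) • mInt P n k • rt P k := by
      rw [smul_smul, ← h]
    rw [h']
    exact AddSubgroup.nsmul_mem _ (AddSubgroup.subset_closure (Set.mem_range_self k)) _
  obtain ⟨β, hβ⟩ := β
  induction hβ using Submodule.span_induction with
  | mem x hx => obtain ⟨k, rfl⟩ := hx; exact hr k
  | zero => exact (smul_zero n : n • (0 : Lat P) = 0) ▸ zero_mem _
  | add x y hx' hy' hx hy =>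
    have := add_mem hx hy
    rwa [← smul_add] at this
  | smul t x hx' hx =>
    have := AddSubgroup.zsmul_mem _ hx t
    rwa [smul_comm] at this

/-! ### The change of variables and the action of a simple reflection -/

variable (b : P.Base)

/-- The change of variables `f(x) ↦ f(w x)` on Laurent polynomials: the algebra homomorphism with
`x ^ β ↦ q ^ d(w⁻¹ β - β) x ^ (w⁻¹ β)`. -/
def twistHom (q : ℕ) [NeZero q] (w : P.weylGroup) : Laurent (Lat P) →ₐ[ℂ] Laurent (Lat P) :=
  AddMonoidAlgebra.lift ℂ (Laurent (Lat P)) (Lat P)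
    { toFun := fun β ↦ AddMonoidAlgebra.single (weylMap w⁻¹ β.toAdd)
        ((q : ℂ) ^ (ht b (weylMap w⁻¹ β.toAdd - β.toAdd)))
      map_one' := by simp [AddMonoidAlgebra.one_def]
      map_mul' := fun β β' ↦ by
        have hq : (q : ℂ) ≠ 0 := NeZero.ne _
        rw [AddMonoidAlgebra.single_mul_single, ← zpow_add₀ hq, ← map_add, toAdd_mul, map_add,
          add_sub_add_comm, map_add] }

lemma twistHom_single (q : ℕ) [NeZero q] (w : P.weylGroup) (β : Lat P) (z : ℂ) :
    twistHom b q w (AddMonoidAlgebra.single β z) = AddMonoidAlgebra.single (weylMap w⁻¹ β)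
      (z * (q : ℂ) ^ (ht b (weylMap w⁻¹ β - β))) := by
  simp [twistHom]

lemma twistHom_injective (q : ℕ) [NeZero q] (w : P.weylGroup) :
    Function.Injective (twistHom b q w) := by
  have : (twistHom b q w⁻¹).comp (twistHom b q w) = AlgHom.id ℂ _ := by
    refine AddMonoidAlgebra.algHom_ext (fun β ↦ ?_) ?_
    · have hq : (q : ℂ) ≠ 0 := NeZero.ne _
      simp only [AlgHom.comp_apply, twistHom_single, inv_inv, ← weylMap_mul, mul_inv_cancel,
        weylMap_one, AlgHom.id_apply, one_mul, ← zpow_add₀ hq, ← map_add]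
      simp
    · ext
  exact Function.LeftInverse.injective (g := twistHom b q w⁻¹) fun f ↦ DFunLike.congr_fun this f

lemma twistRat_injective (q : ℕ) [NeZero q] (w : P.weylGroup) : Function.Injective
    ((IsScalarTower.toAlgHom ℂ (Laurent (Lat P)) (RatFn (Lat P))).comp (twistHom b q w)) :=
  toRat_injective.comp (twistHom_injective b q w)

/-- The change of variables `f(x) ↦ f(w x)` on rational functions. -/
def twist (q : ℕ) [NeZero q] (w : P.weylGroup) : RatFn (Lat P) →ₐ[ℂ] RatFn (Lat P) :=
  IsFractionRing.liftAlgHom (twistRat_injective b q w)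

lemma twist_toRat (q : ℕ) [NeZero q] (w : P.weylGroup) (f : Laurent (Lat P)) :
    twist b q w (toRat f) = toRat (twistHom b q w f) :=
  IsFractionRing.lift_algebraMap (twistRat_injective b q w) f

lemma mono_add (β β' : Lat P) : mono (β + β') = mono β * mono β' := by
  rw [mono, mono, mono, toRat, toRat, toRat, ← map_mul, AddMonoidAlgebra.single_mul_single, one_mul]

lemma twist_mono (q : ℕ) [NeZero q] (w : P.weylGroup) (β : Lat P) :
    twist b q w (mono β) =
      (q : RatFn (Lat P)) ^ (ht b (weylMap w⁻¹ β - β)) * mono (weylMap w⁻¹ β) := by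
  set t : ℤ := ht b (weylMap w⁻¹ β - β) with ht'
  have e : (AddMonoidAlgebra.single (weylMap w⁻¹ β) ((q : ℂ) ^ t) : Laurent (Lat P)) =
      algebraMap ℂ (Laurent (Lat P)) ((q : ℂ) ^ t) *
        AddMonoidAlgebra.single (weylMap w⁻¹ β) 1 := by
    rw [← Algebra.smul_def, AddMonoidAlgebra.smul_single, smul_eq_mul, mul_one]
  rw [mono, twist_toRat, twistHom_single, one_mul, ← ht', e, mono, toRat, toRat, map_mul,
    ← IsScalarTower.algebraMap_apply]
  congr 1
  exact (map_zpow₀ (algebraMap ℂ (RatFn (Lat P))) (q : ℂ) t).trans (by rw [map_natCast])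

lemma weylMap_simpleRefl [P.IsCrystallographic] (i : b.support) (β : Lat P) :
    weylMap (simpleRefl b i) β = β - P.coroot'In ℤ i β • rt P i := by
  apply Subtype.ext
  change simpleRefl b i • (β : M) = (β : M) - ((P.coroot'In ℤ i β • rt P i : Lat P) : M)
  rw [Submodule.coe_smul, ← Int.cast_smul_eq_zsmul ℝ]
  rw [RootPairing.weylGroup.ofIdx_smul, RootPairing.Equiv.reflection_smul,
    RootPairing.reflection_apply, ← P.algebraMap_coroot'In_apply ℤ]
  rfl

/-- The variable `xᵢ = x ^ αᵢ`. -/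
def var (i : b.support) : RatFn (Lat P) := mono (rt P i)

/-- The change of variables of a simple reflection in coordinates: `xᵢ` goes to
`q ^ (-c(i,j)) xᵢ xⱼ ^ (-c(i,j))`. -/
lemma twist_var [P.IsCrystallographic] (q : ℕ) [NeZero q] (i j : b.support) :
    twist b q (simpleRefl b j) (var b i) = (q : RatFn (Lat P)) ^ (-P.pairingIn ℤ i j) *
      (var b i * mono (-(P.pairingIn ℤ i j • rt P j))) := by
  have hj : (simpleRefl b j)⁻¹ = simpleRefl b j :=
    Subtype.ext (RootPairing.Equiv.reflection_inv P j)
  rw [var, twist_mono, hj, weylMap_simpleRefl, RootPairing.coroot'In_rootSpanMem_eq_pairingIn,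
    sub_sub_cancel_left, map_neg, map_smul, ht_rt, smul_eq_mul, mul_one, sub_eq_add_neg, mono_add]

/-- The affine action `σᵢ • β = σᵢ β + (lᵢ + 1) αᵢ` of a simple reflection on `Λ`. -/
def dot (l : b.support → ℕ) (i : b.support) (β : Lat P) : Lat P :=
  weylMap (simpleRefl b i) β + ((l i : ℤ) + 1) • rt P i

/-- If `θ` is the weight `∑ (lᵢ + 1) ωᵢ`, that is, if `⟨θ, αᵢ^∨⟩ = lᵢ + 1`, then
`σᵢ • β = σᵢ (β - θ) + θ`. -/
lemma coe_dot (l : b.support → ℕ) (i : b.support) (β : Lat P) (θ : M)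
    (hθ : P.coroot' i θ = l i + 1) :
    (dot b l i β : M) = simpleRefl b i • ((β : M) - θ) + θ := by
  have h1 : simpleRefl b i • θ = θ - ((l i : ℝ) + 1) • P.root i := by
    rw [RootPairing.weylGroup.ofIdx_smul, RootPairing.Equiv.reflection_smul,
      RootPairing.reflection_apply, hθ]
  have h2 : ((((l i : ℤ) + 1) • rt P i : Lat P) : M) = ((l i : ℝ) + 1) • P.root i := by
    rw [Submodule.coe_smul, ← Int.cast_smul_eq_zsmul ℝ]
    push_cast
    rfl
  rw [dot, Submodule.coe_add, h2, smul_sub, h1]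
  change simpleRefl b i • (β : M) + _ = _
  abel

/-- `μ_{ℓ,i}(β) = d(σᵢ • β - β)`. -/
def mu (l : b.support → ℕ) (i : b.support) (β : Lat P) : ℤ := ht b (dot b l i β - β)

variable [P.IsCrystallographic]

lemma mu_eq (l : b.support → ℕ) (i : b.support) (β : Lat P) :
    mu b l i β = l i + 1 - P.coroot'In ℤ i β := by
  rw [mu, dot, weylMap_simpleRefl, show β - P.coroot'In ℤ i β • rt P i + ((l i : ℤ) + 1) • rt P i - β =
    ((l i : ℤ) + 1 - P.coroot'In ℤ i β) • rt P i by rw [sub_smul]; abel, map_smul, ht_rt]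
  simp

lemma mu_dot (l : b.support → ℕ) (i : b.support) (β : Lat P) :
    mu b l i (dot b l i β) = - mu b l i β := by
  have h : dot b l i β = β + mu b l i β • rt P i := by
    rw [mu_eq, dot, weylMap_simpleRefl, sub_smul]
    abel
  rw [mu_eq, h, map_add, map_smul, mu_eq, RootPairing.coroot'In_rootSpanMem_eq_pairingIn,
    RootPairing.pairingIn_same]
  simp only [smul_eq_mul]
  ring

lemma mu_congr [P.IsRootSystem] [P.IsReduced] [P.IsIrreducible] (n : ℕ) [NeZero n]
    (l : b.support → ℕ)
    (i : b.support) {β β' : Lat P} (h : β' - β ∈ subLat P n) :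
    (mInt P n i : ℤ) ∣ mu b l i β' - mu b l i β := by
  have key : ∀ x ∈ subLat P n, (mInt P n i : ℤ) ∣ P.coroot'In ℤ i x := by
    intro x hx
    induction hx using AddSubgroup.closure_induction with
    | mem x hx =>
      obtain ⟨k, rfl⟩ := hx
      rw [map_nsmul, RootPairing.coroot'In_rootSpanMem_eq_pairingIn, nsmul_eq_mul]
      have h1 : n / n.gcd (normSq P i) ∣ mInt P n k * (P.pairingIn ℤ k i).natAbs := by
        have hg : 0 < n.gcd (normSq P i) := Nat.gcd_pos_of_pos_left _ (NeZero.pos n)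
        refine Nat.Coprime.dvd_of_dvd_mul_right (Nat.coprime_div_gcd_div_gcd hg) ?_
        refine Nat.dvd_of_mul_dvd_mul_right hg ?_
        rw [Nat.div_mul_cancel (Nat.gcd_dvd_left _ _), mul_assoc,
          Nat.div_mul_cancel (Nat.gcd_dvd_right _ _)]
        have h2 : (P.pairingIn ℤ k i).natAbs * normSq P i =
            (P.pairingIn ℤ i k).natAbs * normSq P k := by
          have := congrArg Int.natAbs (normSq_mul_pairing (P := P) k i)
          simpa [Int.natAbs_mul] using this.symm
        rw [mul_assoc, h2, mul_left_comm, mul_comm (mInt P n k)]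
        exact Dvd.dvd.mul_left (dvd_normSq_mul_mInt n k) _
      rw [← Int.natAbs_dvd_natAbs, Int.natAbs_mul]
      simpa only [Int.natAbs_natCast, Int.nsmul_eq_mul, mInt] using h1
    | zero => simp
    | add x y _ _ hx hy => rw [map_add]; exact dvd_add hx hy
    | neg x _ hx => rw [map_neg]; exact hx.neg_right
  have h1 := key _ h
  rw [map_sub] at h1
  rw [mu_eq, mu_eq, ← dvd_neg, neg_sub, sub_sub_sub_cancel_left]
  exact h1

/-- The rational function `𝒫_{β,ℓ,i}(xᵢ)`. -/
def PFun (n q : ℕ) (l : b.support → ℕ) (i : b.support) (β : Lat P) : RatFn (Lat P) :=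
  (q * var b i) ^ ((l i : ℤ) + 1 - mu b l i β % mInt P n i) *
    ((1 - 1 / q) / (1 - (q * var b i) ^ mInt P n i / q))

/-- The rational function `𝒬_{β,ℓ,i}(xᵢ)`. -/
def QFun (n q : ℕ) (γ : ZMod n → ℂ) (l : b.support → ℕ) (i : b.support) (β : Lat P) :
    RatFn (Lat P) :=
  -algebraMap ℂ (RatFn (Lat P)) (γ (-(normSq P i * mu b l i β : ℤ))) *
    (q * var b i) ^ ((l i : ℤ) + 1 - mInt P n i) *
    ((1 - (q * var b i) ^ mInt P n i) / (1 - (q * var b i) ^ mInt P n i / q))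

open scoped Classical in
/-- The operator `f ↦ f|_ℓ σᵢ`: it is the linear map on `⨁_{c ∈ Λ/Λ'} Ã_c = Ã` which takes
`f ∈ Ã_β` to `(𝒫_{β,ℓ,i}(xᵢ) + 𝒬_{σᵢ • β,ℓ,i}(xᵢ)) f(σᵢ x)`. -/
def slashGen (n q : ℕ) [NeZero n] [NeZero q] (γ : ZMod n → ℂ) (l : b.support → ℕ)
    (i : b.support) : RatFn (Lat P) →ₗ[ℂ] RatFn (Lat P) :=
  (DirectSum.toModule ℂ (Lat P ⧸ subLat P n) (RatFn (Lat P)) fun c ↦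
      LinearMap.mulLeft ℂ (PFun b n q l i c.out + QFun b n q γ l i (dot b l i c.out)) ∘ₗ
        (twist b q (simpleRefl b i)).toLinearMap ∘ₗ (piece (subLat P n) c).subtype) ∘ₗ
    (pieceEquiv (subLat P n) (NeZero.pos n) (nsmul_mem_subLat n)).symm.toLinearMap

/-- The defining formula holds for every representative `β` of a coset. -/
theorem slashGen_apply [P.IsRootSystem] [P.IsReduced] [P.IsIrreducible]
    (n q : ℕ) [NeZero n] [NeZero q] (γ : ZMod n → ℂ) (l : b.support → ℕ)
    (i : b.support) (β : Lat P) (f : RatFn (Lat P))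
    (hf : f ∈ piece (subLat P n) (QuotientAddGroup.mk β)) :
    slashGen b n q γ l i f =
      (PFun b n q l i β + QFun b n q γ l i (dot b l i β)) * twist b q (simpleRefl b i) f := by
  classical
  set c : Lat P ⧸ subLat P n := QuotientAddGroup.mk β with hc
  have hm : (mInt P n i : ℤ) ∣ mu b l i c.out - mu b l i β := by
    refine mu_congr b n l i ?_
    rw [← QuotientAddGroup.eq_iff_sub_mem]
    exact c.out_eq
  have hP : PFun b n q l i c.out = PFun b n q l i β := by
    rw [PFun, PFun, (Int.ModEq.symm (Int.modEq_iff_dvd.mpr hm)).eq]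
  have hQ : QFun b n q γ l i (dot b l i c.out) = QFun b n q γ l i (dot b l i β) := by
    have : ((normSq P i * mu b l i c.out : ℤ) : ZMod n) = (normSq P i * mu b l i β : ℤ) := by
      rw [← sub_eq_zero, ← Int.cast_sub, ← mul_sub, ZMod.intCast_zmod_eq_zero_iff_dvd]
      refine dvd_trans ?_ (mul_dvd_mul_left _ hm)
      exact_mod_cast dvd_normSq_mul_mInt n (i : ι)
    rw [QFun, QFun, mu_dot, mu_dot, mul_neg, mul_neg, Int.cast_neg, Int.cast_neg, this]
  have hs : (pieceEquiv (subLat P n) (NeZero.pos n) (nsmul_mem_subLat n)).symm f =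
      DirectSum.lof ℂ _ (fun c ↦ piece (subLat P n) c) c ⟨f, hf⟩ := by
    rw [LinearEquiv.symm_apply_eq, pieceEquiv_lof]
  rw [slashGen, LinearMap.comp_apply, LinearEquiv.coe_coe, hs, DirectSum.toModule_lof]
  simp [hP, hQ]

/-- The operator of a word in the simple reflections, as a right action:
`f|_ℓ (σ_{i₁} σ_{i₂} ⋯) = (f|_ℓ σ_{i₁})|_ℓ σ_{i₂} ⋯`. -/
def slashWord (n q : ℕ) [NeZero n] [NeZero q] (γ : ZMod n → ℂ) (l : b.support → ℕ)
    (L : List b.support) (f : RatFn (Lat P)) : RatFn (Lat P) :=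
  L.foldl (fun g i ↦ slashGen b n q γ l i g) f

/-- `f|_ℓ w`, computed through a word for `w` in the simple reflections. -/
def slash [P.IsReduced] (n q : ℕ) [NeZero n] [NeZero q] (γ : ZMod n → ℂ) (l : b.support → ℕ)
    (w : P.weylGroup) (f : RatFn (Lat P)) : RatFn (Lat P) :=
  slashWord b n q γ l (exists_word b w).choose f

/-! ### The invariant rational function -/

open scoped Classical in
/-- `Δ(x) = ∏_{α > 0} (1 - q ^ (m(α) d(α)) x ^ (m(α) α))`. -/
def Delta (n q : ℕ) : RatFn (Lat P) :=
  ∏ k with b.IsPos k,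
    (1 - (q : RatFn (Lat P)) ^ ((mInt P n k : ℤ) * ht b (rt P k)) * mono (mInt P n k • rt P k))

open scoped Classical in
/-- `D(x) = ∏_{α > 0} (1 - q ^ (m(α) d(α) - 1) x ^ (m(α) α))`. -/
def DFun (n q : ℕ) : RatFn (Lat P) :=
  ∏ k with b.IsPos k,
    (1 - (q : RatFn (Lat P)) ^ ((mInt P n k : ℤ) * ht b (rt P k) - 1) *
      mono (mInt P n k • rt P k))

/-- `j(w, x) = Δ(x) / Δ(w x)`. -/
def jFun (n q : ℕ) [NeZero q] (w : P.weylGroup) : RatFn (Lat P) :=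
  Delta b n q / twist b q w (Delta b n q)

/-- `h(x; ℓ) = Δ(x)⁻¹ ∑_{w ∈ W} j(w, x) (1|_ℓ w)(x)`. -/
def hFun [P.IsRootSystem] [P.IsReduced] (n q : ℕ) [NeZero n] [NeZero q] (γ : ZMod n → ℂ)
    (l : b.support → ℕ) : RatFn (Lat P) :=
  (Delta b n q)⁻¹ * ∑ w : P.weylGroup, jFun b n q w * slash b n q γ l w 1

open scoped Classical in
/-- The rational function `z` restricts to the rational function `g` in one variable when all
variables other than `xᵢ` are set to zero: `z` is a quotient of two polynomials `a / c`, where `c`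
does not vanish identically on the line, and `g` is the quotient of their restrictions. -/
def RestrictsTo (i : b.support) (z : RatFn (Lat P)) (g : RatFunc ℂ) : Prop :=
  ∃ a c : MvPolynomial b.support ℂ,
    let res : MvPolynomial b.support ℂ →ₐ[ℂ] Polynomial ℂ :=
      MvPolynomial.aeval fun j ↦ if j = i then Polynomial.X else 0
    res c ≠ 0 ∧
    z = MvPolynomial.aeval (var b) a / MvPolynomial.aeval (var b) c ∧
    g = algebraMap (Polynomial ℂ) (RatFunc ℂ) (res a) /
      algebraMap (Polynomial ℂ) (RatFunc ℂ) (res c)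

end Roots

end ChintaGunnells

end

set_option linter.unusedSectionVars false

noncomputable section

namespace ChintaGunnells

section Combinatorics

/-! ### The Weyl group and positive roots -/

variable {ι M N : Type*} [Fintype ι] [AddCommGroup M] [Module ℝ M] [AddCommGroup N] [Module ℝ N]
variable {P : RootPairing ι ℝ M N}

/-! Write `y ^ β = q ^ d(β) x ^ β` and `Y_k = y ^ (m(α_k) α_k)`. The relations between the operators
`|σ_i` are obtained uniformly, without a case check in rank two. It is enough to treat `starGen`,
that is `f ↦ Y_i (f|σ_i)`, because the two families differ by the cocycle `invProd`.

Modulo `Λ'` and the dot action, every `β` can be moved into the closed alcove `0 ≤ ⟨β - θ, α^∨⟩ ≤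
m(α)` for `α > 0`, where `θ = ∑ (l_i + 1) ω_i` (`exists_alcove_representative`). On the monomials `y
^ (u • β)` of an alcove element the `starGen` are images of a single system of operators `genOp` on
functions on `W`, with a parameter `t` such that `t ^ 2 = 1/q`. All dependence on `γ` and `β` goes
into nonzero scalars, and the two conditions on `γ` are what this needs on the walls and inside the
alcove (`starGen_monomial`, `realise_genOp`).

For the universal operators, let two words have the same product `w`, and let `Z` be the difference
of their operators after clearing denominators. It commutes with Hecke-type operators `affOp` acting
from the other side, one for each wall of the alcove (`genOp_affOp`), and is killed by the
functional `genSum`. At `t = 1` the operators `affOp` become permutations with monomial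
coefficients. This forces the matrix of `Z` to be supported on `u = w⁻¹ x`, and `genSum` kills what
is left. Hence `t - 1` divides `Z`; the argument applies again to the quotient, so every power of `t
- 1` divides `Z`, and `Z = 0` (`genWord_eq_of_prod_eq`).

Since `Δ` lies in the degree zero piece, `h` is the sum of all `Δ⁻¹|w` (`hFun_eq`), so its
invariance is a reindexing.

For polynomiality, use the action `bar w f = j(w, x) (f|w)`, for which `σ_i` acts as `-starGen`. The
denominator of `bar w 1` divides the product of `1 - Y_k / q` over the inversions of `w`, so `D`
times the invariant sum `barSum` is a Laurent polynomial. Modulo `1 - Y_i` the operator of `σ_i` is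
`-1` (`exists_bar_simple`), while `barSum` is fixed, so every `1 - Y_k` divides `barSum`. For `q ≠
1` this gives divisibility of the numerator by `Δ`; for `q = 1` one has `D = Δ` and each `bar w 1`
is already a Laurent polynomial (`DeltaL_dvd_sumNum`). The term of `w` is supported where each
simple coordinate is at least that of `θ - w⁻¹ θ ≥ 0`, and division by `Δ = 1 - (terms of positive
height)` keeps nonnegative exponents (`SuppGE.of_mul_one_sub`).

On the line of `x_i` only `w = 1` and `w = σ_i` contribute (`exists_one_le_crd_thetaSub`), and the
value of `h` is a computation with these two terms. -/

/-- The reflection in the root `α_k` as an element of the Weyl group. -/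
abbrev refl (k : ι) : P.weylGroup := RootPairing.weylGroup.ofIdx P k

/-- The permutation of the indices of the roots induced by an element of the Weyl group. -/
def perm (w : P.weylGroup) (k : ι) : ι := P.weylGroupToPerm w k

/-- The index of the root `-α_k`. -/
def opp (P : RootPairing ι ℝ M N) (k : ι) : ι := P.reflectionPerm k k

lemma root_perm (w : P.weylGroup) (k : ι) : P.root (perm w k) = w • P.root k :=
  (P.weylGroup_apply_root w k).symm

lemma root_opp (k : ι) : P.root (opp P k) = -P.root k := by simp [opp]

lemma opp_opp (k : ι) : opp P (opp P k) = k := by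
  apply P.root.injective
  rw [root_opp, root_opp, neg_neg]

lemma opp_ne (k : ι) : opp P k ≠ k := by
  have := Module.IsReflexive.of_isPerfPair P.toLinearMap
  exact fun h ↦ P.ne_neg k h.symm

lemma perm_mul (w w' : P.weylGroup) (k : ι) : perm (w * w') k = perm w (perm w' k) := by
  simp [perm]

@[simp] lemma perm_one (k : ι) : perm (1 : P.weylGroup) k = k := by simp [perm]

@[simp] lemma perm_inv_perm (w : P.weylGroup) (k : ι) : perm w⁻¹ (perm w k) = k := by
  rw [← perm_mul, inv_mul_cancel, perm_one]

@[simp] lemma perm_perm_inv (w : P.weylGroup) (k : ι) : perm w (perm w⁻¹ k) = k := by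
  rw [← perm_mul, mul_inv_cancel, perm_one]

lemma perm_injective (w : P.weylGroup) : Function.Injective (perm w) :=
  (P.weylGroupToPerm w).injective

lemma perm_opp (w : P.weylGroup) (k : ι) : perm w (opp P k) = opp P (perm w k) := by
  apply P.root.injective
  rw [root_perm, root_opp, root_opp, root_perm, smul_neg]

lemma perm_refl (j k : ι) : perm (refl (P := P) j) k = P.reflectionPerm j k := by
  apply P.root.injective
  rw [root_perm, RootPairing.weylGroup.ofIdx_smul, RootPairing.Equiv.reflection_smul,
    RootPairing.root_reflectionPerm]

lemma perm_refl_self (k : ι) : perm (refl (P := P) k) k = opp P k := perm_refl k k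

@[simp] lemma refl_inv (k : ι) : (refl (P := P) k)⁻¹ = refl k :=
  Subtype.ext (RootPairing.Equiv.reflection_inv P k)

@[simp] lemma refl_mul_self (k : ι) : refl (P := P) k * refl k = 1 := by
  rw [mul_eq_one_iff_inv_eq, refl_inv]

@[simp] lemma refl_mul_refl_mul (k : ι) (w : P.weylGroup) : refl k * (refl k * w) = w := by
  rw [← mul_assoc, refl_mul_self, one_mul]

@[simp] lemma mul_refl_mul_refl (k : ι) (w : P.weylGroup) : w * refl k * refl k = w := by
  rw [mul_assoc, refl_mul_self, mul_one]

lemma refl_smul (k : ι) (x : M) : refl (P := P) k • x = x - P.coroot' k x • P.root k := by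
  rw [RootPairing.weylGroup.ofIdx_smul, RootPairing.Equiv.reflection_smul,
    RootPairing.reflection_apply]

@[simp] lemma perm_refl_perm_refl (j k : ι) : perm (refl (P := P) j) (perm (refl (P := P) j) k) = k := by
  rw [← perm_mul, refl_mul_self, perm_one]

lemma perm_eq_iff {w : P.weylGroup} {j k : ι} : perm w k = j ↔ k = perm w⁻¹ j :=
  ⟨fun h ↦ by rw [← h, perm_inv_perm], fun h ↦ by rw [h, perm_perm_inv]⟩

lemma coroot'_perm (w : P.weylGroup) : ∀ (k : ι) (x : M),
    P.coroot' (perm w k) (w • x) = P.coroot' k x := by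
  obtain ⟨w, hw⟩ := w
  induction hw using RootPairing.weylGroup.induction with
  | mem i =>
    intro k x
    change P.coroot' (perm (refl i) k) (refl (P := P) i • x) = _
    rw [perm_refl, RootPairing.coroot'_reflectionPerm, LinearMap.comp_apply]
    congr 1
    exact P.reflection_same i x
  | one => intro k x; change P.coroot' (perm 1 k) ((1 : P.weylGroup) • x) = _; simp
  | mul w w' hw hw' h h' =>
    intro k x
    change P.coroot' (perm (⟨w, hw⟩ * ⟨w', hw'⟩) k) (((⟨w, hw⟩ : P.weylGroup) * ⟨w', hw'⟩) • x) = _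
    rw [perm_mul, mul_smul, h, h']

lemma coroot'_opp (k : ι) (x : M) : P.coroot' (opp P k) x = -P.coroot' k x := by
  rw [opp, RootPairing.coroot'_reflectionPerm, LinearMap.comp_apply, LinearEquiv.coe_coe,
    RootPairing.reflection_apply, map_sub, map_smul, RootPairing.root_coroot'_eq_pairing, RootPairing.pairing_same, smul_eq_mul]
  ring

lemma weyl_smul_injective [P.IsRootSystem] {w w' : P.weylGroup}
    (h : ∀ x : M, w • x = w' • x) : w = w' := by
  apply Subtype.ext
  apply RootPairing.Equiv.weightHom_injective P
  ext x
  exact h x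

lemma mul_refl (w : P.weylGroup) (k : ι) [P.IsRootSystem] :
    w * refl k = refl (perm w k) * w := by
  apply weyl_smul_injective
  intro x
  rw [mul_smul, mul_smul, refl_smul, refl_smul, coroot'_perm, smul_sub, root_perm, smul_comm]

lemma refl_eq_of_perm_eq [P.IsRootSystem] {w : P.weylGroup} {j k : ι} (h : perm w k = j) :
    refl j * w = w * refl k := by
  rw [mul_refl, h]

lemma refl_opp [P.IsRootSystem] (k : ι) : refl (P := P) (opp P k) = refl k := by
  apply weyl_smul_injective
  intro x
  rw [refl_smul, refl_smul, coroot'_opp, root_opp, smul_neg, neg_smul, neg_neg]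

/-! #### Positivity -/

variable (b : P.Base)

lemma isPos_opp (k : ι) : b.IsPos (opp P k) ↔ ¬ b.IsPos k :=
  RootPairing.Base.IsPos.neg_iff_not b k

lemma isPos_simple (i : b.support) : b.IsPos i := RootPairing.Base.isPos_of_mem_support i.2

variable [P.IsCrystallographic] [P.IsReduced]

lemma isPos_perm_simple (i : b.support) {k : ι} (hk : b.IsPos k) (hki : k ≠ i) :
    b.IsPos (perm (simpleRefl b i) k) := by
  rw [perm_refl]
  exact hk.reflectionPerm i.2 hki

lemma isPos_perm_simple_iff (i : b.support) {k : ι} (hki : k ≠ i) (hki' : k ≠ opp P i) :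
    b.IsPos (perm (simpleRefl b i) k) ↔ b.IsPos k := by
  refine ⟨fun h ↦ ?_, fun h ↦ isPos_perm_simple b i h hki⟩
  have := isPos_perm_simple b i h fun h' ↦ hki' ?_
  · rwa [← perm_mul, refl_mul_self, perm_one] at this
  · rw [perm_eq_iff.mp h', refl_inv, perm_refl_self]

/-! ### Inversion sets, descents and induction on the Weyl group. -/

open scoped Classical in
/-- The positive roots which `w` makes negative. -/
def inv (w : P.weylGroup) : Finset ι := {k | b.IsPos k ∧ ¬ b.IsPos (perm w k)}

lemma mem_inv {w : P.weylGroup} {k : ι} : k ∈ inv b w ↔ b.IsPos k ∧ ¬ b.IsPos (perm w k) := by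
  simp [inv]

/-- The reflection `σ_i` changes the sign of no root except `±α_i`, so passing from `w` to `σ_i w`
adds the single inversion `w⁻¹ α_i`. Arbitrary commutative monoids are allowed so that powers of
`t`, scalars and monomials are covered at once. -/
lemma prod_inv_simple_mul {C : Type*} [CommMonoid C] (r : ι → C) (i : b.support) (w : P.weylGroup)
    (h : b.IsPos (perm w⁻¹ i)) :
    ∏ k ∈ inv b (simpleRefl b i * w), r k = r (perm w⁻¹ i) * ∏ k ∈ inv b w, r k := by
  classical
  have h1 : perm w⁻¹ i ∉ inv b w := by
    rw [mem_inv, perm_perm_inv]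
    exact fun h ↦ h.2 (isPos_simple b i)
  rw [← Finset.prod_insert h1]
  refine Finset.prod_congr ?_ fun _ _ ↦ rfl
  ext k
  rw [Finset.mem_insert, mem_inv, mem_inv, perm_mul]
  by_cases hk : k = perm w⁻¹ i
  · subst hk
    rw [perm_perm_inv, perm_refl_self, isPos_opp]
    simp [h, isPos_simple b i]
  · simp only [hk, false_or, and_congr_right_iff]
    intro hkp
    rw [isPos_perm_simple_iff]
    · rintro h'
      exact hk (by rw [← h', perm_inv_perm])
    · rintro h'
      have : k = opp P (perm w⁻¹ i) := by rw [← perm_opp, ← h', perm_inv_perm]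
      rw [this, isPos_opp] at hkp
      exact hkp h

lemma prod_inv_simple_mul' {C : Type*} [CommMonoid C] (r : ι → C) (i : b.support) (w : P.weylGroup)
    (h : ¬ b.IsPos (perm w⁻¹ i)) :
    ∏ k ∈ inv b w, r k =
      r (opp P (perm w⁻¹ i)) * ∏ k ∈ inv b (simpleRefl b i * w), r k := by
  have h1 : perm (simpleRefl b i * w)⁻¹ i = opp P (perm w⁻¹ i) := by
    rw [mul_inv_rev, refl_inv, perm_mul, perm_refl_self, perm_opp]
  have := prod_inv_simple_mul b r i (simpleRefl b i * w) (by rw [h1, isPos_opp]; exact h)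
  rwa [h1, refl_mul_refl_mul] at this

/-- Multiplication on the right moves the inversions of `w` by `σ_i` and adds `α_i`, which is not
among the moved ones because `σ_i α_i` is negative. -/
lemma prod_inv_mul_simple {C : Type*} [CommMonoid C] (r : ι → C) (i : b.support) (w : P.weylGroup)
    (h : b.IsPos (perm w i)) :
    ∏ k ∈ inv b (w * simpleRefl b i), r k =
      r i * ∏ k ∈ inv b w, r (perm (simpleRefl b i) k) := by
  classical
  have h1 : (i : ι) ∉ (inv b w).image (perm (simpleRefl b i)) := by
    rw [Finset.mem_image]
    rintro ⟨k, hk, hk'⟩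
    rw [mem_inv] at hk
    have : k = opp P i := by
      rw [perm_eq_iff.mp hk', refl_inv, perm_refl_self]
    rw [this, isPos_opp] at hk
    exact hk.1 (isPos_simple b i)
  rw [← Finset.prod_image (f := r) fun _ _ _ _ h ↦ perm_injective _ h, ← Finset.prod_insert h1]
  refine Finset.prod_congr ?_ fun _ _ ↦ rfl
  ext k
  rw [Finset.mem_insert, Finset.mem_image, mem_inv, perm_mul]
  by_cases hk : k = i
  · subst hk
    rw [perm_refl_self, perm_opp, isPos_opp]
    simp [h, isPos_simple b i]
  · simp only [hk, false_or]
    constructor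
    · rintro ⟨h1, h2⟩
      refine ⟨perm (simpleRefl b i) k, ?_, by rw [← perm_mul, refl_mul_self, perm_one]⟩
      exact (mem_inv b).mpr ⟨isPos_perm_simple b i h1 hk, h2⟩
    · rintro ⟨k', hk', rfl⟩
      rw [mem_inv] at hk'
      rw [← perm_mul _ _ k', refl_mul_self, perm_one]
      refine ⟨isPos_perm_simple b i hk'.1 ?_, hk'.2⟩
      rintro rfl
      exact hk'.2 h

lemma inv_one : inv b (1 : P.weylGroup) = ∅ := by
  ext k; simp [mem_inv]

/-- The exchange condition. Reading the word from the right, the image of `α_i` turns negative at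
some letter `j`, and there the part of the word to the right of it sends `α_i` to `α_j`. Moving
`σ_j` past that part turns it into `σ_i`, so the letter can be deleted. -/
lemma exists_shorter_word [P.IsRootSystem] (i : b.support) (L : List b.support)
    (h : ¬ b.IsPos (perm (L.map (simpleRefl b)).prod i)) :
    ∃ L' : List b.support, (L'.map (simpleRefl b)).prod =
      (L.map (simpleRefl b)).prod * simpleRefl b i ∧ L'.length + 1 = L.length := by
  induction L with
  | nil => simp [isPos_simple b i] at h
  | cons j L ih =>
    rw [List.map_cons, List.prod_cons] at h ⊢
    by_cases hL : b.IsPos (perm (L.map (simpleRefl b)).prod i)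
    · refine ⟨L, ?_, rfl⟩
      have : perm (L.map (simpleRefl b)).prod i = j := by
        by_contra hne
        refine h ?_
        rw [perm_mul]
        exact isPos_perm_simple b j hL hne
      rw [refl_eq_of_perm_eq this, mul_refl_mul_refl]
    · obtain ⟨L', h1, h2⟩ := ih hL
      exact ⟨j :: L', by rw [List.map_cons, List.prod_cons, h1, mul_assoc], by simp [h2]⟩

/-- The last letter of a shortest word is a descent, since otherwise the exchange condition would
shorten the word. -/
lemma exists_descent [P.IsRootSystem] {w : P.weylGroup} (hw : w ≠ 1) :
    ∃ i : b.support, ¬ b.IsPos (perm w i) := by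
  classical
  have hex : ∃ n, ∃ L : List b.support, (L.map (simpleRefl b)).prod = w ∧ L.length = n := by
    obtain ⟨L, hL⟩ := exists_word b w
    exact ⟨_, L, hL, rfl⟩
  obtain ⟨L, hL, hn⟩ := Nat.find_spec hex
  have hmin := fun m ↦ Nat.find_min' hex (m := m)
  rw [← hn] at hmin
  rcases List.eq_nil_or_concat L with rfl | ⟨L, i, rfl⟩
  · exact absurd hL.symm (by simpa using hw)
  · refine ⟨i, fun hpos ↦ ?_⟩
    have e : w = (L.map (simpleRefl b)).prod * simpleRefl b i := by rw [← hL]; simp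
    have h1 : ¬ b.IsPos (perm (L.map (simpleRefl b)).prod i) := by
      rw [e, perm_mul, perm_refl_self, perm_opp, isPos_opp] at hpos
      exact hpos
    obtain ⟨L', h2, h3⟩ := exists_shorter_word b i L h1
    have := hmin _ ⟨L', h2.trans e.symm, rfl⟩
    simp at this
    omega

lemma inv_mul_simple_card (i : b.support) (w : P.weylGroup) (h : ¬ b.IsPos (perm w i)) :
    (inv b (w * simpleRefl b i)).card + 1 = (inv b w).card := by
  have h1 : b.IsPos (perm (w * simpleRefl b i) i) := by
    rw [perm_mul, perm_refl_self, perm_opp, isPos_opp]; exact h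
  -- In `Multiplicative ℕ` the product of the constant `1` counts the inversions.
  have := prod_inv_mul_simple b (fun _ ↦ Multiplicative.ofAdd 1) i (w * simpleRefl b i) h1
  rw [mul_refl_mul_refl] at this
  simp only [Finset.prod_const] at this
  have := congrArg Multiplicative.toAdd this
  simp at this
  omega

/-- Induction on the Weyl group along ascents on the right. -/
lemma weyl_induction [P.IsRootSystem] {p : P.weylGroup → Prop} (one : p 1)
    (mul : ∀ (w : P.weylGroup) (i : b.support), b.IsPos (perm w i) → p w →
      p (w * simpleRefl b i)) (w : P.weylGroup) : p w := by
  induction hn : (inv b w).card using Nat.strong_induction_on generalizing w with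
  | _ n ih =>
    by_cases hw : w = 1
    · exact hw ▸ one
    · obtain ⟨i, hi⟩ := exists_descent b hw
      have h1 := inv_mul_simple_card b i w hi
      have h2 := mul (w * simpleRefl b i) i
        (by rw [perm_mul, perm_refl_self, perm_opp, isPos_opp]; exact hi)
        (ih _ (by omega) _ rfl)
      rwa [mul_refl_mul_refl] at h2

end Combinatorics

section Weights

/-! ### Shifted weights and distinguished representatives -/

variable {ι M N : Type*} [Fintype ι] [AddCommGroup M] [Module ℝ M] [AddCommGroup N] [Module ℝ N]
variable {P : RootPairing ι ℝ M N}

lemma rt_perm (w : P.weylGroup) (k : ι) : rt P (perm w k) = weylMap w (rt P k) :=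
  Subtype.ext (root_perm w k)

lemma rt_opp (k : ι) : rt P (opp P k) = -rt P k := Subtype.ext (root_opp k)

lemma coe_weylMap (w : P.weylGroup) (β : Lat P) : (weylMap w β : M) = w • (β : M) := rfl

lemma coe_rt (k : ι) : (rt P k : M) = P.root k := rfl

section

variable [P.IsCrystallographic]

lemma coe_coroot'In (k : ι) (β : Lat P) : (P.coroot'In ℤ k β : ℝ) = P.coroot' k (β : M) := by
  rw [← P.algebraMap_coroot'In_apply ℤ]
  rfl

lemma coroot'In_perm (w : P.weylGroup) (k : ι) (β : Lat P) :
    P.coroot'In ℤ (perm w k) (weylMap w β) = P.coroot'In ℤ k β := by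
  have : (P.coroot'In ℤ (perm w k) (weylMap w β) : ℝ) = P.coroot'In ℤ k β := by
    rw [coe_coroot'In, coe_coroot'In, coe_weylMap, coroot'_perm]
  exact_mod_cast this

lemma coroot'In_opp (k : ι) (β : Lat P) :
    P.coroot'In ℤ (opp P k) β = -P.coroot'In ℤ k β := by
  have : (P.coroot'In ℤ (opp P k) β : ℝ) = -P.coroot'In ℤ k β := by
    rw [coe_coroot'In, coe_coroot'In, coroot'_opp]
  exact_mod_cast this

lemma coroot'In_rt (k j : ι) : P.coroot'In ℤ k (rt P j) = P.pairingIn ℤ j k :=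
  RootPairing.coroot'In_rootSpanMem_eq_pairingIn ..

lemma weylMap_refl (k : ι) (β : Lat P) :
    weylMap (refl k) β = β - P.coroot'In ℤ k β • rt P k := by
  apply Subtype.ext
  rw [coe_weylMap, refl_smul, ← coe_coroot'In]
  change _ = (β : M) - ((P.coroot'In ℤ k β • rt P k : Lat P) : M)
  rw [Submodule.coe_smul, ← Int.cast_smul_eq_zsmul ℝ]

lemma rootLength_perm (w : P.weylGroup) (k : ι) :
    (P.posRootForm ℤ).rootLength (perm w k) = (P.posRootForm ℤ).rootLength k := by
  apply FaithfulSMul.algebraMap_injective ℤ ℝ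
  rw [RootPairing.RootPositiveForm.algebraMap_rootLength,
    RootPairing.RootPositiveForm.algebraMap_rootLength, root_perm]
  exact RootPairing.InvariantForm.apply_weylGroup_smul P
    (B := (P.posRootForm ℤ).toInvariantForm) w _ _

lemma normSq_perm (w : P.weylGroup) (k : ι) : normSq P (perm w k) = normSq P k := by
  rw [normSq, normSq, rootLength_perm]

lemma mInt_perm (w : P.weylGroup) (n : ℕ) (k : ι) : mInt P n (perm w k) = mInt P n k := by
  rw [mInt, mInt, normSq_perm]

lemma normSq_opp (k : ι) : normSq P (opp P k) = normSq P k := by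
  rw [← perm_refl_self, normSq_perm]

lemma mInt_opp (n : ℕ) (k : ι) : mInt P n (opp P k) = mInt P n k := by
  rw [mInt, mInt, normSq_opp]

lemma mInt_pos (n : ℕ) [NeZero n] (k : ι) : 0 < mInt P n k :=
  Nat.div_pos (Nat.le_of_dvd (NeZero.pos n) (Nat.gcd_dvd_left _ _))
    (Nat.gcd_pos_of_pos_left _ (NeZero.pos n))

/-- `m(α_k)` divides `r` as soon as `n` divides `‖α_k‖² r`. -/
lemma mInt_dvd_of_dvd (n : ℕ) [NeZero n] (k : ι) {r : ℤ} (h : (n : ℤ) ∣ normSq P k * r) :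
    (mInt P n k : ℤ) ∣ r := by
  have hg : 0 < n.gcd (normSq P k) := Nat.gcd_pos_of_pos_left _ (NeZero.pos n)
  rw [← Int.natAbs_dvd_natAbs, Int.natAbs_natCast] at h ⊢
  rw [Int.natAbs_mul, Int.natAbs_natCast] at h
  refine Nat.Coprime.dvd_of_dvd_mul_left (Nat.coprime_div_gcd_div_gcd hg) ?_
  refine Nat.dvd_of_mul_dvd_mul_right hg ?_
  rwa [mInt, Nat.div_mul_cancel (Nat.gcd_dvd_left _ _), mul_right_comm,
    Nat.div_mul_cancel (Nat.gcd_dvd_right _ _)]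

lemma dvd_iff_mInt_dvd (n : ℕ) [NeZero n] (k : ι) {r : ℤ} :
    (n : ℤ) ∣ normSq P k * r ↔ (mInt P n k : ℤ) ∣ r := by
  refine ⟨mInt_dvd_of_dvd n k, fun h ↦ dvd_trans ?_ (mul_dvd_mul_left _ h)⟩
  exact_mod_cast dvd_normSq_mul_mInt n k

variable [P.IsRootSystem] [P.IsReduced] [P.IsIrreducible]

lemma normSq_pos (k : ι) : 0 < normSq P k := by
  have h1 := normSq_mul (P := P) k
  have h2 := (P.posRootForm ℤ).rootLength_pos k
  by_contra h
  rw [Nat.eq_zero_of_not_pos h, Nat.cast_zero, zero_mul] at h1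
  omega

/-- By the symmetry of `⟨α_j, α_k^∨⟩ ‖α_k‖²` in `j` and `k`, the number in question times `‖α_k‖²`
is a multiple of `‖α_j‖² m(α_j)`, hence of `n`. In effect the vectors `m(α) α` have integral Cartan
numbers among themselves. -/
lemma mInt_dvd_coroot'In_smul (n : ℕ) [NeZero n] (k j : ι) :
    (mInt P n k : ℤ) ∣ P.coroot'In ℤ k (mInt P n j • rt P j) := by
  refine mInt_dvd_of_dvd n k ?_
  rw [map_nsmul, coroot'In_rt, nsmul_eq_mul, mul_left_comm, mul_comm (normSq P k : ℤ),
    normSq_mul_pairing, mul_left_comm, mul_comm (mInt P n j : ℤ)]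
  refine Dvd.dvd.mul_left ?_ _
  exact_mod_cast dvd_normSq_mul_mInt n j

lemma weylMap_mem_subLat (n : ℕ) (w : P.weylGroup) {x : Lat P} (hx : x ∈ subLat P n) :
    weylMap w x ∈ subLat P n := by
  induction hx using AddSubgroup.closure_induction with
  | mem x hx =>
    obtain ⟨j, rfl⟩ := hx
    rw [map_nsmul, ← rt_perm, ← mInt_perm w]
    exact AddSubgroup.subset_closure ⟨_, rfl⟩
  | zero => simp
  | add x y _ _ hx hy => rw [map_add]; exact add_mem hx hy
  | neg x _ hx => rw [map_neg]; exact neg_mem hx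

lemma mInt_smul_mem (n : ℕ) (k : ι) : mInt P n k • rt P k ∈ subLat P n :=
  AddSubgroup.subset_closure ⟨k, rfl⟩

end

/-! #### The invariant form -/

section Form

variable [P.IsCrystallographic]

lemma two_mul_rootForm (x : M) (k : ι) :
    2 * P.RootForm x (P.root k) = P.coroot' k x * P.RootForm (P.root k) (P.root k) := by
  have h := P.rootForm_reflection_reflection_apply k x (P.root k)
  rw [RootPairing.reflection_apply, RootPairing.reflection_apply_self, map_neg, map_sub,
    LinearMap.sub_apply, map_smul, LinearMap.smul_apply, smul_eq_mul] at h
  linarith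

lemma rootForm_root_self_pos (k : ι) : 0 < P.RootForm (P.root k) (P.root k) := by
  have h := (P.posRootForm ℤ).rootLength_pos k
  have h2 := (P.posRootForm ℤ).algebraMap_rootLength k
  have h3 : (P.posRootForm ℤ).form (P.root k) (P.root k) = P.RootForm (P.root k) (P.root k) := by
    rfl
  rw [← h3, ← h2]
  exact Int.cast_pos.mpr h

lemma rootForm_symm (x y : M) : P.RootForm x y = P.RootForm y x := by
  rw [RootPairing.rootForm_apply_apply, RootPairing.rootForm_apply_apply]
  exact Finset.sum_congr rfl fun _ _ ↦ mul_comm _ _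

lemma rootForm_sub_smul (x : M) (c : ℝ) (k : ι) :
    P.RootForm (x - c • P.root k) (x - c • P.root k) = P.RootForm x x +
      c * (c - P.coroot' k x) * P.RootForm (P.root k) (P.root k) := by
  have h := two_mul_rootForm (P := P) x k
  simp only [map_sub, map_smul, LinearMap.sub_apply, LinearMap.smul_apply, smul_eq_mul,
    rootForm_symm (P.root k) x]
  linear_combination (-c) * h

end Form

/-! ### Dominant vectors and a dominant shortest vector among the `m(α) α`. -/

variable (b : P.Base)

lemma rt_eq_sum_of_isPos {k : ι} (hk : b.IsPos k) :
    ∃ f : b.support → ℕ, rt P k = ∑ j, f j • rt P j := by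
  obtain ⟨f, hf, h | h⟩ := b.exists_root_eq_sum_nat_or_neg k
  · refine ⟨fun j ↦ f j, Subtype.ext ?_⟩
    rw [coe_rt, h, ← Finset.sum_coe_sort b.support, AddSubmonoidClass.coe_finsetSum]
    rfl
  · exfalso
    have h2 : P.root k = ∑ j ∈ b.support, (fun j ↦ -(f j : ℤ)) j • P.root j := by
      rw [h, ← Finset.sum_neg_distrib]
      simp
    rw [RootPairing.Base.isPos_iff, RootPairing.Base.height_eq_sum h2] at hk
    have : ∑ j ∈ b.support, -(f j : ℤ) ≤ 0 := Finset.sum_nonpos fun j _ ↦ by simp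
    omega

/-- The sign of `⟨x, α^∨⟩` is that of `(x, α)` for the invariant form, and the latter is additive in
`α`. -/
lemma coroot'_nonneg_of_simple [P.IsCrystallographic] {x : M}
    (h : ∀ i : b.support, 0 ≤ P.coroot' i x) {k : ι} (hk : b.IsPos k) : 0 ≤ P.coroot' k x := by
  obtain ⟨f, hf⟩ := rt_eq_sum_of_isPos b hk
  have hf' : P.root k = ∑ j, f j • P.root j := by
    rw [← coe_rt, hf, AddSubmonoidClass.coe_finsetSum]
    rfl
  have hs : ∀ i : b.support, 0 ≤ P.RootForm x (P.root i) := fun i ↦ by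
    have := two_mul_rootForm (P := P) x i
    have := mul_nonneg (h i) (rootForm_root_self_pos (P := P) i).le
    linarith
  have h1 : 0 ≤ P.RootForm x (P.root k) := by
    rw [hf', map_sum]
    refine Finset.sum_nonneg fun j _ ↦ ?_
    rw [map_nsmul, nsmul_eq_mul]
    exact mul_nonneg (Nat.cast_nonneg _) (hs j)
  have h2 := two_mul_rootForm (P := P) x k
  have h3 := rootForm_root_self_pos (P := P) k
  by_contra hneg
  have := mul_neg_of_neg_of_pos (not_le.mp hneg) h3
  linarith

variable [P.IsCrystallographic] [P.IsReduced] [P.IsRootSystem]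

/-- Choose `w` maximising the sum of `⟨w x, α^∨⟩` over `α > 0`. As `σ_i` permutes the positive roots
other than `α_i`, replacing `w` by `σ_i w` changes the sum by `-2 ⟨w x, α_i^∨⟩`, so this pairing is
nonnegative. -/
lemma exists_dominant (x : M) : ∃ w : P.weylGroup, ∀ k, b.IsPos k → 0 ≤ P.coroot' k (w • x) := by
  classical
  obtain ⟨w, hw⟩ := Finite.exists_max fun w : P.weylGroup ↦
    ∑ k with b.IsPos k, P.coroot' k (w • x)
  refine ⟨w, fun k hk ↦ coroot'_nonneg_of_simple b (fun i ↦ ?_) hk⟩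
  have h := hw (simpleRefl b i * w)
  by_contra hneg
  refine not_lt.mpr h ?_
  have hmem : (i : ι) ∈ Finset.univ.filter fun k ↦ b.IsPos k := by simp [isPos_simple b i]
  rw [← Finset.add_sum_erase _ _ hmem, ← Finset.add_sum_erase _ _ hmem]
  have h1 : ∀ k, P.coroot' k ((simpleRefl b i * w) • x) =
      P.coroot' (perm (simpleRefl b i) k) (w • x) := fun k ↦ by
    rw [mul_smul]
    conv_lhs => rw [← perm_refl_perm_refl (P := P) i k]
    rw [coroot'_perm]
  simp only [h1]
  rw [perm_refl_self, coroot'_opp]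
  have h2 : ∑ k ∈ (Finset.univ.filter fun k ↦ b.IsPos k).erase i,
      P.coroot' (perm (simpleRefl b i) k) (w • x) =
      ∑ k ∈ (Finset.univ.filter fun k ↦ b.IsPos k).erase i, P.coroot' k (w • x) := by
    refine Finset.sum_nbij' (perm (simpleRefl b i)) (perm (simpleRefl b i)) ?_ ?_ ?_ ?_ ?_
    · intro k hk
      simp only [Finset.mem_erase, Finset.mem_filter, Finset.mem_univ, true_and] at hk ⊢
      refine ⟨fun h' ↦ ?_, isPos_perm_simple b i hk.2 hk.1⟩
      rw [perm_eq_iff, refl_inv, perm_refl_self] at h'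
      rw [h', isPos_opp] at hk
      exact hk.2 (isPos_simple b i)
    · intro k hk
      simp only [Finset.mem_erase, Finset.mem_filter, Finset.mem_univ, true_and] at hk ⊢
      refine ⟨fun h' ↦ ?_, isPos_perm_simple b i hk.2 hk.1⟩
      rw [perm_eq_iff, refl_inv, perm_refl_self] at h'
      rw [h', isPos_opp] at hk
      exact hk.2 (isPos_simple b i)
    · intro k _; simp
    · intro k _; simp
    · intro k _; rfl
  rw [h2]
  linarith

/-- A dominant root `ϑ` for which `m(ϑ) ϑ` is a shortest one among the vectors `m(α) α`. -/
lemma exists_quasiMinuscule [P.IsIrreducible] (n : ℕ) [NeZero n] : ∃ j, b.IsPos j ∧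
    ∀ k, b.IsPos k → k ≠ j → P.pairingIn ℤ j k = 0 ∨
      (mInt P n j * P.pairingIn ℤ j k = mInt P n k ∧ ¬ b.IsPos (perm (refl (P := P) j) k)) := by
  have hne : Nonempty ι := by
    have hnt : Nontrivial M := RootPairing.IsIrreducible.nontrivial P
    by_contra hι
    have he : IsEmpty ι := not_nonempty_iff.mp hι
    have : Submodule.span ℝ (Set.range P.root) = ⊤ :=
      RootPairing.IsRootSystem.span_root_eq_top (P := P)
    rw [Set.range_eq_empty, Submodule.span_empty] at this
    exact bot_ne_top this
  obtain ⟨j₀, hj₀⟩ := Finite.exists_min fun k : ι ↦ mInt P n k ^ 2 * normSq P k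
  obtain ⟨w, hw⟩ := exists_dominant b (P.root j₀)
  set j := perm w j₀ with hj
  have hmin : ∀ k, mInt P n j ^ 2 * normSq P j ≤ mInt P n k ^ 2 * normSq P k := fun k ↦ by
    rw [hj, mInt_perm, normSq_perm]
    exact hj₀ k
  have hdom : ∀ k, b.IsPos k → 0 ≤ P.pairingIn ℤ j k := fun k hk ↦ by
    have := hw k hk
    rw [← root_perm, RootPairing.root_coroot'_eq_pairing, ← P.algebraMap_pairingIn ℤ, eq_intCast] at this
    exact_mod_cast this
  have hjp : b.IsPos j := by
    by_contra hneg
    have := hdom (opp P j) ((isPos_opp b j).mpr hneg)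
    rw [← coroot'In_rt, coroot'In_opp, coroot'In_rt, RootPairing.pairingIn_same] at this
    omega
  refine ⟨j, hjp, fun k hk hkj ↦ ?_⟩
  rcases (hdom k hk).eq_or_lt with h0 | hpos
  · exact Or.inl h0.symm
  · refine Or.inr ⟨?_, fun hneg ↦ ?_⟩
    · have hdvd := mInt_dvd_coroot'In_smul (P := P) n k j
      rw [map_nsmul, coroot'In_rt, nsmul_eq_mul] at hdvd
      obtain ⟨c, hc⟩ := hdvd
      have hmk : (0 : ℤ) < mInt P n k := by exact_mod_cast mInt_pos (P := P) n k
      have hmj : (0 : ℤ) < mInt P n j := by exact_mod_cast mInt_pos (P := P) n j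
      have hnk : (0 : ℤ) < normSq P k := by exact_mod_cast normSq_pos (P := P) k
      have hc0 : 0 < c := by
        have := mul_pos hmj hpos
        rw [hc] at this
        exact (mul_pos_iff_of_pos_left hmk).mp this
      -- Distinct positive roots of a reduced system are not proportional, so the product of the two
      -- Cartan numbers is not `4`.
      have hw3 : P.pairingIn ℤ j k * P.pairingIn ℤ k j ≤ 3 := by
        have h4 := P.pairingIn_pairingIn_mem_set_of_isCrystal_of_isRed j k
        have hne1 : P.pairingIn ℤ j k * P.pairingIn ℤ k j ≠ 4 := by
          refine P.coxeterWeightIn_ne_four ℤ hkj.symm ?_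
          intro h
          rw [← root_opp, EmbeddingLike.apply_eq_iff_eq] at h
          rw [h, isPos_opp] at hjp
          exact hjp hk
        simp only [Set.mem_insert_iff, Set.mem_singleton_iff, Prod.mk.injEq] at h4
        rcases h4 with h | h | h | h | h | h | h | h | h | h | h | h | h <;>
          rw [h.1, h.2] at hne1 ⊢ <;> lia
      have hlen : (mInt P n j : ℤ) ^ 2 * normSq P j ≤ (mInt P n k : ℤ) ^ 2 * normSq P k := by
        exact_mod_cast hmin k
      have hsym := normSq_mul_pairing (P := P) k j
      -- The Cartan numbers of the vectors `m(α) α` have the same product as those of the roots.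
      -- With the minimality of `j` this gives `c ^ 2 ≤ 3`, so `c = 1`.
      have e1 : c ^ 2 * ((mInt P n k : ℤ) ^ 2 * normSq P k) =
          (P.pairingIn ℤ j k * P.pairingIn ℤ k j) * ((mInt P n j : ℤ) ^ 2 * normSq P j) := by
        calc c ^ 2 * ((mInt P n k : ℤ) ^ 2 * normSq P k)
            = ((mInt P n k : ℤ) * c) ^ 2 * normSq P k := by ring
          _ = ((mInt P n j : ℤ)) ^ 2 * P.pairingIn ℤ j k * (P.pairingIn ℤ j k * normSq P k) := by
              rw [← hc]; ring
          _ = _ := by rw [hsym]; ring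
      have hpk : 0 < (mInt P n k : ℤ) ^ 2 * normSq P k := by positivity
      have hpj : 0 ≤ (mInt P n j : ℤ) ^ 2 * normSq P j := by positivity
      have hc2 : c < 2 := by
        by_contra hge
        have : 4 ≤ c ^ 2 := by nlinarith
        nlinarith
      have : c = 1 := by omega
      rw [hc, this, mul_one]
    -- Were the reflected root positive, its coroot would pair with the dominant root to minus a
    -- positive number.
    · have h1 := hdom _ hneg
      rw [← coroot'In_rt, ← coroot'In_perm (refl (P := P) j), perm_refl_perm_refl, ← rt_perm,
        perm_refl_self, rt_opp, map_neg, coroot'In_rt] at h1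
      omega

/-! #### The shifted action -/

lemma exists_weight (c : b.support → ℝ) : ∃ θ : M, ∀ i : b.support, P.coroot' i θ = c i := by
  let φ : Module.Dual ℝ N := b.toCoweightBasis.constr ℝ c
  obtain ⟨θ, hθ⟩ := (LinearMap.IsPerfPair.bijective_left P.toLinearMap).2 φ
  refine ⟨θ, fun i ↦ ?_⟩
  change P.toLinearMap θ (P.coroot i) = c i
  rw [hθ, ← b.toCoweightBasis_apply, Module.Basis.constr_basis]

variable (l : b.support → ℕ)

/-- The weight `θ` with `⟨θ, αᵢ^∨⟩ = lᵢ + 1`. -/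
def theta : M := (exists_weight b fun i ↦ (l i : ℝ) + 1).choose

lemma coroot'_theta (i : b.support) : P.coroot' i (theta b l) = l i + 1 :=
  (exists_weight b fun i ↦ (l i : ℝ) + 1).choose_spec i

/-- Every coroot is an integral combination of simple coroots, and on those the values `l_i + 1` are
integers. -/
lemma exists_int_theta (k : ι) : ∃ z : ℤ, P.coroot' k (theta b l) = z := by
  have key : ∀ x ∈ Submodule.span ℤ (P.coroot '' b.support),
      ∃ z : ℤ, P.toLinearMap (theta b l) x = z := by
    intro x hx
    induction hx using Submodule.span_induction with
    | mem x hx =>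
      obtain ⟨i, hi, rfl⟩ := hx
      exact ⟨l ⟨i, hi⟩ + 1, by simpa using coroot'_theta b l ⟨i, hi⟩⟩
    | zero => exact ⟨0, by simp⟩
    | add x y _ _ hx hy =>
      obtain ⟨z, hz⟩ := hx
      obtain ⟨z', hz'⟩ := hy
      exact ⟨z + z', by rw [map_add, hz, hz', Int.cast_add]⟩
    | smul t x _ hx =>
      obtain ⟨z, hz⟩ := hx
      exact ⟨t * z, by rw [map_zsmul, hz, zsmul_eq_mul, Int.cast_mul]⟩
  exact key _ (b.coroot_mem_span_int k)

/-- The integer `⟨θ, α_k^∨⟩`. -/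
def tau (k : ι) : ℤ := (exists_int_theta b l k).choose

lemma coe_tau (k : ι) : (tau b l k : ℝ) = P.coroot' k (theta b l) :=
  (exists_int_theta b l k).choose_spec.symm

lemma tau_simple (i : b.support) : tau b l i = l i + 1 := by
  have : (tau b l i : ℝ) = l i + 1 := by rw [coe_tau, coroot'_theta]
  exact_mod_cast this

/-- The integer `⟨β - θ, α_k^∨⟩`. -/
def shp (k : ι) (β : Lat P) : ℤ := P.coroot'In ℤ k β - tau b l k

lemma coe_shp (k : ι) (β : Lat P) : (shp b l k β : ℝ) = P.coroot' k ((β : M) - theta b l) := by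
  rw [shp, Int.cast_sub, coe_coroot'In, coe_tau, map_sub]

lemma mu_eq_neg_shp (i : b.support) (β : Lat P) : mu b l i β = -shp b l i β := by
  rw [mu_eq, shp, tau_simple]
  ring

lemma shp_opp (k : ι) (β : Lat P) : shp b l (opp P k) β = -shp b l k β := by
  have : (shp b l (opp P k) β : ℝ) = -shp b l k β := by rw [coe_shp, coe_shp, coroot'_opp]
  exact_mod_cast this

/-- The weight `θ` need not lie in `Λ`, but `θ - w θ` does, since each reflection subtracts an
integral multiple of a root. This makes the dot action of all of `W` well defined on `Λ`. -/
lemma exists_theta_sub (w : P.weylGroup) :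
    ∃ x : Lat P, (x : M) = theta b l - w • theta b l := by
  obtain ⟨L, rfl⟩ := exists_word b w
  induction L with
  | nil => exact ⟨0, by simp⟩
  | cons i L ih =>
    obtain ⟨x, hx⟩ := ih
    refine ⟨weylMap (simpleRefl b i) x + tau b l i • rt P i, ?_⟩
    have h1 : simpleRefl b i • theta b l = theta b l - P.coroot' i (theta b l) • P.root i :=
      refl_smul _ _
    rw [List.map_cons, List.prod_cons, mul_smul, Submodule.coe_add, coe_weylMap, hx, smul_sub,
      h1, Submodule.coe_smul, ← Int.cast_smul_eq_zsmul ℝ, coe_tau, coe_rt]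
    abel

/-- The element `θ - w θ` of the root lattice. -/
def thetaSub (w : P.weylGroup) : Lat P := (exists_theta_sub b l w).choose

lemma coe_thetaSub (w : P.weylGroup) : (thetaSub b l w : M) = theta b l - w • theta b l :=
  (exists_theta_sub b l w).choose_spec

/-- The action `w • β = w (β - θ) + θ` of the Weyl group on the root lattice. -/
def dotW (w : P.weylGroup) (β : Lat P) : Lat P := weylMap w β + thetaSub b l w

lemma coe_dotW (w : P.weylGroup) (β : Lat P) :
    (dotW b l w β : M) = w • ((β : M) - theta b l) + theta b l := by
  rw [dotW, Submodule.coe_add, coe_weylMap, coe_thetaSub, smul_sub]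
  abel

lemma dotW_one (β : Lat P) : dotW b l 1 β = β := by
  apply Subtype.ext
  rw [coe_dotW]
  simp

lemma dotW_mul (w w' : P.weylGroup) (β : Lat P) :
    dotW b l (w * w') β = dotW b l w (dotW b l w' β) := by
  apply Subtype.ext
  rw [coe_dotW, coe_dotW, coe_dotW, mul_smul, add_sub_cancel_right]

lemma dotW_simple (i : b.support) (β : Lat P) : dotW b l (simpleRefl b i) β = dot b l i β := by
  apply Subtype.ext
  rw [coe_dotW, coe_dot b l i β (theta b l) (coroot'_theta b l i)]

lemma dotW_refl (k : ι) (β : Lat P) : dotW b l (refl k) β = β - shp b l k β • rt P k := by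
  apply Subtype.ext
  rw [coe_dotW, refl_smul, ← coe_shp]
  change _ = (β : M) - ((shp b l k β • rt P k : Lat P) : M)
  rw [Submodule.coe_smul, ← Int.cast_smul_eq_zsmul ℝ, coe_rt]
  abel

lemma shp_dotW (w : P.weylGroup) (k : ι) (β : Lat P) :
    shp b l (perm w k) (dotW b l w β) = shp b l k β := by
  have : (shp b l (perm w k) (dotW b l w β) : ℝ) = shp b l k β := by
    rw [coe_shp, coe_shp, coe_dotW, add_sub_cancel_right, coroot'_perm]
  exact_mod_cast this

/-! ### The alcove for the dot action and translations by `Λ'`. -/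

variable [P.IsIrreducible] (n : ℕ) [NeZero n]

/-- Take `κ` minimising the length of `β + κ - θ`. With `m = m(α)` and `s = ⟨β + κ - θ, α^∨⟩`,
subtracting `m α` changes the squared length by `m (m - s) (α, α)`, which must be nonnegative. -/
lemma exists_small_representative (β : Lat P) : ∃ κ ∈ subLat P n,
    ∀ k, shp b l k (β + κ) ≤ mInt P n k := by
  -- The root form is the sum of the squares of the pairings with all coroots; these are integers
  -- here, so the squared length is a natural number and a minimum exists.
  let F : Lat P → ℕ := fun κ ↦ ∑ k, (shp b l k (β + κ)).natAbs ^ 2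
  have hF : ∀ κ, (F κ : ℝ) = P.RootForm (((β + κ : Lat P) : M) - theta b l)
      (((β + κ : Lat P) : M) - theta b l) := fun κ ↦ by
    rw [RootPairing.rootForm_apply_apply, Nat.cast_sum]
    refine Finset.sum_congr rfl fun k _ ↦ ?_
    change _ = P.coroot' k _ * P.coroot' k _
    rw [← coe_shp, Nat.cast_pow, Nat.cast_natAbs, Int.cast_abs, sq_abs, sq]
  obtain ⟨κ, hκ, hmin⟩ : ∃ κ ∈ subLat P n, ∀ κ' ∈ subLat P n, F κ ≤ F κ' := by
    obtain ⟨κ, hκ⟩ := exists_minimal_of_wellFoundedLT (fun x ↦ ∃ κ ∈ subLat P n, F κ = x)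
      ⟨_, 0, zero_mem _, rfl⟩
    obtain ⟨⟨κ₀, h0, rfl⟩, h2⟩ := hκ
    exact ⟨κ₀, h0, fun κ' hκ' ↦ (le_total (F κ₀) (F κ')).elim id fun h ↦ h2 ⟨κ', hκ', rfl⟩ h⟩
  refine ⟨κ, hκ, fun k ↦ ?_⟩
  have h1 := hmin (κ - mInt P n k • rt P k) (sub_mem hκ (mInt_smul_mem n k))
  have h2 : ((β + (κ - mInt P n k • rt P k) : Lat P) : M) - theta b l =
      (((β + κ : Lat P) : M) - theta b l) - (mInt P n k : ℝ) • P.root k := by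
    rw [Nat.cast_smul_eq_nsmul ℝ, ← coe_rt]
    push_cast
    change (β : M) + ((κ : M) - mInt P n k • (rt P k : M)) - _ = _
    abel
  have h3 : (F κ : ℝ) ≤ F (κ - mInt P n k • rt P k) := by exact_mod_cast h1
  rw [hF, hF, h2, rootForm_sub_smul, ← coe_shp] at h3
  have h4 := rootForm_root_self_pos (P := P) k
  have h5 : (0 : ℝ) < mInt P n k := by exact_mod_cast mInt_pos (P := P) n k
  by_contra hlt
  have h6 : (mInt P n k : ℝ) < shp b l k (β + κ) := by exact_mod_cast not_le.mp hlt
  have h7 : (mInt P n k : ℝ) * (mInt P n k - shp b l k (β + κ)) *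
      P.RootForm (P.root k) (P.root k) < 0 :=
    mul_neg_of_neg_of_pos (mul_neg_of_pos_of_neg h5 (by linarith)) h4
  linarith

/-- Every class in `Λ` modulo `Λ'` and the dot action contains an element of the alcove. -/
lemma exists_alcove_representative (β : Lat P) : ∃ β₀ : Lat P, ∃ w : P.weylGroup, ∃ κ ∈ subLat P n,
    (∀ k, b.IsPos k → 0 ≤ shp b l k β₀ ∧ shp b l k β₀ ≤ mInt P n k) ∧
      β = dotW b l w β₀ + κ := by
  obtain ⟨κ, hκ, h⟩ := exists_small_representative b l n β
  -- The upper bounds hold for all roots and `m` is `W`-invariant, so they survive the move to the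
  -- dominant chamber.
  obtain ⟨w, hw⟩ := exists_dominant b (((β + κ : Lat P) : M) - theta b l)
  refine ⟨dotW b l w (β + κ), w⁻¹, -κ, neg_mem hκ, fun k hk ↦ ⟨?_, ?_⟩, ?_⟩
  · have h1 := hw k hk
    have : (0 : ℝ) ≤ shp b l k (dotW b l w (β + κ)) := by
      rwa [coe_shp, coe_dotW, add_sub_cancel_right]
    exact_mod_cast this
  · have := h (perm w⁻¹ k)
    rwa [← shp_dotW b l w, perm_perm_inv, mInt_perm] at this
  · rw [← dotW_mul, inv_mul_cancel, dotW_one, add_neg_cancel_right]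

end Weights

section Universal

/-! ### The universal module -/

variable {ι M N : Type*} [Fintype ι] [AddCommGroup M] [Module ℝ M] [AddCommGroup N] [Module ℝ N]
variable {P : RootPairing ι ℝ M N} (b : P.Base) (q : ℕ) [NeZero q]

/-- The normalised monomial `y ^ β = q ^ d(β) x ^ β`. -/
def ym (β : Lat P) : Laurent (Lat P) := AddMonoidAlgebra.single β ((q : ℂ) ^ ht b β)

lemma ym_zero : ym b q 0 = 1 := by simp [ym, AddMonoidAlgebra.one_def]

lemma ym_add (β β' : Lat P) : ym b q (β + β') = ym b q β * ym b q β' := by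
  rw [ym, ym, ym, AddMonoidAlgebra.single_mul_single, map_add, zpow_add₀ (NeZero.ne _)]

lemma ym_neg_mul (β : Lat P) : ym b q (-β) * ym b q β = 1 := by
  rw [← ym_add, neg_add_cancel, ym_zero]

lemma ym_ne_zero (β : Lat P) : ym b q β ≠ 0 := by
  intro h
  have := ym_neg_mul b q β
  rw [h, mul_zero] at this
  exact zero_ne_one this

lemma ym_injective : Function.Injective (ym b q) := by
  intro β β' h
  by_contra hne
  have h2 : (ym b q β).coeff β = (ym b q β').coeff β := by rw [h]
  rw [ym, ym, AddMonoidAlgebra.coeff_single, AddMonoidAlgebra.coeff_single,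
    Finsupp.single_eq_same, Finsupp.single_eq_of_ne hne] at h2
  exact zpow_ne_zero _ (NeZero.ne _) h2

lemma twistHom_ym (w : P.weylGroup) (β : Lat P) :
    twistHom b q w (ym b q β) = ym b q (weylMap w⁻¹ β) := by
  rw [ym, twistHom_single, ym, ← zpow_add₀ (NeZero.ne _), ← map_add, add_sub_cancel]

lemma twistHom_mul (w w' : P.weylGroup) (f : Laurent (Lat P)) :
    twistHom b q (w * w') f = twistHom b q w' (twistHom b q w f) := by
  have : twistHom b q (w * w') = (twistHom b q w').comp (twistHom b q w) := by
    refine AddMonoidAlgebra.algHom_ext (fun β ↦ ?_) ?_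
    · have hq : (q : ℂ) ≠ 0 := NeZero.ne _
      simp only [AlgHom.comp_apply, twistHom_single, mul_inv_rev, weylMap_mul, one_mul,
        ← zpow_add₀ hq, ← map_add]
      simp
    · ext
  rw [this, AlgHom.comp_apply]

lemma twistHom_one (f : Laurent (Lat P)) : twistHom b q 1 f = f := by
  apply twistHom_injective b q 1
  rw [← twistHom_mul, one_mul]

/-- Laurent polynomials with an additional variable, a square root of `1/q`. -/
abbrev GenRing (P : RootPairing ι ℝ M N) : Type _ := Polynomial (Laurent (Lat P))

/-- The action of the Weyl group on `GenRing`. -/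
def tw (w : P.weylGroup) : GenRing P →+* GenRing P :=
  Polynomial.mapRingHom (twistHom b q w : Laurent (Lat P) →+* Laurent (Lat P))

/-- The monomial `y ^ β` in `GenRing`. -/
def yg (β : Lat P) : GenRing P := Polynomial.C (ym b q β)

lemma yg_zero : yg b q 0 = 1 := by rw [yg, ym_zero, map_one]

lemma yg_add (β β' : Lat P) : yg b q (β + β') = yg b q β * yg b q β' := by
  rw [yg, ym_add, map_mul]; rfl

lemma yg_neg_mul (β : Lat P) : yg b q (-β) * yg b q β = 1 := by
  rw [← yg_add, neg_add_cancel, yg_zero]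

lemma tw_yg (w : P.weylGroup) (β : Lat P) : tw b q w (yg b q β) = yg b q (weylMap w⁻¹ β) := by
  rw [tw, yg, Polynomial.coe_mapRingHom, Polynomial.map_C]
  exact congrArg Polynomial.C (twistHom_ym b q w β)

lemma tw_X (w : P.weylGroup) : tw b q w Polynomial.X = Polynomial.X := by
  rw [tw, Polynomial.coe_mapRingHom, Polynomial.map_X]

lemma tw_mul (w w' : P.weylGroup) (f : GenRing P) : tw b q (w * w') f = tw b q w' (tw b q w f) := by
  rw [tw, tw, tw, Polynomial.coe_mapRingHom, Polynomial.coe_mapRingHom, Polynomial.coe_mapRingHom,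
    Polynomial.map_map]
  exact congrArg (Polynomial.map · f) (RingHom.ext fun x ↦ twistHom_mul b q w w' x)

lemma tw_one (f : GenRing P) : tw b q 1 f = f := by
  have : (twistHom b q (1 : P.weylGroup) : Laurent (Lat P) →+* Laurent (Lat P)) = RingHom.id _ :=
    RingHom.ext fun x ↦ twistHom_one b q x
  rw [tw, this, Polynomial.mapRingHom_id, RingHom.id_apply]

/-- The universal module: functions on the Weyl group. -/
abbrev UMod (P : RootPairing ι ℝ M N) : Type _ := P.weylGroup → GenRing P

variable [P.IsCrystallographic] (n : ℕ)

/-- The element `Y_k = y ^ (m(α_k) α_k)` of `GenRing`. -/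
def yRoot (k : ι) : GenRing P := yg b q (mInt P n k • rt P k)

open scoped Classical in
/-- The coefficient `1` or `Y_i`, according to the sign of `u⁻¹ αᵢ`. -/
def signCoeff (i : b.support) (u : P.weylGroup) : GenRing P :=
  if b.IsPos (perm u⁻¹ i) then 1 else yRoot b q n i

/-- The generic form of the operator of a simple reflection, with denominators cleared. -/
def genOp (i : b.support) (f : UMod P) : UMod P := fun u ↦
  Polynomial.X * (1 - yRoot b q n i) * tw b q (simpleRefl b i) (f (simpleRefl b i * u)) +
    (1 - Polynomial.X ^ 2) * signCoeff b q n i u * tw b q (simpleRefl b i) (f u)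

open scoped Classical in
/-- The coefficient `0` or `t ^ 2 - 1`, according to the sign of `u α_j`. -/
def heckeCoeff (j : ι) (u : P.weylGroup) : GenRing P :=
  if b.IsPos (perm u j) then 0 else Polynomial.X ^ 2 - 1

/-- The operator of an affine reflection acting from the other side. -/
def affOp (j : ι) (κ : Lat P) (f : UMod P) : UMod P := fun u ↦
  Polynomial.X * yg b q (-weylMap u κ) * f (u * refl j) + heckeCoeff b j u * f u

lemma genOp_add (i : b.support) (f g : UMod P) :
    genOp b q n i (f + g) = genOp b q n i f + genOp b q n i g := by
  funext u
  simp only [genOp, Pi.add_apply, map_add]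
  ring

lemma genOp_mul (i : b.support) (c : GenRing P) (f : UMod P) :
    genOp b q n i (fun u ↦ c * f u) = fun u ↦ tw b q (simpleRefl b i) c * genOp b q n i f u := by
  funext u
  simp only [genOp, map_mul]
  ring

/-- The operators of a word in the simple reflections. -/
def genWord (L : List b.support) (f : UMod P) : UMod P := L.foldl (fun g i ↦ genOp b q n i g) f

/-- The denominators cleared in `genWord`. -/
def genDen : List b.support → GenRing P
  | [] => 1
  | i :: L => tw b q (L.map (simpleRefl b)).prod (1 - Polynomial.X ^ 2 * yRoot b q n i) * genDen L

lemma genWord_cons (i : b.support) (L : List b.support) (f : UMod P) :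
    genWord b q n (i :: L) f = genWord b q n L (genOp b q n i f) := rfl

lemma genWord_add (L : List b.support) (f g : UMod P) :
    genWord b q n L (f + g) = genWord b q n L f + genWord b q n L g := by
  induction L generalizing f g with
  | nil => rfl
  | cons i L ih => rw [genWord_cons, genWord_cons, genWord_cons, genOp_add, ih]

lemma genWord_mul (L : List b.support) (c : GenRing P) (f : UMod P) :
    genWord b q n L (fun u ↦ c * f u) =
      fun u ↦ tw b q (L.map (simpleRefl b)).prod c * genWord b q n L f u := by
  induction L generalizing c f with
  | nil =>
    funext u
    simp only [List.map_nil, List.prod_nil, tw_one]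
    rfl
  | cons i L ih =>
    rw [genWord_cons, genOp_mul, ih, genWord_cons, List.map_cons, List.prod_cons]
    funext u
    rw [tw_mul]

/-! ### The reflections in the walls of the alcove. -/

variable [P.IsReduced] [P.IsRootSystem]

/-- The condition on an affine reflection for its operator to commute with all `genOp`. -/
structure AffSimple (j : ι) (κ : Lat P) : Prop where
  refl_neg : weylMap (refl (P := P) j) κ = -κ
  self : (b.IsPos j ∧ κ = 0) ∨ (¬ b.IsPos j ∧ κ = -(mInt P n j • rt P j))
  other : ∀ k, k ≠ j → k ≠ opp P j →
    (P.coroot'In ℤ k κ = 0 ∧ (b.IsPos (perm (refl (P := P) j) k) ↔ b.IsPos k)) ∨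
    (P.coroot'In ℤ k κ = mInt P n k ∧ b.IsPos k ∧ ¬ b.IsPos (perm (refl (P := P) j) k)) ∨
    (P.coroot'In ℤ k κ = -mInt P n k ∧ ¬ b.IsPos k ∧ b.IsPos (perm (refl (P := P) j) k))

lemma affSimple_simple (i : b.support) : AffSimple b n (i : ι) 0 where
  refl_neg := by simp
  self := Or.inl ⟨isPos_simple b i, rfl⟩
  other k hk hk' := Or.inl ⟨map_zero _, isPos_perm_simple_iff b i hk hk'⟩

lemma perm_refl_eq_self {j k : ι} (h : P.pairingIn ℤ j k = 0) : perm (refl (P := P) j) k = k := by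
  have h1 : P.pairing k j = 0 := by
    rw [← (P.posRootForm ℤ).toInvariantForm.apply_root_root_zero_iff,
      ← (P.posRootForm ℤ).toInvariantForm.symm.eq, RingHom.id_apply,
      RootPairing.InvariantForm.apply_root_root_zero_iff, ← P.algebraMap_pairingIn ℤ, h, map_zero]
  apply P.root.injective
  rw [root_perm, refl_smul, RootPairing.root_coroot'_eq_pairing, h1, zero_smul, sub_zero]

/-- This is the wall not passing through `θ`. The alternatives in `exists_quasiMinuscule` for
positive roots, and their negatives, are what the field `other` asks for. -/
lemma exists_affSimple [P.IsIrreducible] [NeZero n] : ∃ j : ι,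
    AffSimple b n (opp P j) (mInt P n j • rt P j) := by
  obtain ⟨j, hj, h⟩ := exists_quasiMinuscule b n
  refine ⟨j, ?_, Or.inr ⟨?_, ?_⟩, fun k hk hk' ↦ ?_⟩
  · rw [refl_opp, map_nsmul, ← rt_perm, perm_refl_self, rt_opp, smul_neg]
  · rw [isPos_opp]; exact not_not.mpr hj
  · rw [mInt_opp, rt_opp, smul_neg, neg_neg]
  · rw [opp_opp] at hk'
    rw [refl_opp, map_nsmul, coroot'In_rt, nsmul_eq_mul]
    by_cases hp : b.IsPos k
    · rcases h k hp hk' with h0 | ⟨h1, h2⟩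
      · refine Or.inl ⟨by rw [h0, mul_zero], ?_⟩
        rw [perm_refl_eq_self h0]
      · exact Or.inr (Or.inl ⟨h1, hp, h2⟩)
    · have hp' : b.IsPos (opp P k) := (isPos_opp b k).mpr hp
      have e1 : P.pairingIn ℤ j (opp P k) = -P.pairingIn ℤ j k := by
        rw [← coroot'In_rt, coroot'In_opp, coroot'In_rt]
      rcases h (opp P k) hp' (fun h' ↦ hk (by rw [← h', opp_opp])) with h0 | ⟨h1, h2⟩
      · rw [e1, neg_eq_zero] at h0
        refine Or.inl ⟨by rw [h0, mul_zero], ?_⟩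
        rw [perm_refl_eq_self h0]
      · rw [e1, mInt_opp, mul_neg] at h1
        rw [perm_opp, isPos_opp, not_not] at h2
        exact Or.inr (Or.inr ⟨by omega, hp, h2⟩)

lemma perm_mul_inv (u w : P.weylGroup) (k : ι) : perm (u * w)⁻¹ k = perm w⁻¹ (perm u⁻¹ k) := by
  rw [mul_inv_rev, perm_mul]

-- One operator moves `u` to `σ_i u`, the other to `u σ_j`, so only coefficients have to be
-- compared. These depend on how the root `γ = u⁻¹ α_i` lies relative to the wall: either `γ = ±
-- α_j`, or the sign change of `γ` is compensated by the monomial that `σ_i` extracts from `y ^ (-u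
-- κ)`.
open scoped Classical in
lemma genOp_affOp {j : ι} {κ : Lat P} (h : AffSimple b n j κ) (i : b.support) (f : UMod P) :
    genOp b q n i (affOp b q j κ f) = affOp b q j κ (genOp b q n i f) := by
  funext u
  have hs : (simpleRefl b i)⁻¹ = simpleRefl b i := refl_inv (P := P) _
  set γ : ι := perm (P := P) u⁻¹ i with hγ
  have e1 : tw b q (simpleRefl b i) (yg b q (-weylMap ((simpleRefl b i) * u) κ)) = yg b q (-weylMap u κ) := by
    rw [tw_yg, map_neg, hs, ← weylMap_mul, refl_mul_refl_mul]
  have e2 : tw b q (simpleRefl b i) (yg b q (-weylMap u κ)) =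
      yg b q (-weylMap u κ) * yg b q (P.coroot'In ℤ γ κ • rt P i) := by
    rw [tw_yg, map_neg, hs, weylMap_refl, neg_sub, sub_eq_add_neg, add_comm, yg_add,
      ← coroot'In_perm u γ κ, hγ, perm_perm_inv]
  have e3 : ∀ w : P.weylGroup, tw b q (simpleRefl b i) (heckeCoeff b j w) = heckeCoeff b j w := fun w ↦ by
    unfold heckeCoeff
    split_ifs <;> simp [tw_X]
  have e4 : perm (u * refl (P := P) j)⁻¹ i = perm (refl (P := P) j) γ := by rw [perm_mul_inv, refl_inv]
  have e5 : mInt P n γ = mInt P n i := mInt_perm _ _ _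
  have hY : yg b q (-(mInt P n i • rt P i)) * yRoot b q n i = 1 := yg_neg_mul b q _
  simp only [genOp, affOp, map_add, map_mul, tw_X, e1, e2, e3, ← mul_assoc (simpleRefl b i) u (refl (P := P) j)]
  by_cases hj : γ = j ∨ γ = opp P j
  · have hru : u * refl (P := P) j = (simpleRefl b i) * u := by
      rw [mul_refl]
      rcases hj with hj | hj
      · rw [← hj, hγ, perm_perm_inv]
      · have : perm u j = opp P i := by
          rw [← opp_opp (P := P) j, ← hj, perm_opp, hγ, perm_perm_inv]
        rw [this, refl_opp (P := P)]
    have hsu : (simpleRefl b i) * (u * refl (P := P) j) = u := by rw [hru, refl_mul_refl_mul (P := P)]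
    rw [mul_assoc (simpleRefl b i), hsu, hru]
    -- Here `σ_i u = u σ_j`. The coefficients of `f u` on the two sides agree identically, and those
    -- of `f (σ_i u)` differ by this identity times `(1 - X ^ 2) X`.
    have key : -(1 - yRoot b q n i) * (if b.IsPos (perm ((simpleRefl b i) * u) j) then (0 : GenRing P) else 1) +
        signCoeff b q n i u * (yg b q (-weylMap u κ) * yg b q (P.coroot'In ℤ γ κ • rt P i)) =
        yg b q (-weylMap u κ) * signCoeff b q n i ((simpleRefl b i) * u) -
          (if b.IsPos (perm u j) then (0 : GenRing P) else 1) * (1 - yRoot b q n i) := by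
      unfold signCoeff
      rw [← hru, e4, ← hγ, hru, perm_mul (simpleRefl b i) u]
      rcases h.self with ⟨hjp, hκ⟩ | ⟨hjp, hκ⟩
      · subst hκ
        rcases hj with hj | hj
        · have h1 : perm u j = i := by rw [← hj, hγ, perm_perm_inv]
          rw [h1, hj, perm_refl_self, perm_refl_self]
          simp [isPos_opp, hjp, isPos_simple b i, yg_zero]
        · have h1 : perm u j = opp P i := by
            rw [← opp_opp (P := P) j, ← hj, perm_opp, hγ, perm_perm_inv]
          rw [h1, hj, perm_opp, perm_opp, perm_refl_self, perm_refl_self]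
          simp [isPos_opp, hjp, isPos_simple b i, yg_zero]
      · rcases hj with hj | hj
        · have h1 : perm u j = i := by rw [← hj, hγ, perm_perm_inv]
          have h2 : weylMap u κ = -(mInt P n i • rt P i) := by
            rw [hκ, map_neg, map_nsmul, ← rt_perm, h1, ← e5, hj]
          have h3 : yg b q (-weylMap u κ) * yg b q (P.coroot'In ℤ γ κ • rt P i) *
              yRoot b q n i = 1 := by
            rw [← yg_add, yRoot, ← yg_add, h2, hj, hκ, map_neg, map_nsmul, coroot'In_rt,
              RootPairing.pairingIn_same, ← e5, hj, ← yg_zero b q]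
            congr 1
            generalize rt P i = r
            simp only [nsmul_eq_mul]
            module
          rw [h2, neg_neg] at h3 ⊢
          rw [h1, hj, perm_refl_self, perm_refl_self]
          rw [hj] at h3
          simp only [isPos_opp, hjp, isPos_simple b i, not_true_eq_false, if_false, if_true,
            not_false_eq_true]
          rw [yRoot] at *
          linear_combination h3
        · have h1 : perm u j = opp P i := by
            rw [← opp_opp (P := P) j, ← hj, perm_opp, hγ, perm_perm_inv]
          have h2 : weylMap u κ = mInt P n i • rt P i := by
            rw [hκ, map_neg, map_nsmul, ← rt_perm, h1, rt_opp, ← e5, hj, mInt_opp, smul_neg,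
              neg_neg]
          have h3 : yg b q (-weylMap u κ) * yg b q (P.coroot'In ℤ γ κ • rt P i) =
              yRoot b q n i := by
            rw [← yg_add, yRoot, h2, hj, coroot'In_opp, hκ, map_neg, map_nsmul, coroot'In_rt,
              RootPairing.pairingIn_same, ← e5, hj, mInt_opp]
            congr 1
            generalize rt P i = r
            simp only [nsmul_eq_mul]
            module
          rw [h3, h2, h1, hj, perm_opp, perm_opp, perm_refl_self, perm_refl_self]
          simp only [isPos_opp, hjp, isPos_simple b i, not_true_eq_false, if_false, if_true,
            not_false_eq_true]
          linear_combination -hY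
    have hc : ∀ w : P.weylGroup, heckeCoeff b j w = (Polynomial.X ^ 2 - 1) *
        (if b.IsPos (perm w j) then (0 : GenRing P) else 1) := fun w ↦ by
      unfold heckeCoeff
      split_ifs <;> simp
    rw [hc, hc]
    linear_combination (1 - Polynomial.X ^ 2) * Polynomial.X * tw b q (simpleRefl b i) (f (simpleRefl b i * u)) * key
  · push Not at hj
    have h1 : heckeCoeff b j ((simpleRefl b i) * u) = heckeCoeff b j u := by
      unfold heckeCoeff
      have : b.IsPos (perm ((simpleRefl b i) * u) j) ↔ b.IsPos (perm u j) := by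
        rw [perm_mul]
        refine isPos_perm_simple_iff b i (fun h' ↦ hj.1 ?_) (fun h' ↦ hj.2 ?_)
        · rw [hγ, ← h', perm_inv_perm]
        · rw [hγ, ← opp_opp (P := P) (perm u⁻¹ i), ← perm_opp u⁻¹, ← h', perm_inv_perm]
      simp only [this]
    -- The three cases of `other` say that `⟨κ, γ^∨⟩` is `0`, `m` or `-m` exactly as the sign of `γ`
    -- is kept, becomes negative or becomes positive under the reflection.
    have key : signCoeff b q n i u * yg b q (P.coroot'In ℤ γ κ • rt P i) =
        signCoeff b q n i (u * refl (P := P) j) := by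
      unfold signCoeff
      rw [e4, ← hγ]
      rcases h.other γ hj.1 hj.2 with ⟨h2, h3⟩ | ⟨h2, h3, h4⟩ | ⟨h2, h3, h4⟩
      · rw [h2, zero_smul, yg_zero, mul_one]
        simp only [h3]
      · rw [h2, if_pos h3, if_neg h4, e5, natCast_zsmul, one_mul]
        rfl
      · rw [h2, if_neg h3, if_pos h4, e5, neg_smul, natCast_zsmul, mul_comm]
        exact hY
    rw [h1, ← key]
    ring

end Universal

section UniversalRelations

/-! ### Words with the same product act in the same way on the universal module -/

variable {ι M N : Type*} [Fintype ι] [AddCommGroup M] [Module ℝ M] [AddCommGroup N] [Module ℝ N]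
variable {P : RootPairing ι ℝ M N} (b : P.Base) (q : ℕ) [NeZero q]
variable [P.IsCrystallographic] (n : ℕ) [P.IsReduced] [P.IsRootSystem]

lemma genWord_affOp {j : ι} {κ : Lat P} (h : AffSimple b n j κ) (L : List b.support)
    (f : UMod P) :
    genWord b q n L (affOp b q j κ f) = affOp b q j κ (genWord b q n L f) := by
  induction L generalizing f with
  | nil => rfl
  | cons i L ih => rw [genWord_cons, genOp_affOp b q n h, ih, genWord_cons]

/-- The functional `f ↦ ∑_u t ^ ℓ(u) f(u)`. -/
def genSum (f : UMod P) : GenRing P := ∑ u, (∏ _k ∈ inv b u, Polynomial.X) * f u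

/-- Replace `u` by `σ_i u` in the first half of the operator. Since the lengths differ by one, the
factor is `t ^ 2 (1 - Y_i) + (1 - t ^ 2)` for an ascent and `(1 - Y_i) + (1 - t ^ 2) Y_i` for a
descent, and both are `1 - t ^ 2 Y_i`. -/
lemma genSum_genOp (i : b.support) (f : UMod P) : genSum b (genOp b q n i f) =
    (1 - Polynomial.X ^ 2 * yRoot b q n i) * tw b q (simpleRefl b i) (genSum b f) := by
  have hX : ∀ u : P.weylGroup, tw b q (simpleRefl b i) (∏ _k ∈ inv b u, Polynomial.X) =
      ∏ _k ∈ inv b u, Polynomial.X := fun u ↦ by simp [tw_X]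
  have e1 : genSum b (genOp b q n i f) =
      ∑ u, (∏ _k ∈ inv b u, Polynomial.X) * (Polynomial.X * (1 - yRoot b q n i) *
        tw b q (simpleRefl b i) (f (simpleRefl b i * u))) +
      ∑ u, (∏ _k ∈ inv b u, Polynomial.X) * ((1 - Polynomial.X ^ 2) * signCoeff b q n i u *
        tw b q (simpleRefl b i) (f u)) := by
    rw [← Finset.sum_add_distrib]
    exact Finset.sum_congr rfl fun u _ ↦ mul_add _ _ _
  rw [e1, ← Equiv.sum_comp (Equiv.mulLeft (simpleRefl b i)), ← Finset.sum_add_distrib, genSum,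
    map_sum, Finset.mul_sum]
  refine Finset.sum_congr rfl fun u _ ↦ ?_
  rw [map_mul, hX, Equiv.coe_mulLeft, refl_mul_refl_mul]
  unfold signCoeff
  split_ifs with hu
  · rw [prod_inv_simple_mul b _ i u hu]
    ring
  · rw [prod_inv_simple_mul' b _ i u hu]
    ring

lemma genSum_genWord (L : List b.support) (f : UMod P) : genSum b (genWord b q n L f) =
    genDen b q n L * tw b q (L.map (simpleRefl b)).prod (genSum b f) := by
  induction L generalizing f with
  | nil =>
    rw [List.map_nil, List.prod_nil, tw_one, genDen, one_mul]
    rfl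
  | cons i L ih =>
    rw [genWord_cons, ih, genSum_genOp, List.map_cons, List.prod_cons, tw_mul, map_mul, genDen]
    ring

/-- The orbit of a root spans `M`, because its span is stable under all reflections and the system
is irreducible. -/
lemma eq_of_weylMap_orbit_eq [P.IsIrreducible] {w w' : P.weylGroup} (j : ι) {m : ℕ} (hm : 0 < m)
    (h : ∀ v, weylMap (w * v) (m • rt P j) = weylMap (w' * v) (m • rt P j)) : w = w' := by
  have hm' : (m : ℝ) ≠ 0 := by exact_mod_cast hm.ne'
  let S : Submodule ℝ M := Submodule.span ℝ (Set.range fun v : P.weylGroup ↦ v • P.root j)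
  have hS : S = ⊤ := by
    refine RootPairing.IsIrreducible.eq_top_of_invtSubmodule_reflection (P := P) S (fun k ↦ ?_) ?_
    · rw [Module.End.mem_invtSubmodule, Submodule.span_le]
      rintro _ ⟨v, rfl⟩
      refine Submodule.subset_span ⟨refl k * v, ?_⟩
      exact mul_smul _ _ _
    · rw [Submodule.ne_bot_iff]
      exact ⟨P.root j, Submodule.subset_span ⟨1, one_smul _ _⟩, P.ne_zero j⟩
  apply weyl_smul_injective
  intro x
  have hx : x ∈ S := hS ▸ Submodule.mem_top
  induction hx using Submodule.span_induction with
  | mem x hx =>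
    obtain ⟨v, rfl⟩ := hx
    have h1 := congrArg (Subtype.val : Lat P → M) (h v)
    rw [coe_weylMap, coe_weylMap, AddSubmonoidClass.coe_nsmul, coe_rt, ← Nat.cast_smul_eq_nsmul ℝ,
      smul_comm, smul_comm _ (m : ℝ) (P.root j), mul_smul, mul_smul] at h1
    exact smul_right_injective M hm' h1
  | zero => simp
  | add x y _ _ hx hy => rw [smul_add, smul_add, hx, hy]
  | smul t x _ hx => rw [smul_comm, smul_comm w', hx]

open scoped Classical in
lemma affOp_single (j : ι) (κ : Lat P) (hκ : weylMap (refl j) κ = -κ) (x : P.weylGroup) :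
    affOp b q j κ (Pi.single x 1) =
      (fun u ↦ (Polynomial.X * yg b q (weylMap x κ)) * (Pi.single (x * refl j) 1 : UMod P) u) +
        fun u ↦ heckeCoeff b j x * (Pi.single x 1 : UMod P) u := by
  funext u
  have h1 : (Pi.single x 1 : UMod P) (u * refl j) = (Pi.single (x * refl j) 1 : UMod P) u := by
    rw [Pi.single_apply, Pi.single_apply]
    refine if_congr ⟨fun h ↦ ?_, fun h ↦ ?_⟩ rfl rfl
    · rw [← h, mul_refl_mul_refl]
    · rw [h, mul_refl_mul_refl]
  have h2 : yg b q (-weylMap u κ) * (Pi.single (x * refl j) 1 : UMod P) u =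
      yg b q (weylMap x κ) * (Pi.single (x * refl j) 1 : UMod P) u := by
    by_cases h : u = x * refl j
    · rw [h, weylMap_mul, hκ, map_neg, neg_neg]
    · rw [Pi.single_eq_of_ne h, mul_zero, mul_zero]
  have h3 : heckeCoeff b j u * (Pi.single x 1 : UMod P) u =
      heckeCoeff b j x * (Pi.single x 1 : UMod P) u := by
    by_cases h : u = x
    · rw [h]
    · rw [Pi.single_eq_of_ne h, mul_zero, mul_zero]
  rw [Pi.add_apply, affOp, h1, h3, mul_assoc, h2, mul_assoc]

/-- The difference `Z` of the two sides is semilinear, commutes with the wall operators and is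
killed by `genSum`. These three properties force every power of `X - 1` to divide its matrix
coefficients, since they pass to the quotient by each power and at `X = 1` they leave only zero. -/
lemma genWord_eq_of_prod_eq [P.IsIrreducible] [NeZero n] {L L' : List b.support}
    (h : (L.map (simpleRefl b)).prod = (L'.map (simpleRefl b)).prod) (f : UMod P)
    (u : P.weylGroup) :
    genDen b q n L' * genWord b q n L f u = genDen b q n L * genWord b q n L' f u := by
  classical
  set w := (L.map (simpleRefl b)).prod with hw
  let Z : UMod P → UMod P := fun f u ↦
    genDen b q n L' * genWord b q n L f u - genDen b q n L * genWord b q n L' f u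
  have hZadd : ∀ f g, Z (f + g) = Z f + Z g := fun f g ↦ by
    funext u
    simp only [Z, genWord_add, Pi.add_apply]
    ring
  have hZmul : ∀ (c : GenRing P) f, Z (fun u ↦ c * f u) = fun u ↦ tw b q w c * Z f u := fun c f ↦ by
    funext u
    simp only [Z, genWord_mul, ← h, ← hw]
    ring
  have hZaff : ∀ {j κ}, AffSimple b n j κ → ∀ f, Z (affOp b q j κ f) = affOp b q j κ (Z f) := by
    intro j κ hj f
    funext u
    simp only [Z, genWord_affOp b q n hj]
    simp only [affOp]
    ring
  have hZsum : ∀ f, genSum b (Z f) = 0 := fun f ↦ by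
    have e : genSum b (Z f) = genDen b q n L' * genSum b (genWord b q n L f) -
        genDen b q n L * genSum b (genWord b q n L' f) := by
      simp only [genSum, Finset.mul_sum, ← Finset.sum_sub_distrib, Z]
      refine Finset.sum_congr rfl fun u _ ↦ by ring
    rw [e, genSum_genWord, genSum_genWord, ← h]
    ring
  set T : GenRing P := Polynomial.X - Polynomial.C 1 with hT
  have hT0 : T ≠ 0 := Polynomial.X_sub_C_ne_zero 1
  have hdvd : ∀ k : ℕ, ∀ x u, T ^ k ∣ Z (Pi.single x 1) u := by
    intro k
    induction k with
    | zero => intro x u; simp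
    | succ k ih =>
      choose z hz using ih
      let ζ : P.weylGroup → P.weylGroup → Laurent (Lat P) := fun x u ↦ (z x u).eval 1
      -- Compare the coefficients of the commutation with a wall operator, cancel `T ^ k` and set `X
      -- = 1`: the Hecke term has the factor `X ^ 2 - 1` and disappears.
      have haff : ∀ {j κ}, AffSimple b n j κ → ∀ x u,
          ym b q (weylMap w⁻¹ (weylMap x κ)) * ζ (x * refl j) (u * refl j) =
            ym b q (weylMap u κ) * ζ x u := by
        intro j κ hj x u
        have e1 := congrFun (hZaff hj (Pi.single x 1)) (u * refl j)
        rw [affOp_single b q j κ hj.refl_neg, hZadd, hZmul, hZmul] at e1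
        have htw : tw b q w (heckeCoeff b j x) = heckeCoeff b j x := by
          unfold heckeCoeff
          split_ifs <;> simp [tw_X]
        simp only [Pi.add_apply, affOp, hz, map_mul, tw_X, tw_yg, htw, mul_refl_mul_refl,
          weylMap_mul, hj.refl_neg, map_neg, neg_neg] at e1
        have e2 : Polynomial.X * yg b q (weylMap w⁻¹ (weylMap x κ)) * z (x * refl j) (u * refl j) +
            heckeCoeff b j x * z x (u * refl j) =
            Polynomial.X * yg b q (weylMap u κ) * z x u +
              heckeCoeff b j (u * refl j) * z x (u * refl j) := by
          apply mul_left_cancel₀ (pow_ne_zero k hT0)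
          linear_combination e1
        have hev : ∀ v : P.weylGroup, (heckeCoeff b j v).eval 1 = 0 := fun v ↦ by
          unfold heckeCoeff
          split_ifs <;> simp
        have e3 := congrArg (Polynomial.eval 1) e2
        simp only [Polynomial.eval_add, Polynomial.eval_mul, Polynomial.eval_X, hev, yg,
          Polynomial.eval_C, one_mul, zero_mul, add_zero] at e3
        exact e3
      -- The walls through `θ`, where `κ = 0`, give invariance under right translation by `W`.
      have hright : ∀ v x u, ζ (x * v) (u * v) = ζ x u := by
        intro v
        obtain ⟨V, rfl⟩ := exists_word b v
        induction V with
        | nil => intro x u; simp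
        | cons i V ihV =>
          intro x u
          rw [List.map_cons, List.prod_cons, ← mul_assoc, ← mul_assoc, ihV]
          have := haff (affSimple_simple b n i) x u
          simpa [ym_zero] using this
      obtain ⟨j, hj⟩ := exists_affSimple b n
      -- The remaining wall says that a nonzero entry requires `w⁻¹ x v κ = u v κ` for all `v`, and
      -- the orbit of `κ` separates the elements of `W`.
      have hzero : ∀ x u, u ≠ w⁻¹ * x → ζ x u = 0 := by
        intro x u hne
        by_contra hz0
        refine hne (eq_of_weylMap_orbit_eq j (mInt_pos (P := P) n j) fun v ↦ ?_)
        have e1 := haff hj (x * v) (u * v)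
        rw [hright, hright] at e1
        have e2 := mul_right_cancel₀ hz0 e1
        rw [← weylMap_mul, ← mul_assoc] at e2
        exact (ym_injective b q e2).symm
      have hall : ∀ x u, ζ x u = 0 := by
        intro x u
        by_cases hu : u = w⁻¹ * x
        -- At `X = 1` the relation from `genSum` says that each row sums to zero, and only one entry
        -- of the row can be nonzero.
        · have e1 := hZsum (Pi.single x 1)
          have e2 : ∑ u, (∏ _k ∈ inv b u, Polynomial.X) * z x u = 0 := by
            apply mul_left_cancel₀ (pow_ne_zero k hT0)
            rw [mul_zero, ← e1, genSum, Finset.mul_sum]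
            refine Finset.sum_congr rfl fun u _ ↦ ?_
            rw [hz]
            ring
          have e3 := congrArg (Polynomial.eval 1) e2
          rw [Polynomial.eval_finsetSum, Polynomial.eval_zero,
            Finset.sum_eq_single_of_mem (w⁻¹ * x) (Finset.mem_univ _)] at e3
          · rw [hu]
            simpa [Polynomial.eval_prod] using e3
          · intro u _ hu
            have : (z x u).eval 1 = 0 := hzero x u hu
            rw [Polynomial.eval_mul, this, mul_zero]
        · exact hzero x u hu
      intro x u
      rw [hz, pow_succ]
      refine mul_dvd_mul_left _ ?_
      rw [hT, Polynomial.dvd_iff_isRoot]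
      exact hall x u
  have hsingle : ∀ x u, Z (Pi.single x 1) u = 0 := fun x u ↦ by
    by_contra hne
    -- A nonzero polynomial is divisible by only finitely many powers of the monic polynomial `X -
    -- 1`.
    have hfin : FiniteMultiplicity T (Z (Pi.single x 1) u) :=
      Polynomial.finiteMultiplicity_of_degree_pos_of_monic
        (by rw [hT, Polynomial.degree_X_sub_C]; exact one_pos) (Polynomial.monic_X_sub_C 1) hne
    obtain ⟨k, hk⟩ := hfin
    exact hk (hdvd _ x u)
  have hf : f = ∑ x, fun u ↦ f x * (Pi.single x 1 : UMod P) u := by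
    funext u
    rw [Finset.sum_apply, Finset.sum_eq_single_of_mem u (Finset.mem_univ _)]
    · simp
    · intro x _ hx
      rw [Pi.single_eq_of_ne hx.symm, mul_zero]
  have hZf : Z f = 0 := by
    have hZ0 : Z 0 = 0 := by
      have := hZadd 0 0
      rwa [add_zero, left_eq_add] at this
    let Zh : UMod P →+ UMod P := ⟨⟨Z, hZ0⟩, hZadd⟩
    change Zh f = 0
    rw [hf, map_sum]
    refine Finset.sum_eq_zero fun x _ ↦ ?_
    change Z _ = 0
    rw [hZmul]
    funext u
    rw [hsingle, mul_zero]
    rfl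
  exact sub_eq_zero.mp (congrFun hZf u)

end UniversalRelations

section Star

/-! ### The operators of the simple reflections on rational functions -/

variable {ι M N : Type*} [Fintype ι] [AddCommGroup M] [Module ℝ M] [AddCommGroup N] [Module ℝ N]
variable {P : RootPairing ι ℝ M N} (b : P.Base) (n q : ℕ) [NeZero q]

/-- The normalised monomial `y ^ β = q ^ d(β) x ^ β` as a rational function. -/
def yr (β : Lat P) : RatFn (Lat P) := toRat (ym b q β)

lemma yr_zero : yr b q 0 = 1 := by rw [yr, ym_zero, toRat, map_one]

lemma yr_add (β β' : Lat P) : yr b q (β + β') = yr b q β * yr b q β' := by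
  rw [yr, ym_add, toRat, map_mul]; rfl

lemma yr_ne_zero (β : Lat P) : yr b q β ≠ 0 := by
  rw [yr, toRat, Ne, FaithfulSMul.algebraMap_eq_zero_iff]
  exact ym_ne_zero b q β

lemma yr_neg (β : Lat P) : yr b q (-β) = (yr b q β)⁻¹ := by
  exact eq_inv_of_mul_eq_one_left (by rw [← yr_add, neg_add_cancel, yr_zero])

lemma yr_zsmul (z : ℤ) (β : Lat P) : yr b q (z • β) = yr b q β ^ z := by
  induction z using Int.induction_on with
  | zero => rw [zero_smul, yr_zero, zpow_zero]
  | succ k ih => rw [add_smul, one_smul, yr_add, ih, zpow_add_one₀ (yr_ne_zero b q β)]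
  | pred k ih =>
    rw [sub_smul, one_smul, sub_eq_add_neg, yr_add, ih, yr_neg, zpow_sub_one₀ (yr_ne_zero b q β)]

lemma yr_nsmul (z : ℕ) (β : Lat P) : yr b q (z • β) = yr b q β ^ z := by
  rw [← natCast_zsmul, yr_zsmul, zpow_natCast]

lemma twist_yr (w : P.weylGroup) (β : Lat P) :
    twist b q w (yr b q β) = yr b q (weylMap w⁻¹ β) := by
  rw [yr, twist_toRat, twistHom_ym, yr]

lemma toRat_single (β : Lat P) (z : ℂ) :
    toRat (AddMonoidAlgebra.single β z) = algebraMap ℂ (RatFn (Lat P)) z * mono β := by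
  have : (AddMonoidAlgebra.single β z : Laurent (Lat P)) =
      algebraMap ℂ _ z * AddMonoidAlgebra.single β 1 := by
    rw [← Algebra.smul_def, AddMonoidAlgebra.smul_single, smul_eq_mul, mul_one]
  rw [this, mono, toRat, toRat, map_mul, ← IsScalarTower.algebraMap_apply]

lemma yr_eq (β : Lat P) : yr b q β = (q : RatFn (Lat P)) ^ ht b β * mono β := by
  rw [yr, ym, toRat_single, map_zpow₀, map_natCast]

lemma mul_var (i : b.support) : (q : RatFn (Lat P)) * var b i = yr b q (rt P i) := by
  rw [yr_eq, ht_rt, zpow_one, var]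

lemma natCast_ne_zero' : (q : RatFn (Lat P)) ≠ 0 := by
  rw [← map_natCast (algebraMap ℂ (RatFn (Lat P)))]
  exact (map_ne_zero _).mpr (NeZero.ne _)

lemma twist_mul (w w' : P.weylGroup) (f : RatFn (Lat P)) :
    twist b q (w * w') f = twist b q w' (twist b q w f) := by
  obtain ⟨a, c, hc, rfl⟩ := IsFractionRing.div_surjective (A := Laurent (Lat P)) f
  have h : ∀ a : Laurent (Lat P), twist b q (w * w') (algebraMap _ _ a) =
      twist b q w' (twist b q w (algebraMap _ _ a)) := fun a ↦ by
    change twist b q (w * w') (toRat a) = twist b q w' (twist b q w (toRat a))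
    rw [twist_toRat, twist_toRat, twist_toRat, twistHom_mul]
  rw [map_div₀, map_div₀, map_div₀, h, h]

lemma twist_one (f : RatFn (Lat P)) : twist b q 1 f = f := by
  apply (twist b q 1).toRingHom.injective
  change twist b q 1 (twist b q 1 f) = twist b q 1 f
  rw [← twist_mul, one_mul]

lemma one_sub_ym_ne_zero {β : Lat P} (hβ : β ≠ 0) (z : ℂ) : 1 - z • ym b q β ≠ 0 := by
  intro h
  have h1 : (1 - z • ym b q β).coeff 0 = 0 := by rw [h]; rfl
  rw [ym, AddMonoidAlgebra.one_def, AddMonoidAlgebra.smul_single, AddMonoidAlgebra.coeff_sub,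
    Finsupp.sub_apply, AddMonoidAlgebra.coeff_single, AddMonoidAlgebra.coeff_single,
    Finsupp.single_eq_same, Finsupp.single_eq_of_ne hβ.symm, sub_zero] at h1
  exact one_ne_zero h1

lemma one_sub_yr_ne_zero {β : Lat P} (hβ : β ≠ 0) (z : ℂ) :
    1 - algebraMap ℂ (RatFn (Lat P)) z * yr b q β ≠ 0 := by
  have h : 1 - algebraMap ℂ (RatFn (Lat P)) z * yr b q β = toRat (1 - z • ym b q β) := by
    rw [toRat, map_sub, map_one, Algebra.smul_def, map_mul, ← IsScalarTower.algebraMap_apply]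
    rfl
  rw [h, toRat, Ne, FaithfulSMul.algebraMap_eq_zero_iff]
  exact one_sub_ym_ne_zero b q hβ z

variable [P.IsCrystallographic]

/-- The monomial `Y_k = y ^ (m(α_k) α_k)` as a rational function. -/
def yrRoot (k : ι) : RatFn (Lat P) := yr b q (mInt P n k • rt P k)

lemma yrRoot_ne_zero (k : ι) : yrRoot b n q k ≠ 0 := yr_ne_zero b q _

lemma mInt_smul_rt_ne_zero [NeZero n] (k : ι) : mInt P n k • rt P k ≠ 0 := by
  intro h
  have h1 : (mInt P n k : ℝ) • P.root k = 0 := by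
    rw [Nat.cast_smul_eq_nsmul ℝ, ← coe_rt]
    exact congrArg Subtype.val h
  rcases smul_eq_zero.mp h1 with h2 | h2
  · exact (mInt_pos (P := P) n k).ne' (by exact_mod_cast h2)
  · exact P.ne_zero k h2

lemma one_sub_yrRoot_ne_zero [NeZero n] (k : ι) (z : ℂ) :
    1 - algebraMap ℂ (RatFn (Lat P)) z * yrRoot b n q k ≠ 0 :=
  one_sub_yr_ne_zero b q (mInt_smul_rt_ne_zero n k) z

lemma one_sub_yrRoot_ne_zero' [NeZero n] (k : ι) : 1 - yrRoot b n q k ≠ 0 := by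
  simpa using one_sub_yrRoot_ne_zero b n q k 1

/-- The subalgebra of rational functions in the monomials of `Λ'`. -/
def basePiece (P : RootPairing ι ℝ M N) [P.IsCrystallographic] (n : ℕ) :
    Subalgebra ℂ (RatFn (Lat P)) where
  carrier := piece (subLat P n) 0
  mul_mem' := by
    rintro _ _ ⟨f, g, hg, hg0, hf, rfl⟩ ⟨f', g', hg', hg0', hf', rfl⟩
    refine ⟨f * f', g * g', mul_ne_zero hg hg', by simpa using hg0.mul hg0',
      by simpa using hf.mul hf', ?_⟩
    simp only [toRat, map_mul, div_mul_div_comm]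
  add_mem' := fun h h' ↦ add_mem h h'
  algebraMap_mem' z := by
    refine ⟨algebraMap ℂ _ z, 1, one_ne_zero, SuppIn.one, ?_, ?_⟩
    · simpa using SuppIn.single (Λ' := subLat P n) 0 z
    · rw [toRat, toRat, map_one, div_one, ← IsScalarTower.algebraMap_apply]

lemma basePiece_mul_mem {f g : RatFn (Lat P)} {c : Lat P ⧸ subLat P n} (hg : g ∈ basePiece P n)
    (hf : f ∈ piece (subLat P n) c) : g * f ∈ piece (subLat P n) c := by
  obtain ⟨a, d, hd, hd0, ha, rfl⟩ := hg
  obtain ⟨a', d', hd', hd0', ha', rfl⟩ := hf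
  refine ⟨a * a', d * d', mul_ne_zero hd hd', by simpa using hd0.mul hd0',
      by simpa using ha.mul ha', ?_⟩
  simp only [toRat, map_mul, div_mul_div_comm]

lemma toRat_mem_piece {c : Lat P ⧸ subLat P n} {f : Laurent (Lat P)} (hf : SuppIn (subLat P n) c f) :
    toRat f ∈ piece (subLat P n) c :=
  ⟨f, 1, one_ne_zero, SuppIn.one, hf, by rw [toRat, toRat, map_one, div_one]⟩

lemma inv_mem_basePiece {f : RatFn (Lat P)} (hf : f ∈ basePiece P n) : f⁻¹ ∈ basePiece P n := by
  obtain ⟨a, d, hd, hd0, ha, rfl⟩ := hf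
  by_cases h : a = 0
  · rw [h, toRat, map_zero, zero_div, inv_zero]
    exact zero_mem _
  · exact ⟨d, a, h, ha, hd0, inv_div _ _⟩

lemma yr_mem_piece (β : Lat P) : yr b q β ∈ piece (subLat P n) (QuotientAddGroup.mk β) :=
  toRat_mem_piece n (SuppIn.single β _)

lemma yr_mem_basePiece {κ : Lat P} (hκ : κ ∈ subLat P n) : yr b q κ ∈ basePiece P n := by
  have := yr_mem_piece b n q κ
  rwa [(QuotientAddGroup.eq_zero_iff κ).mpr hκ] at this

lemma yrRoot_mem (k : ι) : yrRoot b n q k ∈ basePiece P n :=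
  yr_mem_basePiece b n q (AddSubgroup.subset_closure ⟨k, rfl⟩)

/-- Denominators of homogeneous functions can be taken in the degree zero piece, so monomials
generate all rational functions over it. Operators semilinear over that piece are therefore
determined on monomials. -/
lemma ratFn_induction [NeZero n] {p : RatFn (Lat P) → Prop}
    (add : ∀ f g, p f → p g → p (f + g))
    (mul : ∀ g ∈ basePiece P n, ∀ β, p (g * yr b q β)) (f : RatFn (Lat P)) : p f := by
  classical
  have htop : f ∈ ⨆ c, piece (subLat P n) c := by
    rw [(piece_isInternal (subLat P n) (NeZero.pos n) (nsmul_mem_subLat n)).submodule_iSup_eq_top]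
    trivial
  have h0 : p 0 := by
    have := mul 0 (zero_mem _) 0
    rwa [zero_mul] at this
  induction htop using Submodule.iSup_induction' with
  | mem c x hx =>
    obtain ⟨a, d, hd, hd0, -, rfl⟩ := hx
    clear c
    induction a using AddMonoidAlgebra.induction_linear with
    | zero => rwa [toRat, map_zero, zero_div]
    | add a a' ha ha' =>
      rw [toRat, map_add, add_div]
      exact add _ _ ha ha'
    | single β z =>
      have h2 := mul ((algebraMap ℂ _ (z / (q : ℂ) ^ ht b β)) * (toRat d)⁻¹)
        (mul_mem (Subalgebra.algebraMap_mem _ _)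
          (inv_mem_basePiece n (toRat_mem_piece n hd0))) β
      convert h2 using 1
      have hz : algebraMap ℂ (RatFn (Lat P)) z = algebraMap ℂ _ (z / (q : ℂ) ^ ht b β) *
          algebraMap ℂ _ ((q : ℂ) ^ ht b β) := by
        rw [← map_mul, div_mul_cancel₀ _ (zpow_ne_zero _ (NeZero.ne _))]
      rw [yr, ym, toRat_single, toRat_single, div_eq_mul_inv, hz]
      ring
  | zero => exact h0
  | add x y _ _ hx hy => exact add x y hx hy

variable [P.IsRootSystem] [P.IsReduced] [P.IsIrreducible] [NeZero n]

lemma SuppIn.twistHom {f : Laurent (Lat P)} (w : P.weylGroup) (hf : SuppIn (subLat P n) 0 f) :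
    SuppIn (subLat P n) 0 (twistHom b q w f) := by
  classical
  have h : ∀ β ∈ f.coeff.support, SuppIn (subLat P n) 0
      (ChintaGunnells.twistHom b q w (AddMonoidAlgebra.single β (f.coeff β))) := by
    intro β hβ
    rw [twistHom_single]
    have h1 := SuppIn.single (Λ' := subLat P n) (weylMap w⁻¹ β)
      (f.coeff β * (q : ℂ) ^ (ht b (weylMap w⁻¹ β - β)))
    rwa [(QuotientAddGroup.eq_zero_iff _).mpr
      (weylMap_mem_subLat n _ ((QuotientAddGroup.eq_zero_iff _).mp (hf β hβ)))] at h1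
  rw [← AddMonoidAlgebra.sum_coeff_single f, Finsupp.sum, map_sum]
  refine Finset.sum_induction _ (SuppIn (subLat P n) 0) (fun _ _ ↦ SuppIn.add) ?_ h
  intro β hβ
  simp at hβ

lemma twist_mem_basePiece (w : P.weylGroup) {f : RatFn (Lat P)} (hf : f ∈ basePiece P n) :
    twist b q w f ∈ basePiece P n := by
  obtain ⟨a, d, hd, hd0, ha, rfl⟩ := hf
  refine ⟨twistHom b q w a, twistHom b q w d, ?_, hd0.twistHom b n q w, ha.twistHom b n q w, ?_⟩
  · rwa [Ne, map_eq_zero_iff _ (twistHom_injective b q w)]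
  · rw [map_div₀, twist_toRat, twist_toRat]

variable (γ : ZMod n → ℂ) (l : b.support → ℕ)

/-- Multiplication by a degree zero function preserves the coset of `β`, hence the coefficient of
the operator; only the change of variables sees the factor. -/
lemma slashGen_mul (i : b.support) {g : RatFn (Lat P)} (hg : g ∈ basePiece P n) (f : RatFn (Lat P)) :
    slashGen b n q γ l i (g * f) = twist b q (simpleRefl b i) g * slashGen b n q γ l i f := by
  induction f using ratFn_induction b n q with
  | add f f' hf hf' => rw [mul_add, map_add, hf, hf', map_add, mul_add]
  | mul g' hg' β =>
    have h1 : g' * yr b q β ∈ piece (subLat P n) (QuotientAddGroup.mk β) :=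
      basePiece_mul_mem n hg' (yr_mem_piece b n q β)
    rw [slashGen_apply b n q γ l i β _ h1,
      slashGen_apply b n q γ l i β _ (basePiece_mul_mem n hg h1), map_mul]
    ring

/-- The operator `f ↦ Y_i (f|σ_i)`. -/
def starGen (i : b.support) (f : RatFn (Lat P)) : RatFn (Lat P) :=
  yrRoot b n q i * slashGen b n q γ l i f

lemma starGen_add (i : b.support) (f g : RatFn (Lat P)) : starGen b n q γ l i (f + g) =
    starGen b n q γ l i f + starGen b n q γ l i g := by
  rw [starGen, map_add, mul_add]; rfl

lemma starGen_sum (i : b.support) {κ : Type*} (s : Finset κ) (f : κ → RatFn (Lat P)) :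
    starGen b n q γ l i (∑ k ∈ s, f k) = ∑ k ∈ s, starGen b n q γ l i (f k) := by
  rw [starGen, map_sum, Finset.mul_sum]; rfl

lemma starGen_mul (i : b.support) {g : RatFn (Lat P)} (hg : g ∈ basePiece P n) (f : RatFn (Lat P)) :
    starGen b n q γ l i (g * f) = twist b q (simpleRefl b i) g * starGen b n q γ l i f := by
  rw [starGen, slashGen_mul b n q γ l i hg, starGen]
  ring

/-- Besides clearing the denominator, the factor `Y_i` turns the exponents `l_i + 1 - (μ)_m` and
`l_i + 1 - m` into `l_i + 1` plus `m - (μ)_m ∈ {1, …, m}` and plus `0`. The factor `y ^ ((l_i + 1)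
α_i)` then combines with the reflected monomial into the dot action. -/
lemma starGen_apply (i : b.support) (β : Lat P) (f : RatFn (Lat P))
    (hf : f ∈ piece (subLat P n) (QuotientAddGroup.mk β)) :
    (1 - algebraMap ℂ _ (1 / (q : ℂ)) * yrRoot b n q i) * starGen b n q γ l i f =
      ((1 - algebraMap ℂ _ (1 / (q : ℂ))) *
          yr b q (((mInt P n i : ℤ) - (-shp b l i β) % mInt P n i) • rt P i) -
        algebraMap ℂ _ (γ (-(normSq P i * shp b l i β : ℤ))) * (1 - yrRoot b n q i)) *
      yr b q (((l i : ℤ) + 1) • rt P i) * twist b q (simpleRefl b i) f := by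
  have hq : (q : RatFn (Lat P)) ≠ 0 := natCast_ne_zero' q
  have hY : yrRoot b n q i = yr b q (rt P i) ^ (mInt P n i : ℤ) := by
    rw [yrRoot, yr_nsmul, zpow_natCast]
  have hd : 1 - algebraMap ℂ (RatFn (Lat P)) (1 / (q : ℂ)) * yrRoot b n q i ≠ 0 :=
    one_sub_yrRoot_ne_zero b n q i _
  have hv : algebraMap ℂ (RatFn (Lat P)) (1 / (q : ℂ)) = 1 / q := by simp
  have hy := yr_ne_zero b q (rt P i)
  rw [starGen, slashGen_apply b n q γ l i β f hf, PFun, QFun, mu_dot, mul_var, mu_eq_neg_shp,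
    neg_neg, ← zpow_natCast, ← hY, hv, yr_zsmul, yr_zsmul]
  rw [hv] at hd
  have hd' : 1 - yrRoot b n q i / q ≠ 0 := by rwa [div_eq_mul_one_div, mul_comm]
  have e1 : yr b q (rt P i) ^ ((l i : ℤ) + 1 - -shp b l i β % mInt P n i) =
      yr b q (rt P i) ^ ((mInt P n i : ℤ) - -shp b l i β % mInt P n i) *
        yr b q (rt P i) ^ ((l i : ℤ) + 1) * (yrRoot b n q i)⁻¹ := by
    rw [hY, ← zpow_neg, ← zpow_add₀ hy, ← zpow_add₀ hy]
    congr 1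
    ring
  have e2 : yr b q (rt P i) ^ ((l i : ℤ) + 1 - mInt P n i) =
      yr b q (rt P i) ^ ((l i : ℤ) + 1) * (yrRoot b n q i)⁻¹ := by
    rw [hY, ← zpow_neg, ← zpow_add₀ hy]
    rfl
  rw [e1, e2]
  have hYn := yrRoot_ne_zero b n q i
  generalize yr b q (rt P i) ^ ((mInt P n i : ℤ) - -shp b l i β % mInt P n i) = A
  generalize yr b q (rt P i) ^ ((l i : ℤ) + 1) = B
  generalize yrRoot b n q i = Y at *
  have hqY : (q : RatFn (Lat P)) - Y ≠ 0 := by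
    intro h
    apply hd'
    rw [← sub_eq_zero.mp h, div_self hq, sub_self]
  have e3 : 1 - Y / (q : RatFn (Lat P)) = (q - Y) / q := by rw [sub_div, div_self hq]
  have e4 : (1 - 1 / (q : RatFn (Lat P)) * Y) = (q - Y) / q := by
    rw [sub_div, div_self hq]
    ring
  rw [e3, e4]
  field_simp
  ring

end Star

section Specialisation

/-! ### The action of the Weyl group on rational functions -/

variable {ι M N : Type*} [Fintype ι] [AddCommGroup M] [Module ℝ M] [AddCommGroup N] [Module ℝ N]
variable {P : RootPairing ι ℝ M N} (b : P.Base) (n q : ℕ) [NeZero q] (t : ℂ)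

/-- The specialisation of the additional variable of `GenRing` at `t`. -/
def spec : GenRing P →+* RatFn (Lat P) :=
  Polynomial.eval₂RingHom (algebraMap (Laurent (Lat P)) (RatFn (Lat P)))
    (algebraMap ℂ (RatFn (Lat P)) t)

lemma spec_X : spec (P := P) t Polynomial.X = algebraMap ℂ _ t := by simp [spec]

lemma spec_yg (β : Lat P) : spec t (yg b q β) = yr b q β := by simp [spec, yg, yr]

lemma spec_tw (w : P.weylGroup) (x : GenRing P) :
    spec t (tw b q w x) = twist b q w (spec t x) := by
  have : (spec (P := P) t).comp (tw b q w) = (twist b q w).toRingHom.comp (spec (P := P) t) := by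
    refine Polynomial.ringHom_ext' ?_ ?_
    · refine RingHom.ext fun a ↦ ?_
      have := twist_toRat b q w a
      simpa [spec, tw] using this.symm
    · change spec t (tw b q w Polynomial.X) = twist b q w (spec t Polynomial.X)
      rw [tw_X, spec_X]
      exact ((twist b q w).commutes t).symm
  exact RingHom.congr_fun this x

variable [P.IsCrystallographic]

lemma spec_yRoot (k : ι) : spec t (yRoot b q n k) = yrRoot b n q k := spec_yg b q t _

variable [P.IsRootSystem] [P.IsReduced] [P.IsIrreducible] [NeZero n]
variable (γ : ZMod n → ℂ) (l : b.support → ℕ)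

/-- The coefficient attached to a positive root in the realisation of the universal module. -/
def rCoeff (β : Lat P) (k : ι) : ℂ :=
  if shp b l k β = 0 then t else -t⁻¹ * γ (-(normSq P k * shp b l k β : ℤ))

/-- The realisation of the universal module attached to an element `β` of the root lattice. -/
def realise (β : Lat P) (f : UMod P) : RatFn (Lat P) :=
  ∑ u, spec t (f u) * (algebraMap ℂ _ (∏ k ∈ inv b u, rCoeff b n t γ l β k) *
    yr b q (dotW b l u β))

lemma shp_dotW' (u : P.weylGroup) (k : ι) (β : Lat P) :
    shp b l k (dotW b l u β) = shp b l (perm u⁻¹ k) β := by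
  rw [← shp_dotW b l u (perm u⁻¹ k), perm_perm_inv]

variable {γ t}

/-- For `1 ≤ N ≤ m` the exponent of `starGen_apply` is the pairing `N` itself. The endpoint `N = m`
is included, which is why the closed alcove is admissible. -/
lemma emod_of_pos_le {N m : ℤ} (h : 0 < N) (h' : N ≤ m) : m - (-N) % m = N := by
  rcases h'.eq_or_lt with rfl | h1
  · simp
  · have : (-N) % m = m - N := by
      rw [← Int.add_emod_right, Int.emod_eq_of_lt] <;> omega
    omega

-- Put `N = ⟨β - θ, α^∨⟩` for the positive one of `±u⁻¹ α_i`. On the wall `N = 0` the monomials of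
-- `u` and `σ_i u` coincide and `γ(0) = -1` gives the identity. For `N > 0` and an ascent the scalar
-- `-t⁻¹ γ` is chosen to fit. A descent must agree with the same scalar, and there the relations for
-- `γ` enter.
open scoped Classical in
lemma starGen_monomial (hγ0 : γ 0 = -1) (hγ : ∀ k : ZMod n, k ≠ 0 → γ k * γ (-k) = 1 / (q : ℂ))
    (ht : t ^ 2 = 1 / (q : ℂ)) {β : Lat P}
    (hβ : ∀ k, b.IsPos k → 0 ≤ shp b l k β ∧ shp b l k β ≤ mInt P n k) (i : b.support)
    (u : P.weylGroup) :
    algebraMap ℂ _ t * (1 - yrRoot b n q i) *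
      (algebraMap ℂ _ (∏ k ∈ inv b (simpleRefl b i * u), rCoeff b n t γ l β k) *
        yr b q (dotW b l (simpleRefl b i * u) β)) +
    (1 - algebraMap ℂ _ t ^ 2) * (if b.IsPos (perm u⁻¹ i) then 1 else yrRoot b n q i) *
      (algebraMap ℂ _ (∏ k ∈ inv b u, rCoeff b n t γ l β k) * yr b q (dotW b l u β)) =
    (1 - algebraMap ℂ _ (1 / (q : ℂ)) * yrRoot b n q i) *
      (algebraMap ℂ _ (∏ k ∈ inv b u, rCoeff b n t γ l β k) *
        starGen b n q γ l i (yr b q (dotW b l u β))) := by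
  have ht0 : t ≠ 0 := by
    rintro rfl
    have : (1 : ℂ) / q ≠ 0 := one_div_ne_zero (NeZero.ne _)
    exact this (by rw [← ht]; ring)
  rw [mul_left_comm _ (algebraMap ℂ (RatFn (Lat P)) _) (starGen b n q γ l i _),
    starGen_apply b n q γ l i (dotW b l u β) _ (yr_mem_piece b n q _)]
  have hs : (simpleRefl b i)⁻¹ = simpleRefl b i := refl_inv (P := P) _
  have e1 : yr b q (((l i : ℤ) + 1) • rt P i) *
      twist b q (simpleRefl b i) (yr b q (dotW b l u β)) =
      yr b q (dotW b l (simpleRefl b i * u) β) := by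
    rw [twist_yr, ← yr_add, hs, dotW_mul, dotW_simple, dot, add_comm]
  have e2 : yr b q (dotW b l u β) = yr b q (shp b l i (dotW b l u β) • rt P i) *
      yr b q (dotW b l (simpleRefl b i * u) β) := by
    rw [← yr_add, dotW_mul, dotW_refl, add_sub_cancel]
  rw [mul_assoc _ (yr b q (((l i : ℤ) + 1) • rt P i)), e1, e2, shp_dotW']
  generalize yr b q (dotW b l (simpleRefl b i * u) β) = Z
  rw [← ht, map_pow]
  have hT0 : algebraMap ℂ (RatFn (Lat P)) t ≠ 0 := (map_ne_zero _).mpr ht0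
  have hk : normSq P (perm u⁻¹ i) = normSq P i := normSq_perm _ _
  have hm : mInt P n (perm u⁻¹ i) = mInt P n i := mInt_perm _ _ _
  have hmpos : (0 : ℤ) < mInt P n i := by exact_mod_cast mInt_pos (P := P) n i
  set k := perm (P := P) u⁻¹ i with hkdef
  by_cases hp : b.IsPos k
  · obtain ⟨h1, h2⟩ := hβ k hp
    rw [if_pos hp, prod_inv_simple_mul b _ i u hp, map_mul, ← hkdef]
    generalize algebraMap ℂ (RatFn (Lat P)) (∏ k ∈ inv b u, rCoeff b n t γ l β k) = C
    rw [hm] at h2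
    rcases h1.eq_or_lt with h0 | hpos
    · rw [rCoeff, if_pos h0.symm, ← h0, mul_zero, Int.cast_zero, neg_zero, neg_zero, hγ0, zero_smul,
        yr_zero, Int.zero_emod, sub_zero, natCast_zsmul, ← yrRoot, map_neg, map_one]
      ring
    · rw [rCoeff, if_neg hpos.ne', emod_of_pos_le hpos h2, hk, map_mul, map_neg, map_inv₀]
      field_simp
      ring
  · obtain ⟨h1, h2⟩ := hβ (opp P k) ((isPos_opp b k).mpr hp)
    rw [if_neg hp, prod_inv_simple_mul' b _ i u hp, map_mul, ← hkdef]
    generalize algebraMap ℂ (RatFn (Lat P))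
      (∏ k ∈ inv b (simpleRefl b i * u), rCoeff b n t γ l β k) = C
    rw [mInt_opp, hm] at h2
    rw [rCoeff, shp_opp] at *
    rw [normSq_opp, hk]
    generalize shp b l k β = K at *
    rcases h1.eq_or_lt with h0 | hpos
    · have hK : K = 0 := by omega
      rw [if_pos h0.symm, hK, mul_zero, Int.cast_zero, neg_zero, neg_zero, hγ0, zero_smul,
        yr_zero, Int.zero_emod, sub_zero, natCast_zsmul, ← yrRoot, map_neg, map_one]
      ring
    · rw [if_neg hpos.ne', map_mul, map_neg, map_inv₀]
      -- On the upper wall `N = m` the number `‖α_i‖² N` is divisible by `n`, so both values of `γ`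
      -- are `γ(0)`. Below it the arguments are nonzero and `γ(k) γ(-k) = 1/q = t ^ 2` is used.
      rcases h2.eq_or_lt with h3 | h3
      · have hK : K = -mInt P n i := by omega
        have hz : ((normSq P i * -K : ℤ) : ZMod n) = 0 := by
          rw [ZMod.intCast_zmod_eq_zero_iff_dvd, dvd_iff_mInt_dvd n (i : ι), h3]
        have hz' : ((normSq P i * K : ℤ) : ZMod n) = 0 := by
          rw [ZMod.intCast_zmod_eq_zero_iff_dvd, dvd_iff_mInt_dvd n (i : ι), hK]
          exact (dvd_refl _).neg_right
        have hY : yrRoot b n q i * yr b q (K • rt P i) = 1 := by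
          rw [yrRoot, ← yr_add, hK, neg_smul, natCast_zsmul, add_neg_cancel, yr_zero]
        rw [hz, hz', neg_zero, hγ0, h3, Int.emod_self, sub_zero, natCast_zsmul, ← yrRoot, map_neg,
          map_one]
        field_simp
        linear_combination (1 - algebraMap ℂ (RatFn (Lat P)) t ^ 2) * C * Z * hY
      · have hz : ((normSq P i * K : ℤ) : ZMod n) ≠ 0 := by
          rw [Ne, ZMod.intCast_zmod_eq_zero_iff_dvd, dvd_iff_mInt_dvd n (i : ι)]
          intro h
          have := Int.le_of_dvd hpos h.neg_right
          omega
        have hg := hγ _ hz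
        rw [← ht] at hg
        have hg' := congrArg (algebraMap ℂ (RatFn (Lat P))) hg
        rw [map_mul, map_pow] at hg'
        have hY : yr b q (((mInt P n i : ℤ) - -K % mInt P n i) • rt P i) =
            yrRoot b n q i * yr b q (K • rt P i) := by
          rw [yrRoot, ← yr_add, Int.emod_eq_of_lt hpos.le h3, sub_neg_eq_add, add_smul,
            natCast_zsmul]
        rw [hY, mul_neg, Int.cast_neg, neg_neg]
        field_simp
        linear_combination (-(1 - yrRoot b n q i)) * C * Z * hg'

lemma basePiece_genOp {f : UMod P} (hf : ∀ u, spec t (f u) ∈ basePiece P n) (i : b.support)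
    (u : P.weylGroup) : spec t (genOp b q n i f u) ∈ basePiece P n := by
  have hX : algebraMap ℂ (RatFn (Lat P)) t ∈ basePiece P n := Subalgebra.algebraMap_mem _ _
  have hY := yrRoot_mem b n q (i : ι)
  simp only [genOp, map_add, map_mul, map_sub, map_one, map_pow, spec_X, spec_yRoot, spec_tw]
  refine add_mem (mul_mem (mul_mem hX (sub_mem (one_mem _) hY)) (twist_mem_basePiece b n q _ (hf _)))
    (mul_mem (mul_mem (sub_mem (one_mem _) (pow_mem hX 2)) ?_) (twist_mem_basePiece b n q _ (hf _)))
  unfold signCoeff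
  split_ifs
  · rw [map_one]; exact one_mem _
  · rw [spec_yRoot]; exact hY

/-- This is `starGen_monomial` summed over `W`, after the substitution `u ↦ σ_i u` in the first half
of the generic operator; the coefficients of `f` come out by semilinearity. -/
lemma realise_genOp (hγ0 : γ 0 = -1) (hγ : ∀ k : ZMod n, k ≠ 0 → γ k * γ (-k) = 1 / (q : ℂ))
    (ht : t ^ 2 = 1 / (q : ℂ)) {β : Lat P}
    (hβ : ∀ k, b.IsPos k → 0 ≤ shp b l k β ∧ shp b l k β ≤ mInt P n k) {f : UMod P}
    (hf : ∀ u, spec t (f u) ∈ basePiece P n) (i : b.support) :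
    realise b n q t γ l β (genOp b q n i f) = spec t (1 - Polynomial.X ^ 2 * yRoot b q n i) *
      starGen b n q γ l i (realise b n q t γ l β f) := by
  classical
  have h1 : ∀ u : P.weylGroup, spec t (signCoeff b q n i u) =
      if b.IsPos (perm u⁻¹ i) then 1 else yrRoot b n q i := fun u ↦ by
    unfold signCoeff
    split_ifs <;> simp [spec_yRoot]
  have h2 : realise b n q t γ l β (genOp b q n i f) =
      ∑ u, (algebraMap ℂ _ t * (1 - yrRoot b n q i) *
        twist b q (simpleRefl b i) (spec t (f (simpleRefl b i * u)))) *
        (algebraMap ℂ _ (∏ k ∈ inv b u, rCoeff b n t γ l β k) * yr b q (dotW b l u β)) +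
      ∑ u, ((1 - algebraMap ℂ _ t ^ 2) * (if b.IsPos (perm u⁻¹ i) then 1 else yrRoot b n q i) *
        twist b q (simpleRefl b i) (spec t (f u))) *
        (algebraMap ℂ _ (∏ k ∈ inv b u, rCoeff b n t γ l β k) * yr b q (dotW b l u β)) := by
    rw [realise, ← Finset.sum_add_distrib]
    refine Finset.sum_congr rfl fun u _ ↦ ?_
    simp only [genOp, map_add, map_mul, map_sub, map_one, map_pow, spec_X, spec_yRoot, spec_tw, h1]
    ring
  rw [h2, ← Equiv.sum_comp (Equiv.mulLeft (simpleRefl b i)), ← Finset.sum_add_distrib, realise,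
    starGen_sum, Finset.mul_sum]
  refine Finset.sum_congr rfl fun u _ ↦ ?_
  have h3 := starGen_monomial b n q l hγ0 hγ ht hβ i u
  rw [starGen_mul b n q γ l i (hf u), starGen_mul b n q γ l i (Subalgebra.algebraMap_mem _ _),
    AlgHom.commutes, Equiv.coe_mulLeft, refl_mul_refl_mul]
  simp only [map_sub, map_one, map_mul, map_pow, spec_X, spec_yRoot]
  rw [← map_pow, ht] at h3 ⊢
  linear_combination (twist b q (simpleRefl b i)) (spec t (f u)) * h3


/-! ### From words in the star operators to the right action of the Weyl group. -/

/-- The operators `starGen` of a word in the simple reflections. -/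
def starWord (γ : ZMod n → ℂ) (L : List b.support) (f : RatFn (Lat P)) : RatFn (Lat P) :=
  L.foldl (fun g i ↦ starGen b n q γ l i g) f

lemma starWord_cons (i : b.support) (L : List b.support) (f : RatFn (Lat P)) :
    starWord b n q l γ (i :: L) f = starWord b n q l γ L (starGen b n q γ l i f) := rfl

lemma starWord_add (L : List b.support) (f g : RatFn (Lat P)) :
    starWord b n q l γ L (f + g) = starWord b n q l γ L f + starWord b n q l γ L g := by
  induction L generalizing f g with
  | nil => rfl
  | cons i L ih => rw [starWord_cons, starGen_add, ih, starWord_cons, starWord_cons]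

lemma starWord_mul (L : List b.support) {g : RatFn (Lat P)} (hg : g ∈ basePiece P n)
    (f : RatFn (Lat P)) : starWord b n q l γ L (g * f) =
      twist b q (L.map (simpleRefl b)).prod g * starWord b n q l γ L f := by
  induction L generalizing f g with
  | nil =>
    rw [List.map_nil, List.prod_nil, twist_one]
    rfl
  | cons i L ih =>
    rw [starWord_cons, starGen_mul b n q γ l i hg, ih (twist_mem_basePiece b n q _ hg),
      List.map_cons, List.prod_cons, twist_mul, starWord_cons]

lemma realise_genWord (hγ0 : γ 0 = -1) (hγ : ∀ k : ZMod n, k ≠ 0 → γ k * γ (-k) = 1 / (q : ℂ))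
    (ht : t ^ 2 = 1 / (q : ℂ)) {β : Lat P}
    (hβ : ∀ k, b.IsPos k → 0 ≤ shp b l k β ∧ shp b l k β ≤ mInt P n k) (L : List b.support)
    {f : UMod P} (hf : ∀ u, spec t (f u) ∈ basePiece P n) :
    realise b n q t γ l β (genWord b q n L f) = spec t (genDen b q n L) *
      starWord b n q l γ L (realise b n q t γ l β f) := by
  induction L generalizing f with
  | nil =>
    rw [genDen, map_one, one_mul]
    rfl
  | cons i L ih =>
    have hg : spec t (1 - Polynomial.X ^ 2 * yRoot b q n i) ∈ basePiece P n := by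
      rw [map_sub, map_one, map_mul, map_pow, spec_X, spec_yRoot]
      exact sub_mem (one_mem _) (mul_mem (pow_mem (Subalgebra.algebraMap_mem _ _) 2)
        (yrRoot_mem b n q i))
    rw [genWord_cons, ih (basePiece_genOp b n q hf i), realise_genOp b n q l hγ0 hγ ht hβ hf,
      starWord_mul b n q l L hg, genDen, map_mul, spec_tw, starWord_cons]
    ring

lemma spec_genDen_ne_zero (L : List b.support) :
    spec t (genDen b q n L) ≠ 0 := by
  induction L with
  | nil => rw [genDen, map_one]; exact one_ne_zero
  | cons i L ih =>
    rw [genDen, map_mul, spec_tw]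
    refine mul_ne_zero ?_ ih
    refine (map_ne_zero (twist b q (L.map (simpleRefl b)).prod)).mpr ?_
    rw [map_sub, map_one, map_mul, map_pow, spec_X, spec_yRoot, ← map_pow]
    exact one_sub_yrRoot_ne_zero b n q i _

variable (γ) in
lemma rCoeff_ne_zero (hγ0 : γ 0 = -1) (hγ : ∀ k : ZMod n, k ≠ 0 → γ k * γ (-k) = 1 / (q : ℂ))
    (ht : t ^ 2 = 1 / (q : ℂ)) (β : Lat P) (k : ι) : rCoeff b n t γ l β k ≠ 0 := by
  have hq : (1 : ℂ) / q ≠ 0 := one_div_ne_zero (NeZero.ne _)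
  have ht0 : t ≠ 0 := by
    rintro rfl
    exact hq (by rw [← ht]; ring)
  have hγne : ∀ z, γ z ≠ 0 := fun z hz ↦ by
    by_cases h : z = 0
    · rw [h, hγ0] at hz; exact neg_ne_zero.mpr one_ne_zero hz
    · apply hq; rw [← hγ z h, hz, zero_mul]
  unfold rCoeff
  split_ifs
  · exact ht0
  · exact mul_ne_zero (neg_ne_zero.mpr (inv_ne_zero ht0)) (hγne _)

/-- By semilinearity it suffices to test monomials `y ^ (w • β₀)` with `β₀` in the alcove. Such a
monomial is, up to a nonzero scalar, the realisation of a basis vector, so the universal relation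
applies and the denominators cancel. -/
lemma starWord_eq_of_prod_eq (hγ0 : γ 0 = -1)
    (hγ : ∀ k : ZMod n, k ≠ 0 → γ k * γ (-k) = 1 / (q : ℂ)) {L L' : List b.support}
    (h : (L.map (simpleRefl b)).prod = (L'.map (simpleRefl b)).prod) (f : RatFn (Lat P)) :
    starWord b n q l γ L f = starWord b n q l γ L' f := by
  classical
  -- Either square root of `1/q` serves as the value of the formal variable.
  obtain ⟨t, ht⟩ := IsAlgClosed.exists_pow_nat_eq (1 / (q : ℂ)) (n := 2) (by norm_num)
  induction f using ratFn_induction b n q with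
  | add f g hf hg => rw [starWord_add, starWord_add, hf, hg]
  | mul g hg β =>
    obtain ⟨β₀, w, κ, hκ, hβ₀, rfl⟩ := exists_alcove_representative b l n β
    rw [yr_add, mul_comm (yr b q _), ← mul_assoc,
      starWord_mul b n q l L (mul_mem hg (yr_mem_basePiece b n q hκ)),
      starWord_mul b n q l L' (mul_mem hg (yr_mem_basePiece b n q hκ)), h]
    congr 1
    let f : UMod P := Pi.single w 1
    have hfw : f w = 1 := Pi.single_eq_same w 1
    have hfu : ∀ u, u ≠ w → f u = 0 := fun u hu ↦ Pi.single_eq_of_ne hu 1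
    have hf : ∀ u, spec t (f u) ∈ basePiece P n := fun u ↦ by
      by_cases hu : u = w
      · subst hu
        rw [hfw, map_one]
        exact one_mem _
      · rw [hfu u hu, map_zero]
        exact zero_mem _
    set c := ∏ k ∈ inv b w, rCoeff b n t γ l β₀ k
    have hc0 : algebraMap ℂ (RatFn (Lat P)) c ≠ 0 := by
      rw [map_ne_zero]
      exact Finset.prod_ne_zero_iff.mpr fun k _ ↦ rCoeff_ne_zero b n q γ l hγ0 hγ ht β₀ k
    have hr : realise b n q t γ l β₀ f = algebraMap ℂ _ c * yr b q (dotW b l w β₀) := by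
      rw [realise, Finset.sum_eq_single w]
      · rw [hfw, map_one, one_mul]
      · intro u _ hu
        rw [hfu u hu, map_zero, zero_mul]
      · simp
    have e1 := realise_genWord b n q l hγ0 hγ ht hβ₀ L hf
    have e2 := realise_genWord b n q l hγ0 hγ ht hβ₀ L' hf
    have e3 : spec t (genDen b q n L') * realise b n q t γ l β₀ (genWord b q n L f) =
        spec t (genDen b q n L) * realise b n q t γ l β₀ (genWord b q n L' f) := by
      rw [realise, realise, Finset.mul_sum, Finset.mul_sum]
      refine Finset.sum_congr rfl fun u _ ↦ ?_
      have hZ := congrArg (spec t) (genWord_eq_of_prod_eq b q n h f u)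
      rw [map_mul, map_mul] at hZ
      rw [← mul_assoc, hZ, mul_assoc]
    rw [e1, e2, hr, starWord_mul b n q l L (Subalgebra.algebraMap_mem _ _),
      starWord_mul b n q l L' (Subalgebra.algebraMap_mem _ _), AlgHom.commutes,
      AlgHom.commutes] at e3
    have hd := spec_genDen_ne_zero b n q (t := t) L
    have hd' := spec_genDen_ne_zero b n q (t := t) L'
    have e4 : (spec t (genDen b q n L') * spec t (genDen b q n L) * algebraMap ℂ _ c) *
        starWord b n q l γ L (yr b q (dotW b l w β₀)) =
        (spec t (genDen b q n L') * spec t (genDen b q n L) * algebraMap ℂ _ c) *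
        starWord b n q l γ L' (yr b q (dotW b l w β₀)) := by
      linear_combination e3
    exact mul_left_cancel₀ (mul_ne_zero (mul_ne_zero hd' hd) hc0) e4

/-- The product of the monomials `Y_k` over the inversions of `w`. -/
def invProd (w : P.weylGroup) : RatFn (Lat P) := ∏ k ∈ inv b w, yrRoot b n q k

lemma invProd_ne_zero (w : P.weylGroup) : invProd b n q w ≠ 0 :=
  Finset.prod_ne_zero_iff.mpr fun k _ ↦ yrRoot_ne_zero b n q k

lemma twist_yrRoot (w : P.weylGroup) (k : ι) :
    twist b q w (yrRoot b n q k) = yrRoot b n q (perm w⁻¹ k) := by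
  rw [yrRoot, twist_yr, map_nsmul, ← rt_perm, yrRoot, mInt_perm]

lemma yrRoot_opp (k : ι) : yrRoot b n q (opp P k) = (yrRoot b n q k)⁻¹ := by
  rw [yrRoot, mInt_opp, rt_opp, smul_neg, yr_neg, yrRoot]

/-- The cocycle rule holds for ascents and descents alike, because `Y_(-α) = Y_α⁻¹`. -/
lemma invProd_simple_mul (i : b.support) (w : P.weylGroup) :
    invProd b n q (simpleRefl b i * w) = twist b q w (yrRoot b n q i) * invProd b n q w := by
  rw [twist_yrRoot]
  by_cases h : b.IsPos (perm w⁻¹ i)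
  · exact prod_inv_simple_mul b _ i w h
  · rw [invProd, invProd, prod_inv_simple_mul' b _ i w h, yrRoot_opp,
      mul_inv_cancel_left₀ (yrRoot_ne_zero b n q _)]

variable (γ)

lemma slashWord_cons (i : b.support) (L : List b.support) (f : RatFn (Lat P)) :
    slashWord b n q γ l (i :: L) f = slashWord b n q γ l L (slashGen b n q γ l i f) := rfl

lemma slashWord_mul (L : List b.support) {g : RatFn (Lat P)} (hg : g ∈ basePiece P n)
    (f : RatFn (Lat P)) : slashWord b n q γ l L (g * f) =
      twist b q (L.map (simpleRefl b)).prod g * slashWord b n q γ l L f := by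
  induction L generalizing f g with
  | nil =>
    rw [List.map_nil, List.prod_nil, twist_one]
    rfl
  | cons i L ih =>
    rw [slashWord_cons, slashGen_mul b n q γ l i hg, ih (twist_mem_basePiece b n q _ hg),
      List.map_cons, List.prod_cons, twist_mul, slashWord_cons]

lemma starWord_eq (L : List b.support) (f : RatFn (Lat P)) : starWord b n q l γ L f =
    invProd b n q (L.map (simpleRefl b)).prod * slashWord b n q γ l L f := by
  induction L generalizing f with
  | nil =>
    rw [List.map_nil, List.prod_nil, invProd, inv_one, Finset.prod_empty, one_mul]
    rfl
  | cons i L ih =>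
    rw [starWord_cons, ih, starGen, slashWord_mul b n q γ l L (yrRoot_mem b n q i), List.map_cons,
      List.prod_cons, invProd_simple_mul, slashWord_cons]
    ring

lemma slashWord_eq_of_prod_eq (hγ0 : γ 0 = -1)
    (hγ : ∀ k : ZMod n, k ≠ 0 → γ k * γ (-k) = 1 / (q : ℂ)) {L L' : List b.support}
    (h : (L.map (simpleRefl b)).prod = (L'.map (simpleRefl b)).prod) (f : RatFn (Lat P)) :
    slashWord b n q γ l L f = slashWord b n q γ l L' f := by
  have h1 := starWord_eq_of_prod_eq b n q l hγ0 hγ h f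
  rw [starWord_eq, starWord_eq, h] at h1
  exact mul_left_cancel₀ (invProd_ne_zero b n q _) h1

/-- The operators `|σ_i` define an action of the Weyl group. -/
theorem slash_prod (hγ0 : γ 0 = -1) (hγ : ∀ k : ZMod n, k ≠ 0 → γ k * γ (-k) = 1 / (q : ℂ))
    (L : List b.support) (f : RatFn (Lat P)) :
    slash b n q γ l (L.map (simpleRefl b)).prod f = slashWord b n q γ l L f :=
  slashWord_eq_of_prod_eq b n q γ l hγ0 hγ (exists_word b _).choose_spec f

end Specialisation

section Invariance

/-! ### Invariance of `h` -/

variable {ι M N : Type*} [Fintype ι] [AddCommGroup M] [Module ℝ M] [AddCommGroup N] [Module ℝ N]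
variable {P : RootPairing ι ℝ M N} (b : P.Base) (n q : ℕ) [NeZero q]
variable [P.IsCrystallographic]

open scoped Classical in
lemma Delta_eq : Delta b n q = ∏ k with b.IsPos k, (1 - yrRoot b n q k) := by
  refine Finset.prod_congr rfl fun k _ ↦ ?_
  rw [yrRoot, yr_eq, map_nsmul, nsmul_eq_mul]

open scoped Classical in
lemma DFun_eq : DFun b n q =
    ∏ k with b.IsPos k, (1 - algebraMap ℂ _ (1 / (q : ℂ)) * yrRoot b n q k) := by
  refine Finset.prod_congr rfl fun k _ ↦ ?_
  rw [yrRoot, yr_eq, map_nsmul, nsmul_eq_mul, zpow_sub_one₀ (natCast_ne_zero' q), map_div₀, map_one,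
    map_natCast, one_div]
  ring

lemma Delta_ne_zero [NeZero n] : Delta b n q ≠ 0 := by
  rw [Delta_eq]
  exact Finset.prod_ne_zero_iff.mpr fun k _ ↦ one_sub_yrRoot_ne_zero' b n q k

lemma DFun_ne_zero [NeZero n] : DFun b n q ≠ 0 := by
  rw [DFun_eq]
  exact Finset.prod_ne_zero_iff.mpr fun k _ ↦ one_sub_yrRoot_ne_zero b n q k _

lemma Delta_mem : Delta b n q ∈ basePiece P n := by
  rw [Delta_eq]
  exact prod_mem fun k _ ↦ sub_mem (one_mem _) (yrRoot_mem b n q k)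

variable [P.IsRootSystem] [P.IsReduced] [P.IsIrreducible] [NeZero n]
variable (γ : ZMod n → ℂ) (l : b.support → ℕ)

lemma slashWord_add (L : List b.support) (f g : RatFn (Lat P)) :
    slashWord b n q γ l L (f + g) = slashWord b n q γ l L f + slashWord b n q γ l L g := by
  induction L generalizing f g with
  | nil => rfl
  | cons i L ih => rw [slashWord_cons, map_add, ih, slashWord_cons, slashWord_cons]

lemma slash_add (w : P.weylGroup) (f g : RatFn (Lat P)) :
    slash b n q γ l w (f + g) = slash b n q γ l w f + slash b n q γ l w g :=
  slashWord_add b n q γ l _ f g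

lemma slash_mul_left (w : P.weylGroup) {g : RatFn (Lat P)} (hg : g ∈ basePiece P n)
    (f : RatFn (Lat P)) : slash b n q γ l w (g * f) = twist b q w g * slash b n q γ l w f := by
  have h := (exists_word b w).choose_spec
  conv_rhs => rw [← h]
  rw [slash, slash, slashWord_mul b n q γ l _ hg, h]

lemma slash_sum (w : P.weylGroup) {κ : Type*} (s : Finset κ) (f : κ → RatFn (Lat P)) :
    slash b n q γ l w (∑ k ∈ s, f k) = ∑ k ∈ s, slash b n q γ l w (f k) := by
  have h0 : slash b n q γ l w 0 = 0 := by
    have := slash_mul_left b n q γ l w (zero_mem (basePiece P n)) 0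
    rwa [zero_mul, map_zero, zero_mul] at this
  exact map_sum (⟨⟨slash b n q γ l w, h0⟩, slash_add b n q γ l w⟩ :
    RatFn (Lat P) →+ RatFn (Lat P)) f s

/-- As `Δ` has degree zero, `Δ⁻¹|w` is `Δ(w x)⁻¹ (1|w)`, and this equals `Δ⁻¹ j(w, x) (1|w)`. Thus
`h` is an average over the group. -/
lemma hFun_eq : hFun b n q γ l = ∑ w : P.weylGroup, slash b n q γ l w (Delta b n q)⁻¹ := by
  rw [hFun, Finset.mul_sum]
  refine Finset.sum_congr rfl fun w _ ↦ ?_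
  have h := slash_mul_left b n q γ l w (inv_mem_basePiece n (Delta_mem b n q)) 1
  rw [mul_one] at h
  rw [h, map_inv₀, jFun]
  have := Delta_ne_zero b n q
  field_simp

/-- The relations between the numbers `γ(k)`. -/
structure IsGauss (γ : ZMod n → ℂ) : Prop where
  zero : γ 0 = -1
  mul_neg : ∀ k : ZMod n, k ≠ 0 → γ k * γ (-k) = 1 / (q : ℂ)

variable {γ}

lemma slash_word (hγ : IsGauss n q γ) (L : List b.support) (f : RatFn (Lat P)) :
    slash b n q γ l (L.map (simpleRefl b)).prod f = slashWord b n q γ l L f :=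
  slash_prod b n q γ l hγ.zero hγ.mul_neg L f

lemma slash_one (hγ : IsGauss n q γ) (f : RatFn (Lat P)) : slash b n q γ l 1 f = f :=
  slash_word b n q l hγ [] f

lemma slash_simple (hγ : IsGauss n q γ) (i : b.support) (f : RatFn (Lat P)) :
    slash b n q γ l (simpleRefl b i) f = slashGen b n q γ l i f := by
  have h := slash_word b n q l hγ [i] f
  rwa [List.map_singleton, List.prod_singleton] at h

lemma slash_mul (hγ : IsGauss n q γ) (w w' : P.weylGroup) (f : RatFn (Lat P)) :
    slash b n q γ l (w * w') f = slash b n q γ l w' (slash b n q γ l w f) := by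
  obtain ⟨L, rfl⟩ := exists_word b w
  obtain ⟨L', rfl⟩ := exists_word b w'
  rw [← List.prod_append, ← List.map_append, slash_word b n q l hγ, slash_word b n q l hγ,
    slash_word b n q l hγ, slashWord, List.foldl_append]
  rfl

/-- The function `h` is invariant. -/
theorem slash_hFun (hγ : IsGauss n q γ) (w : P.weylGroup) :
    slash b n q γ l w (hFun b n q γ l) = hFun b n q γ l := by
  rw [hFun_eq, slash_sum]
  simp only [← slash_mul b n q l hγ]
  exact Equiv.sum_comp (Equiv.mulRight w) fun w ↦ slash b n q γ l w (Delta b n q)⁻¹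

/-! ### The action twisted by `j` -/

variable (γ) in
/-- The operator `f ↦ j(w, x) (f|w)`. -/
def bar (w : P.weylGroup) (f : RatFn (Lat P)) : RatFn (Lat P) :=
  jFun b n q w * slash b n q γ l w f

lemma bar_one (hγ : IsGauss n q γ) (f : RatFn (Lat P)) : bar b n q γ l 1 f = f := by
  rw [bar, slash_one b n q l hγ, jFun, twist_one, div_self (Delta_ne_zero b n q), one_mul]

lemma bar_mul_left (w : P.weylGroup) {g : RatFn (Lat P)} (hg : g ∈ basePiece P n)
    (f : RatFn (Lat P)) : bar b n q γ l w (g * f) = twist b q w g * bar b n q γ l w f := by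
  rw [bar, slash_mul_left b n q γ l w hg, bar]
  ring

lemma bar_sum (w : P.weylGroup) {κ : Type*} (s : Finset κ) (f : κ → RatFn (Lat P)) :
    bar b n q γ l w (∑ k ∈ s, f k) = ∑ k ∈ s, bar b n q γ l w (f k) := by
  rw [bar, slash_sum, Finset.mul_sum]
  rfl

lemma bar_mul (hγ : IsGauss n q γ) (w w' : P.weylGroup) (f : RatFn (Lat P)) :
    bar b n q γ l (w * w') f = bar b n q γ l w' (bar b n q γ l w f) := by
  have hj : jFun b n q w ∈ basePiece P n := by
    rw [jFun, div_eq_mul_inv]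
    exact mul_mem (Delta_mem b n q)
      (inv_mem_basePiece n (twist_mem_basePiece b n q w (Delta_mem b n q)))
  have h1 : twist b q w' (Delta b n q) ≠ 0 := (map_ne_zero _).mpr (Delta_ne_zero b n q)
  rw [bar, bar, bar, slash_mul_left b n q γ l w' hj, slash_mul b n q l hγ, jFun, jFun, jFun,
    twist_mul, map_div₀]
  field_simp

-- The reflection permutes the factors other than `1 - Y_i` and sends that one to `1 - Y_i⁻¹ =
-- -Y_i⁻¹ (1 - Y_i)`. Hence `j(σ_i, x) = -Y_i`.
open scoped Classical in
lemma twist_simple_Delta (i : b.support) :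
    Delta b n q = -yrRoot b n q i * twist b q (simpleRefl b i) (Delta b n q) := by
  rw [Delta_eq, map_prod]
  have hmem : (i : ι) ∈ Finset.univ.filter fun k ↦ b.IsPos k := by simp [isPos_simple b i]
  rw [← Finset.mul_prod_erase _ _ hmem, ← Finset.mul_prod_erase _ _ hmem]
  simp only [map_sub, map_one, twist_yrRoot, refl_inv]
  have h2 : ∏ k ∈ (Finset.univ.filter fun k ↦ b.IsPos k).erase i,
      (1 - yrRoot b n q (perm (simpleRefl b i) k)) =
      ∏ k ∈ (Finset.univ.filter fun k ↦ b.IsPos k).erase i, (1 - yrRoot b n q k) := by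
    have hmaps : ∀ k ∈ (Finset.univ.filter fun k ↦ b.IsPos k).erase (i : ι),
        perm (simpleRefl b i) k ∈ (Finset.univ.filter fun k ↦ b.IsPos k).erase (i : ι) := by
      intro k hk
      simp only [Finset.mem_erase, Finset.mem_filter, Finset.mem_univ, true_and] at hk ⊢
      refine ⟨fun h' ↦ ?_, isPos_perm_simple b i hk.2 hk.1⟩
      rw [perm_eq_iff, refl_inv, perm_refl_self] at h'
      rw [h', isPos_opp] at hk
      exact hk.2 (isPos_simple b i)
    refine Finset.prod_nbij' (perm (simpleRefl b i)) (perm (simpleRefl b i)) hmaps hmaps ?_ ?_ ?_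
    · intro k _; simp
    · intro k _; simp
    · intro k _; rfl
  rw [h2, perm_refl_self, yrRoot_opp]
  have := yrRoot_ne_zero b n q i
  field_simp
  ring

lemma bar_simple (hγ : IsGauss n q γ) (i : b.support) (f : RatFn (Lat P)) :
    bar b n q γ l (simpleRefl b i) f = -starGen b n q γ l i f := by
  have h1 : twist b q (simpleRefl b i) (Delta b n q) ≠ 0 :=
    (map_ne_zero _).mpr (Delta_ne_zero b n q)
  rw [bar, slash_simple b n q l hγ, starGen, jFun]
  rw [div_eq_of_eq_mul h1 (twist_simple_Delta b n q i), neg_mul]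

variable (γ) in
/-- The sum of the `j(w, x) (1|w)`. -/
def barSum : RatFn (Lat P) := ∑ w : P.weylGroup, bar b n q γ l w 1

lemma hFun_eq_div : hFun b n q γ l = barSum b n q γ l / Delta b n q := by
  rw [hFun, barSum, div_eq_inv_mul]
  rfl

lemma bar_barSum (hγ : IsGauss n q γ) (w : P.weylGroup) :
    bar b n q γ l w (barSum b n q γ l) = barSum b n q γ l := by
  rw [barSum, bar_sum]
  simp only [← bar_mul b n q l hγ]
  exact Equiv.sum_comp (Equiv.mulRight w) fun w ↦ bar b n q γ l w 1

end Invariance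

section Numerators

/-! ### Numerators -/

variable {Λ : Type*} [AddCommGroup Λ]

/-- The support of `f` is contained in the half space `ξ ≥ c`. -/
def SuppGE (ξ : Λ →+ ℤ) (c : ℤ) (f : Laurent Λ) : Prop := ∀ β ∈ f.coeff.support, c ≤ ξ β

lemma SuppGE.zero {ξ : Λ →+ ℤ} {c : ℤ} : SuppGE ξ c (0 : Laurent Λ) := fun β hβ ↦ by simp at hβ

lemma SuppGE.mono {ξ : Λ →+ ℤ} {c d : ℤ} {f : Laurent Λ} (hf : SuppGE ξ c f) (h : d ≤ c) :
    SuppGE ξ d f := fun β hβ ↦ h.trans (hf β hβ)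

lemma SuppGE.add {ξ : Λ →+ ℤ} {c : ℤ} {f g : Laurent Λ} (hf : SuppGE ξ c f) (hg : SuppGE ξ c g) :
    SuppGE ξ c (f + g) := by
  classical
  intro β hβ
  rcases Finset.mem_union.mp (Finsupp.support_add hβ) with h | h
  exacts [hf β h, hg β h]

lemma SuppGE.smul {ξ : Λ →+ ℤ} {c : ℤ} {f : Laurent Λ} (z : ℂ) (hf : SuppGE ξ c f) :
    SuppGE ξ c (z • f) := fun β hβ ↦ hf β (Finsupp.support_smul hβ)

lemma SuppGE.neg {ξ : Λ →+ ℤ} {c : ℤ} {f : Laurent Λ} (hf : SuppGE ξ c f) :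
    SuppGE ξ c (-f) := by
  simpa using hf.smul (-1)

lemma SuppGE.sub {ξ : Λ →+ ℤ} {c : ℤ} {f g : Laurent Λ} (hf : SuppGE ξ c f) (hg : SuppGE ξ c g) :
    SuppGE ξ c (f - g) := by
  rw [sub_eq_add_neg]
  exact hf.add hg.neg

lemma SuppGE.mul {ξ : Λ →+ ℤ} {c d : ℤ} {f g : Laurent Λ} (hf : SuppGE ξ c f) (hg : SuppGE ξ d g) :
    SuppGE ξ (c + d) (f * g) := by
  classical
  intro β hβ
  obtain ⟨a, ha, e, he, rfl⟩ :=
    Finset.mem_add.mp (AddMonoidAlgebra.support_coeff_mul_subset f g hβ)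
  rw [map_add]
  exact add_le_add (hf a ha) (hg e he)

lemma SuppGE.single {ξ : Λ →+ ℤ} {c : ℤ} {β : Λ} (h : c ≤ ξ β) (z : ℂ) :
    SuppGE ξ c (AddMonoidAlgebra.single β z) := by
  intro a ha
  have : a = β := by
    by_contra h
    simp [AddMonoidAlgebra.coeff_single, Ne.symm h] at ha
  rwa [this]

lemma SuppGE.one {ξ : Λ →+ ℤ} : SuppGE ξ 0 (1 : Laurent Λ) :=
  SuppGE.single (by simp) 1

lemma SuppGE.sum {ξ : Λ →+ ℤ} {c : ℤ} {κ : Type*} (s : Finset κ) (f : κ → Laurent Λ)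
    (h : ∀ k ∈ s, SuppGE ξ c (f k)) : SuppGE ξ c (∑ k ∈ s, f k) :=
  Finset.sum_induction _ (SuppGE ξ c) (fun _ _ ↦ SuppGE.add) SuppGE.zero h

lemma SuppGE.prod {ξ : Λ →+ ℤ} {κ : Type*} (s : Finset κ) (f : κ → Laurent Λ)
    (h : ∀ k ∈ s, SuppGE ξ 0 (f k)) : SuppGE ξ 0 (∏ k ∈ s, f k) :=
  Finset.prod_induction _ (SuppGE ξ 0) (fun _ _ hf hg ↦ by simpa using hf.mul hg) SuppGE.one h

lemma SuppGE.pow {ξ : Λ →+ ℤ} {c : ℤ} {f : Laurent Λ} (hf : SuppGE ξ c f) (k : ℕ) :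
    SuppGE ξ (k * c) (f ^ k) := by
  induction k with
  | zero => simpa using SuppGE.one
  | succ k ih =>
    rw [pow_succ]
    exact (ih.mul hf).mono (by push_cast; linarith)

variable {ι M N : Type*} [Fintype ι] [AddCommGroup M] [Module ℝ M] [AddCommGroup N] [Module ℝ N]
variable {P : RootPairing ι ℝ M N} (b : P.Base) (n q : ℕ) [NeZero q]
lemma one_sub_ym_dvd (κ : Lat P) (j : ℤ) : 1 - ym b q κ ∣ 1 - ym b q (j • κ) := by
  have hpow : ∀ r : ℕ, ym b q (r • κ) = ym b q κ ^ r := fun r ↦ by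
    induction r with
    | zero => rw [zero_smul, ym_zero, pow_zero]
    | succ r ih => rw [succ_nsmul, ym_add, ih, pow_succ]
  have hnat : ∀ r : ℕ, 1 - ym b q κ ∣ 1 - ym b q (r • κ) := fun r ↦ by
    rw [hpow]
    simpa using sub_dvd_pow_sub_pow 1 (ym b q κ) r
  obtain ⟨r, rfl | rfl⟩ := j.eq_nat_or_neg
  · rw [natCast_zsmul]
    exact hnat r
  · have h := ym_neg_mul b q (r • κ)
    rw [neg_smul, natCast_zsmul]
    have : 1 - ym b q (-(r • κ)) = -ym b q (-(r • κ)) * (1 - ym b q (r • κ)) := by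
      linear_combination -h
    rw [this]
    exact (hnat r).mul_left _

variable [P.IsCrystallographic]

/-- The monomial `Y_k = y ^ (m(α_k) α_k)` as a Laurent polynomial. -/
def ymRoot (k : ι) : Laurent (Lat P) := ym b q (mInt P n k • rt P k)

lemma toRat_smul (z : ℂ) (f : Laurent (Lat P)) :
    toRat (z • f) = algebraMap ℂ _ z * toRat f := by
  rw [toRat, toRat, Algebra.smul_def, map_mul, ← IsScalarTower.algebraMap_apply]

lemma toRat_one_sub_smul (z : ℂ) (k : ι) :
    toRat (1 - z • ymRoot b n q k) = 1 - algebraMap ℂ _ z * yrRoot b n q k := by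
  rw [toRat, map_sub, map_one]
  exact congrArg (1 - ·) (toRat_smul z _)

variable [P.IsRootSystem] [P.IsReduced] [P.IsIrreducible] [NeZero n]
variable (γ : ZMod n → ℂ) (l : b.support → ℕ)

/-- The exponent `e ∈ {1, …, m}` congruent to `⟨β - θ, α_i^∨⟩` modulo `m = m(α_i)`. -/
def resExp (i : b.support) (β : Lat P) : ℤ := mInt P n i - (-shp b l i β) % mInt P n i

lemma resExp_pos (i : b.support) (β : Lat P) : 0 < resExp b n l i β := by
  have hm : (0 : ℤ) < mInt P n i := by exact_mod_cast mInt_pos (P := P) n i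
  have := Int.emod_lt_of_pos (-shp b l i β) hm
  rw [resExp]
  omega

lemma resExp_le (i : b.support) (β : Lat P) : resExp b n l i β ≤ mInt P n i := by
  have hm : (0 : ℤ) < mInt P n i := by exact_mod_cast mInt_pos (P := P) n i
  have := Int.emod_nonneg (-shp b l i β) hm.ne'
  rw [resExp]
  omega

/-- The numerator of the image of a monomial under the operator of a simple reflection. -/
def monoNum (i : b.support) (β : Lat P) : Laurent (Lat P) :=
  ((1 - 1 / (q : ℂ)) • ym b q (resExp b n l i β • rt P i) -
    γ (-(normSq P i * shp b l i β : ℤ)) • (1 - ymRoot b n q i)) * ym b q (dot b l i β)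

lemma toRat_monoNum (i : b.support) (β : Lat P) : toRat (monoNum b n q γ l i β) =
    (1 - algebraMap ℂ _ (1 / (q : ℂ)) * yrRoot b n q i) * starGen b n q γ l i (yr b q β) := by
  have hs : (simpleRefl b i)⁻¹ = simpleRefl b i := refl_inv (P := P) _
  rw [starGen_apply b n q γ l i β _ (yr_mem_piece b n q β), mul_assoc _ (yr b q _), twist_yr,
    ← yr_add, hs, add_comm (_ • _), monoNum, toRat, map_mul, map_sub]
  have h1 := toRat_smul (P := P) (1 - 1 / (q : ℂ)) (ym b q (resExp b n l i β • rt P i))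
  have h2 := toRat_smul (P := P) (γ (-(normSq P i * shp b l i β : ℤ))) (1 - ymRoot b n q i)
  rw [toRat, toRat, map_sub] at h1 h2
  rw [h1, h2, map_one, map_one]
  rfl

/-- Where `Y_i = 1`, the operator `starGen` fixes monomials: the `γ` term has the factor `1 - Y_i`,
and the other exponent differs from `β` by a multiple of `m(α_i) α_i`. All divisibility by `Δ`
originates here. -/
lemma monoNum_dvd (i : b.support) (β : Lat P) : 1 - ymRoot b n q i ∣
    (1 - (1 / (q : ℂ)) • ymRoot b n q i) * ym b q β - monoNum b n q γ l i β := by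
  obtain ⟨j, hj⟩ : ∃ j : ℤ, resExp b n l i β - shp b l i β = j * mInt P n i := by
    refine ⟨1 + (-shp b l i β) / mInt P n i, ?_⟩
    have := Int.mul_ediv_add_emod (-shp b l i β) (mInt P n i)
    rw [resExp]
    linear_combination -this
  have h1 : ym b q (resExp b n l i β • rt P i) * ym b q (dot b l i β) =
      ym b q β * ym b q (j • mInt P n i • rt P i) := by
    rw [← ym_add, ← ym_add, ← dotW_simple, dotW_refl]
    congr 1
    have : j • mInt P n i • rt P i = (resExp b n l i β - shp b l i β) • rt P i := by
      rw [hj, mul_smul, natCast_zsmul]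
    rw [this, sub_smul]
    abel
  have h2 : 1 - ymRoot b n q i ∣ _ := one_sub_ym_dvd b q (mInt P n i • rt P i) j
  have h3 : (1 - (1 / (q : ℂ)) • ymRoot b n q i) * ym b q β - monoNum b n q γ l i β =
      (1 - 1 / (q : ℂ)) • (ym b q β * (1 - ym b q (j • mInt P n i • rt P i))) +
      (1 - ymRoot b n q i) * ((1 / (q : ℂ)) • ym b q β +
        γ (-(normSq P i * shp b l i β : ℤ)) • ym b q (dot b l i β)) := by
    rw [monoNum]
    simp only [Algebra.smul_def, map_sub, map_one]
    linear_combination (algebraMap ℂ (Laurent (Lat P)) (1 / (q : ℂ)) - 1) * h1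
  rw [h3]
  refine dvd_add ?_ (dvd_mul_right _ _)
  rw [Algebra.smul_def]
  exact (h2.mul_left _).mul_left _

/-- The exponents are `σ_i • β` plus multiples of `α_i` between `0` and `m(α_i)`, so a linear
functional is smallest at one of the two ends. -/
lemma suppGE_monoNum (i : b.support) (β : Lat P) (ξ : Lat P →+ ℤ) :
    SuppGE ξ (ξ (dot b l i β) + min 0 (ξ (mInt P n i • rt P i))) (monoNum b n q γ l i β) := by
  have hm : ξ (mInt P n i • rt P i) = mInt P n i * ξ (rt P i) := by
    rw [map_nsmul, nsmul_eq_mul]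
  have he : min 0 (ξ (mInt P n i • rt P i)) ≤ ξ (resExp b n l i β • rt P i) := by
    have h1 := resExp_pos b n l i β
    have h2 := resExp_le b n l i β
    rw [hm, map_zsmul, smul_eq_mul]
    rcases le_total 0 (ξ (rt P i)) with h | h
    · exact (min_le_left _ _).trans (by positivity)
    · exact (min_le_right _ _).trans (mul_le_mul_of_nonpos_right h2 h)
  rw [monoNum, add_comm]
  refine SuppGE.mul (SuppGE.sub ((SuppGE.single he _).smul _) (SuppGE.smul _ (SuppGE.sub ?_ ?_)))
    (SuppGE.single le_rfl _)
  · exact SuppGE.one.mono (min_le_left _ _)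
  · exact SuppGE.single (min_le_right _ _) _

/-- The numerator of the image of a Laurent polynomial under the operator of a simple
reflection. -/
def starNum (i : b.support) (F : Laurent (Lat P)) : Laurent (Lat P) :=
  ∑ β ∈ F.coeff.support, (F.coeff β / (q : ℂ) ^ ht b β) • monoNum b n q γ l i β

lemma eq_sum_ym (F : Laurent (Lat P)) :
    F = ∑ β ∈ F.coeff.support, (F.coeff β / (q : ℂ) ^ ht b β) • ym b q β := by
  conv_lhs => rw [← AddMonoidAlgebra.sum_coeff_single F, Finsupp.sum]
  refine Finset.sum_congr rfl fun β _ ↦ ?_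
  rw [ym, AddMonoidAlgebra.smul_single, smul_eq_mul,
    div_mul_cancel₀ _ (zpow_ne_zero _ (NeZero.ne _))]

lemma toRat_starNum (i : b.support) (F : Laurent (Lat P)) : toRat (starNum b n q γ l i F) =
    (1 - algebraMap ℂ _ (1 / (q : ℂ)) * yrRoot b n q i) * starGen b n q γ l i (toRat F) := by
  conv_rhs => rw [eq_sum_ym b q F]
  rw [starNum, toRat, toRat, map_sum, map_sum, starGen_sum, Finset.mul_sum]
  refine Finset.sum_congr rfl fun β _ ↦ ?_
  have h1 := toRat_smul (P := P) (F.coeff β / (q : ℂ) ^ ht b β) (monoNum b n q γ l i β)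
  have h2 := toRat_smul (P := P) (F.coeff β / (q : ℂ) ^ ht b β) (ym b q β)
  rw [toRat, toRat] at h1 h2
  rw [h1, h2, starGen_mul b n q γ l i (Subalgebra.algebraMap_mem _ _), AlgHom.commutes]
  have h3 := toRat_monoNum b n q γ l i β
  rw [toRat] at h3
  rw [h3, yr, toRat]
  ring

lemma starNum_dvd (i : b.support) (F : Laurent (Lat P)) : 1 - ymRoot b n q i ∣
    (1 - (1 / (q : ℂ)) • ymRoot b n q i) * F - starNum b n q γ l i F := by
  have : (1 - (1 / (q : ℂ)) • ymRoot b n q i) * F - starNum b n q γ l i F =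
      ∑ β ∈ F.coeff.support, (F.coeff β / (q : ℂ) ^ ht b β) •
        ((1 - (1 / (q : ℂ)) • ymRoot b n q i) * ym b q β - monoNum b n q γ l i β) := by
    have h0 := congrArg (fun G ↦ (1 - (1 / (q : ℂ)) • ymRoot b n q i) * G) (eq_sum_ym b q F)
    simp only [Finset.mul_sum] at h0
    rw [h0, starNum, ← Finset.sum_sub_distrib]
    refine Finset.sum_congr rfl fun β _ ↦ ?_
    rw [smul_sub, mul_smul_comm]
  rw [this]
  refine Finset.dvd_sum fun β _ ↦ ?_
  rw [Algebra.smul_def]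
  exact (monoNum_dvd b n q γ l i β).mul_left _

lemma suppGE_starNum (i : b.support) {F : Laurent (Lat P)} (ξ : Lat P →+ ℤ) {c : ℤ}
    (hF : SuppGE (ξ.comp (weylMap (simpleRefl b i))) c F) :
    SuppGE ξ (c + ξ (((l i : ℤ) + 1) • rt P i) + min 0 (ξ (mInt P n i • rt P i)))
      (starNum b n q γ l i F) := by
  refine SuppGE.sum _ _ fun β hβ ↦ ((suppGE_monoNum b n q γ l i β ξ).mono ?_).smul _
  have := hF β hβ
  rw [AddMonoidHom.comp_apply] at this
  rw [dot, map_add]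
  linarith

variable {γ}

/-- The factor of `D` attached to the inversions of `w`. -/
def invDen (w : P.weylGroup) : Laurent (Lat P) :=
  ∏ k ∈ inv b w, (1 - (1 / (q : ℂ)) • ymRoot b n q k)

lemma toRat_invDen (w : P.weylGroup) : toRat (invDen b n q w) =
    ∏ k ∈ inv b w, (1 - algebraMap ℂ _ (1 / (q : ℂ)) * yrRoot b n q k) := by
  rw [invDen, toRat, map_prod]
  exact Finset.prod_congr rfl fun k _ ↦ toRat_one_sub_smul b n q _ k

lemma toRat_invDen_mem (w : P.weylGroup) : toRat (invDen b n q w) ∈ basePiece P n := by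
  rw [toRat_invDen]
  exact prod_mem fun k _ ↦ sub_mem (one_mem _) (mul_mem (Subalgebra.algebraMap_mem _ _)
    (yrRoot_mem b n q k))

lemma toRat_invDen_mul_simple (w : P.weylGroup) (i : b.support) (h : b.IsPos (perm w i)) :
    toRat (invDen b n q (w * simpleRefl b i)) =
      (1 - algebraMap ℂ _ (1 / (q : ℂ)) * yrRoot b n q i) *
        twist b q (simpleRefl b i) (toRat (invDen b n q w)) := by
  rw [toRat_invDen, toRat_invDen, prod_inv_mul_simple b _ i w h, map_prod]
  congr 1
  refine Finset.prod_congr rfl fun k _ ↦ ?_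
  rw [map_sub, map_one, map_mul, AlgHom.commutes, twist_yrRoot, refl_inv]

lemma thetaSub_mul (w w' : P.weylGroup) :
    thetaSub b l (w * w') = weylMap w (thetaSub b l w') + thetaSub b l w := by
  apply Subtype.ext
  rw [Submodule.coe_add, coe_weylMap, coe_thetaSub, coe_thetaSub, coe_thetaSub, mul_smul, smul_sub]
  abel

lemma thetaSub_one : thetaSub b l (1 : P.weylGroup) = 0 := by
  apply Subtype.ext
  rw [coe_thetaSub, one_smul, sub_self]
  rfl

lemma thetaSub_refl (k : ι) : thetaSub b l (refl (P := P) k) = tau b l k • rt P k := by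
  apply Subtype.ext
  rw [coe_thetaSub, refl_smul, ← coe_tau, sub_sub_cancel, Submodule.coe_smul,
    ← Int.cast_smul_eq_zsmul ℝ, coe_rt]

/-- The numerator of `j(w, x) (1|w)` is a Laurent polynomial with controlled support. -/
lemma exists_barNum (hγ : IsGauss n q γ) (w : P.weylGroup) : ∃ F : Laurent (Lat P),
    toRat F = toRat (invDen b n q w) * bar b n q γ l w 1 ∧
    ∀ ξ : Lat P →+ ℤ, SuppGE ξ (ξ (thetaSub b l w⁻¹) +
      ∑ k ∈ inv b w, min 0 (ξ (mInt P n k • rt P k))) F := by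
  induction w using weyl_induction b with
  | one =>
    refine ⟨1, ?_, fun ξ ↦ ?_⟩
    · rw [bar_one b n q l hγ, invDen, inv_one, Finset.prod_empty, mul_one]
    · rw [_root_.inv_one, thetaSub_one, inv_one, Finset.sum_empty, map_zero]
      exact SuppGE.one
  | mul w i hw ih =>
    obtain ⟨F, hF, hs⟩ := ih
    refine ⟨-starNum b n q γ l i F, ?_, fun ξ ↦ ?_⟩
    · have h1 := toRat_starNum b n q γ l i F
      have h2 : toRat (-starNum b n q γ l i F) = -toRat (starNum b n q γ l i F) := map_neg _ _
      rw [h2, h1, hF, starGen_mul b n q γ l i (toRat_invDen_mem b n q w), bar_mul b n q l hγ,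
        bar_simple b n q l hγ, toRat_invDen_mul_simple b n q w i hw]
      ring
    · have h1 := suppGE_starNum b n q γ l i ξ (hs (ξ.comp (weylMap (simpleRefl b i))))
      refine (h1.mono (le_of_eq ?_)).neg
      -- The product formula for inversions, read in `Multiplicative ℤ`, becomes the recursion for
      -- the sum of the minima.
      have h2 := prod_inv_mul_simple b
        (fun k ↦ Multiplicative.ofAdd (min 0 (ξ (mInt P n k • rt P k)))) i w hw
      simp only [← ofAdd_sum, ← ofAdd_add] at h2
      have h3 := Multiplicative.ofAdd.injective h2
      rw [h3, mul_inv_rev, refl_inv, thetaSub_mul, thetaSub_refl, tau_simple, map_add]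
      simp only [AddMonoidHom.comp_apply, map_nsmul, rt_perm, mInt_perm]
      ring

end Numerators

section Divisibility

/-! ### Divisibility by the factors of `Δ` -/

variable {ι M N : Type*} [Fintype ι] [AddCommGroup M] [Module ℝ M] [AddCommGroup N] [Module ℝ N]
variable {P : RootPairing ι ℝ M N} (b : P.Base) (n q : ℕ) [NeZero q]

/-- The quotient of the ring of Laurent polynomials in which `y ^ κ` becomes `1`. -/
def quotHom (κ : Lat P) :
    Laurent (Lat P) →ₐ[ℂ] AddMonoidAlgebra ℂ (Lat P ⧸ AddSubgroup.zmultiples κ) :=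
  AddMonoidAlgebra.lift ℂ _ (Lat P)
    { toFun := fun β ↦ AddMonoidAlgebra.single (QuotientAddGroup.mk β.toAdd)
        ((q : ℂ) ^ (-ht b β.toAdd))
      map_one' := by simp [AddMonoidAlgebra.one_def]
      map_mul' := fun β β' ↦ by
        rw [AddMonoidAlgebra.single_mul_single, ← zpow_add₀ (NeZero.ne _), toAdd_mul, map_add,
          neg_add]
        rfl }

lemma quotHom_single (κ β : Lat P) (z : ℂ) : quotHom b q κ (AddMonoidAlgebra.single β z) =
    AddMonoidAlgebra.single (QuotientAddGroup.mk β) (z * (q : ℂ) ^ (-ht b β)) := by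
  simp [quotHom]

lemma quotHom_ym (κ β : Lat P) :
    quotHom b q κ (ym b q β) = AddMonoidAlgebra.single (QuotientAddGroup.mk β) 1 := by
  rw [ym, quotHom_single, ← zpow_add₀ (NeZero.ne _), add_neg_cancel, zpow_zero]

/-- A section of `quotHom`. -/
def quotSec (κ : Lat P) (y : AddMonoidAlgebra ℂ (Lat P ⧸ AddSubgroup.zmultiples κ)) :
    Laurent (Lat P) := y.coeff.sum fun c z ↦ z • ym b q c.out

/-- Modulo `1 - y ^ κ` every monomial agrees with the one of the chosen representative of its coset.
Hence this element generates the kernel of `quotHom`. -/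
lemma dvd_sub_quotSec (κ : Lat P) (x : Laurent (Lat P)) :
    1 - ym b q κ ∣ x - quotSec b q κ (quotHom b q κ x) := by
  induction x using AddMonoidAlgebra.induction_linear with
  | zero => simp [quotSec]
  | add f g hf hg =>
    have : quotSec b q κ (quotHom b q κ f + quotHom b q κ g) =
        quotSec b q κ (quotHom b q κ f) + quotSec b q κ (quotHom b q κ g) :=
      Finsupp.sum_add_index' (fun _ ↦ zero_smul _ _) fun _ _ _ ↦ add_smul _ _ _
    rw [map_add, this, add_sub_add_comm]
    exact dvd_add hf hg
  | single β z =>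
    set c : Lat P ⧸ AddSubgroup.zmultiples κ := QuotientAddGroup.mk β with hc
    obtain ⟨j, hj⟩ : ∃ j : ℤ, j • κ = c.out - β := by
      rw [← AddSubgroup.mem_zmultiples_iff, ← QuotientAddGroup.eq_iff_sub_mem]
      exact c.out_eq
    have h1 : quotSec b q κ (AddMonoidAlgebra.single c (z * (q : ℂ) ^ (-ht b β))) =
        (z * (q : ℂ) ^ (-ht b β)) • ym b q c.out := by
      rw [quotSec, AddMonoidAlgebra.coeff_single]
      exact Finsupp.sum_single_index (zero_smul _ _)
    have h2 : (AddMonoidAlgebra.single β z : Laurent (Lat P)) =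
        (z * (q : ℂ) ^ (-ht b β)) • ym b q β := by
      rw [ym, AddMonoidAlgebra.smul_single, smul_eq_mul, mul_assoc, ← zpow_add₀ (NeZero.ne _),
        neg_add_cancel, zpow_zero, mul_one]
    have h3 : ym b q c.out = ym b q β * ym b q (j • κ) := by
      rw [← ym_add, hj, add_sub_cancel]
    rw [quotHom_single, h1, h2, ← smul_sub, h3, ← mul_one_sub, Algebra.smul_def]
    exact ((one_sub_ym_dvd b q κ j).mul_left _).mul_left _

lemma dvd_of_quotHom_eq_zero {κ : Lat P} {x : Laurent (Lat P)} (h : quotHom b q κ x = 0) :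
    1 - ym b q κ ∣ x := by
  have := dvd_sub_quotSec b q κ x
  rwa [h, quotSec, AddMonoidAlgebra.coeff_zero, Finsupp.sum_zero_index, sub_zero] at this

/-- In the group algebra of `Λ / ℤκ` the class of `μ` has infinite order. An element killed by `1 -
z y ^ μ` has support stable under translation by that class, and being finite this support is empty.
-/
lemma dvd_of_dvd_one_sub_mul {κ μ : Lat P}
    (h : ∀ j : ℤ, j • μ ∈ AddSubgroup.zmultiples κ → j = 0) {z : ℂ} (hz : z ≠ 0)
    {x : Laurent (Lat P)} (hx : 1 - ym b q κ ∣ (1 - z • ym b q μ) * x) : 1 - ym b q κ ∣ x := by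
  apply dvd_of_quotHom_eq_zero
  set y := quotHom b q κ x with hy
  set c : Lat P ⧸ AddSubgroup.zmultiples κ := QuotientAddGroup.mk μ with hc
  have h0 : quotHom b q κ (1 - ym b q κ) = 0 := by
    have : (QuotientAddGroup.mk κ : Lat P ⧸ AddSubgroup.zmultiples κ) = 0 :=
      (QuotientAddGroup.eq_zero_iff _).mpr (AddSubgroup.mem_zmultiples κ)
    rw [map_sub, map_one, quotHom_ym, this, AddMonoidAlgebra.one_def, sub_self]
  obtain ⟨d, hd⟩ := hx
  have h1 : y = AddMonoidAlgebra.single c z * y := by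
    have h2 := congrArg (quotHom b q κ) hd
    rw [map_mul, map_mul, h0, zero_mul, map_sub, map_one, map_smul, quotHom_ym,
      AddMonoidAlgebra.smul_single, smul_eq_mul, mul_one, sub_mul, one_mul, sub_eq_zero] at h2
    exact h2
  have h2 : ∀ e, y.coeff (c + e) = z * y.coeff e := fun e ↦ by
    conv_lhs => rw [h1]
    exact AddMonoidAlgebra.coeff_single_mul_add ..
  by_contra hne
  obtain ⟨e, he⟩ : ∃ e, y.coeff e ≠ 0 := by
    by_contra hall
    push Not at hall
    exact hne (by ext e; simpa using hall e)
  have h3 : ∀ j : ℕ, y.coeff (j • c + e) = z ^ j * y.coeff e := fun j ↦ by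
    induction j with
    | zero => rw [zero_smul, zero_add, pow_zero, one_mul]
    | succ j ih => rw [succ_nsmul', add_assoc, h2, ih, pow_succ']; ring
  have hinj : Function.Injective fun j : ℕ ↦ j • c + e := by
    intro j j' hjj
    have h4 : j • c = j' • c := add_right_cancel hjj
    have h5 := h ((j : ℤ) - j') (by
      rw [← QuotientAddGroup.eq_zero_iff, sub_smul, natCast_zsmul, natCast_zsmul]
      change j • c - j' • c = 0
      rw [h4, sub_self])
    omega
  refine Set.infinite_range_of_injective hinj (y.coeff.support.finite_toSet.subset ?_)
  rintro _ ⟨j, rfl⟩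
  rw [Finset.mem_coe, Finsupp.mem_support_iff, h3]
  exact mul_ne_zero (pow_ne_zero _ hz) he

variable [P.IsCrystallographic] [P.IsReduced] [NeZero n]

lemma eq_zero_of_smul_mem_zmultiples {j k : ι} (h : j ≠ k) (h' : j ≠ opp P k) (a : ℤ)
    (ha : a • mInt P n j • rt P j ∈ AddSubgroup.zmultiples (mInt P n k • rt P k)) : a = 0 := by
  have hli : LinearIndependent ℝ ![P.root j, P.root k] := by
    by_contra hli
    rcases RootPairing.IsReduced.eq_or_eq_neg j k hli with h1 | h1
    · exact h (P.root.injective h1)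
    · rw [← root_opp] at h1
      exact h' (P.root.injective h1)
  obtain ⟨c, hc⟩ := AddSubgroup.mem_zmultiples_iff.mp ha
  have hc' : (c : ℝ) • (mInt P n k : ℝ) • P.root k = (a : ℝ) • (mInt P n j : ℝ) • P.root j := by
    rw [Int.cast_smul_eq_zsmul, Int.cast_smul_eq_zsmul, Nat.cast_smul_eq_nsmul,
      Nat.cast_smul_eq_nsmul]
    exact congrArg Subtype.val hc
  have h2 := (LinearIndependent.pair_iff.mp hli (a * mInt P n j) (-(c * mInt P n k)) (by
    rw [mul_smul, ← hc', neg_smul, mul_smul, add_neg_cancel])).1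
  have hm := (mInt_pos (P := P) n j).ne'
  simpa [hm] using h2

lemma ymRoot_opp (k : ι) : ymRoot b n q (opp P k) = ym b q ((-1 : ℤ) • mInt P n k • rt P k) := by
  rw [ymRoot, mInt_opp, rt_opp, smul_neg, neg_smul, one_smul]

/-- If the roots are not proportional, `1 - z Y_j` is not a zero divisor modulo `1 - Y_k`. If `α_j =
±α_k`, it is congruent to the nonzero constant `1 - z`. -/
lemma dvd_of_dvd_one_sub_ymRoot_mul (j k : ι) {z : ℂ} (hz : z ≠ 0)
    (h : z ≠ 1 ∨ (j ≠ k ∧ j ≠ opp P k)) {x : Laurent (Lat P)}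
    (hx : 1 - ymRoot b n q k ∣ (1 - z • ymRoot b n q j) * x) : 1 - ymRoot b n q k ∣ x := by
  by_cases hj : j ≠ k ∧ j ≠ opp P k
  · exact dvd_of_dvd_one_sub_mul b q (eq_zero_of_smul_mem_zmultiples n hj.1 hj.2) hz hx
  · have hz1 : z ≠ 1 := h.resolve_right hj
    obtain ⟨a, ha⟩ : ∃ a : ℤ, ymRoot b n q j = ym b q (a • mInt P n k • rt P k) := by
      by_cases hjk : j = k
      · exact ⟨1, by rw [one_smul, hjk, ymRoot]⟩
      · refine ⟨-1, ?_⟩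
        rw [not_and_not_right.mp hj hjk, ymRoot_opp]
    have h1 : 1 - ymRoot b n q k ∣ 1 - ym b q (a • mInt P n k • rt P k) := one_sub_ym_dvd b q _ a
    have h2 : (1 - z) • x = (1 - z • ymRoot b n q j) * x -
        (z • x) * (1 - ym b q (a • mInt P n k • rt P k)) := by
      rw [ha]
      simp only [Algebra.smul_def, map_sub, map_one]
      ring
    have h3 : 1 - ymRoot b n q k ∣ (1 - z) • x := by
      rw [h2]
      exact dvd_sub hx (h1.mul_left _)
    have h4 := h3.mul_left (algebraMap ℂ _ (1 - z)⁻¹)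
    rwa [← Algebra.smul_def, smul_smul, inv_mul_cancel₀ (sub_ne_zero.mpr hz1.symm), one_smul] at h4

-- Distinct positive roots are not proportional, so each new factor can be cancelled against the
-- earlier ones. No unique factorisation is needed.
open scoped Classical in
lemma prod_one_sub_ymRoot_dvd (s : Finset ι) (hs : ∀ k ∈ s, b.IsPos k) {x : Laurent (Lat P)}
    (hx : ∀ k ∈ s, 1 - ymRoot b n q k ∣ x) : ∏ k ∈ s, (1 - ymRoot b n q k) ∣ x := by
  induction s using Finset.induction_on with
  | empty => simp
  | insert k s hk ih =>
    obtain ⟨y, rfl⟩ := ih (fun k hk ↦ hs k (Finset.mem_insert_of_mem hk))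
      fun k hk ↦ hx k (Finset.mem_insert_of_mem hk)
    rw [Finset.prod_insert hk, mul_comm]
    refine mul_dvd_mul_left _ ?_
    have h1 := hx k (Finset.mem_insert_self k s)
    have hs' : ∀ j ∈ s, j ≠ k ∧ j ≠ opp P k := fun j hj ↦ by
      refine ⟨fun h ↦ hk (h ▸ hj), fun h ↦ ?_⟩
      have h2 := hs j (Finset.mem_insert_of_mem hj)
      rw [h, isPos_opp] at h2
      exact h2 (hs k (Finset.mem_insert_self k s))
    clear hx ih hs hk
    induction s using Finset.induction_on with
    | empty => simpa using h1
    | insert j s hj ih =>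
      rw [Finset.prod_insert hj, mul_assoc] at h1
      refine ih ?_ fun j hj ↦ hs' j (Finset.mem_insert_of_mem hj)
      refine dvd_of_dvd_one_sub_ymRoot_mul b n q j k one_ne_zero
        (Or.inr (hs' j (Finset.mem_insert_self j s))) ?_
      rwa [one_smul]

end Divisibility

section Regular

/-! ### Rational functions with controlled denominators -/

variable {ι M N : Type*} [Fintype ι] [AddCommGroup M] [Module ℝ M] [AddCommGroup N] [Module ℝ N]
variable {P : RootPairing ι ℝ M N} (b : P.Base) (n q : ℕ) [NeZero q]
variable [P.IsCrystallographic]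

/-- The multiplicative set generated by the factors `1 - Y_k / q`. -/
def denSub : Submonoid (Laurent (Lat P)) :=
  Submonoid.closure (Set.range fun k ↦ 1 - (1 / (q : ℂ)) • ymRoot b n q k)

lemma one_sub_mem_denSub (k : ι) : 1 - (1 / (q : ℂ)) • ymRoot b n q k ∈ denSub b n q :=
  Submonoid.subset_closure ⟨k, rfl⟩

/-- The rational functions whose denominators are products of factors `1 - Y_k / q`. -/
def IsReg (z : RatFn (Lat P)) : Prop := ∃ c ∈ denSub b n q, ∃ F, toRat c * z = toRat F

variable {b n q} in
lemma IsReg.add {z z' : RatFn (Lat P)} (hz : IsReg b n q z) (hz' : IsReg b n q z') :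
    IsReg b n q (z + z') := by
  obtain ⟨c, hc, F, hF⟩ := hz
  obtain ⟨c', hc', F', hF'⟩ := hz'
  refine ⟨c * c', mul_mem hc hc', c' * F + c * F', ?_⟩
  simp only [toRat, map_mul, map_add] at *
  rw [← hF, ← hF']
  ring

variable {b n q} in
lemma IsReg.toRat_mul {z : RatFn (Lat P)} (hz : IsReg b n q z) (G : Laurent (Lat P)) :
    IsReg b n q (toRat G * z) := by
  obtain ⟨c, hc, F, hF⟩ := hz
  refine ⟨c, hc, G * F, ?_⟩
  simp only [toRat, map_mul] at *
  rw [← hF]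
  ring

lemma isReg_toRat (F : Laurent (Lat P)) : IsReg b n q (toRat F) :=
  ⟨1, one_mem _, F, by rw [toRat, map_one, one_mul]⟩

variable {b n q} in
lemma IsReg.sum {κ : Type*} (s : Finset κ) (z : κ → RatFn (Lat P))
    (hz : ∀ k ∈ s, IsReg b n q (z k)) : IsReg b n q (∑ k ∈ s, z k) := by
  refine Finset.sum_induction _ (IsReg b n q) (fun _ _ ↦ IsReg.add) ?_ hz
  have := isReg_toRat b n q 0
  rwa [toRat, map_zero] at this

variable [P.IsRootSystem] [P.IsReduced] [P.IsIrreducible] [NeZero n]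

lemma twistHom_ymRoot (w : P.weylGroup) (k : ι) :
    twistHom b q w (ymRoot b n q k) = ymRoot b n q (perm w⁻¹ k) := by
  rw [ymRoot, twistHom_ym, map_nsmul, ← rt_perm, ymRoot, mInt_perm]

lemma toRat_ne_zero_of_mem_denSub {c : Laurent (Lat P)} (hc : c ∈ denSub b n q) : toRat c ≠ 0 := by
  induction hc using Submonoid.closure_induction with
  | mem c hc =>
    obtain ⟨k, rfl⟩ := hc
    dsimp only
    rw [toRat_one_sub_smul]
    exact one_sub_yrRoot_ne_zero b n q k _
  | one => rw [toRat, map_one]; exact one_ne_zero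
  | mul c c' _ _ h h' =>
    rw [toRat, map_mul]
    exact mul_ne_zero h h'

lemma toRat_mem_of_mem_denSub {c : Laurent (Lat P)} (hc : c ∈ denSub b n q) :
    toRat c ∈ basePiece P n := by
  induction hc using Submonoid.closure_induction with
  | mem c hc =>
    obtain ⟨k, rfl⟩ := hc
    dsimp only
    rw [toRat_one_sub_smul]
    exact sub_mem (one_mem _) (mul_mem (Subalgebra.algebraMap_mem _ _) (yrRoot_mem b n q k))
  | one => rw [toRat, map_one]; exact one_mem _
  | mul c c' _ _ h h' =>
    rw [toRat, map_mul]
    exact mul_mem h h'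

lemma twistHom_mem_denSub (w : P.weylGroup) {c : Laurent (Lat P)} (hc : c ∈ denSub b n q) :
    twistHom b q w c ∈ denSub b n q := by
  induction hc using Submonoid.closure_induction with
  | mem c hc =>
    obtain ⟨k, rfl⟩ := hc
    dsimp only
    rw [map_sub, map_one, map_smul, twistHom_ymRoot]
    exact one_sub_mem_denSub b n q _
  | one => rw [map_one]; exact one_mem _
  | mul c c' _ _ h h' =>
    rw [map_mul]
    exact mul_mem h h'

/-- By `mInt_dvd_coroot'In_smul`, `σ_i` moves `m(α_k) α_k` by a multiple of `m(α_i) α_i`. It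
therefore acts trivially on the `Y_k` modulo `1 - Y_i`. -/
lemma dvd_twistHom_sub (i : b.support) {c : Laurent (Lat P)} (hc : c ∈ denSub b n q) :
    1 - ymRoot b n q i ∣ twistHom b q (simpleRefl b i) c - c := by
  induction hc using Submonoid.closure_induction with
  | mem c hc =>
    obtain ⟨k, rfl⟩ := hc
    dsimp only
    obtain ⟨j, hj⟩ := mInt_dvd_coroot'In_smul (P := P) n i k
    have h1 : ymRoot b n q k = ymRoot b n q (perm (simpleRefl b i) k) *
        ym b q (j • mInt P n i • rt P i) := by
      rw [ymRoot, ymRoot, ← ym_add, mInt_perm, rt_perm, ← map_nsmul, weylMap_refl, hj, mul_comm,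
        mul_smul, natCast_zsmul, sub_add_cancel]
    have h2 := one_sub_ym_dvd b q (mInt P n i • rt P i) j
    rw [map_sub, map_one, map_smul, twistHom_ymRoot, refl_inv, sub_sub_sub_cancel_left, ← smul_sub,
      h1, Algebra.smul_def]
    refine Dvd.dvd.mul_left ?_ _
    rw [← dvd_neg, neg_sub, ← mul_one_sub]
    exact h2.mul_left _
  | one => simp
  | mul c c' _ _ h h' =>
    rw [map_mul]
    have : twistHom b q (simpleRefl b i) c * twistHom b q (simpleRefl b i) c' - c * c' =
        twistHom b q (simpleRefl b i) c * (twistHom b q (simpleRefl b i) c' - c') +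
          (twistHom b q (simpleRefl b i) c - c) * c' := by ring
    rw [this]
    exact dvd_add (h'.mul_left _) (h.mul_right _)

variable {γ : ZMod n → ℂ} (l : b.support → ℕ)

/-- Modulo `1 - Y_i` both the numerator and the denominator of `z` are unchanged, by `starNum_dvd`
and `dvd_twistHom_sub`, so the operator `-starGen` acts as `-1`. The quotient `z'` again has only
denominators `1 - Y_k / q`. -/
lemma exists_bar_simple (hγ : IsGauss n q γ) (i : b.support) {z : RatFn (Lat P)}
    (hz : IsReg b n q z) : ∃ z', IsReg b n q z' ∧
      bar b n q γ l (simpleRefl b i) z = toRat (1 - ymRoot b n q i) * z' - z := by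
  obtain ⟨c, hc, F, hF⟩ := hz
  obtain ⟨K, hK⟩ := dvd_twistHom_sub b n q i hc
  obtain ⟨H, hH⟩ := starNum_dvd b n q γ l i F
  have hc0 := toRat_ne_zero_of_mem_denSub b n q hc
  have htc := twistHom_mem_denSub b n q (simpleRefl b i) hc
  have htc0 := toRat_ne_zero_of_mem_denSub b n q htc
  have hd := one_sub_mem_denSub b n q (i : ι)
  have hd0 := toRat_ne_zero_of_mem_denSub b n q hd
  have h1 := toRat_starNum b n q γ l i F
  rw [← hF, starGen_mul b n q γ l i (toRat_mem_of_mem_denSub b n q hc), twist_toRat,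
    ← toRat_one_sub_smul] at h1
  have hK' := congrArg toRat hK
  have hH' := congrArg toRat hH
  rw [bar_simple b n q l hγ]
  generalize twistHom b q (simpleRefl b i) c = tc at *
  generalize 1 - (1 / (q : ℂ)) • ymRoot b n q i = d at *
  generalize 1 - ymRoot b n q i = Y at *
  refine ⟨(toRat (H * c + K * F * d)) / toRat (d * tc * c),
    ⟨d * tc * c, mul_mem (mul_mem hd htc) hc, H * c + K * F * d, ?_⟩, ?_⟩
  · refine mul_div_cancel₀ _ ?_
    rw [toRat, map_mul, map_mul]
    exact mul_ne_zero (mul_ne_zero hd0 htc0) hc0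
  · simp only [toRat, map_mul, map_add, map_sub] at *
    have h2 : starGen b n q γ l i z = algebraMap _ (RatFn (Lat P)) (starNum b n q γ l i F) /
        (algebraMap _ _ d * algebraMap _ _ tc) := by
      rw [eq_div_iff (mul_ne_zero hd0 htc0), h1]
      ring
    have h3 : z = algebraMap _ _ F / algebraMap _ _ c := by
      rw [eq_div_iff hc0, ← hF]
      ring
    rw [h2, h3]
    field_simp
    linear_combination (algebraMap _ (RatFn (Lat P)) c) * hH' +
      algebraMap _ (RatFn (Lat P)) d * algebraMap _ (RatFn (Lat P)) F * hK'

lemma isReg_bar_simple (hγ : IsGauss n q γ) (i : b.support) {z : RatFn (Lat P)}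
    (hz : IsReg b n q z) : IsReg b n q (bar b n q γ l (simpleRefl b i) z) := by
  obtain ⟨z', hz', h⟩ := exists_bar_simple b n q l hγ i hz
  rw [h, sub_eq_add_neg]
  refine (hz'.toRat_mul _).add ?_
  have := hz.toRat_mul (-1)
  rwa [toRat, map_neg, map_one, neg_one_mul] at this

lemma isReg_bar (hγ : IsGauss n q γ) (w : P.weylGroup) {z : RatFn (Lat P)}
    (hz : IsReg b n q z) : IsReg b n q (bar b n q γ l w z) := by
  induction w using weyl_induction b with
  | one => rwa [bar_one b n q l hγ]
  | mul w i _ ih =>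
    rw [bar_mul b n q l hγ]
    exact isReg_bar_simple b n q l hγ i ih

lemma isReg_barSum (hγ : IsGauss n q γ) : IsReg b n q (barSum b n q γ l) := by
  have h1 := isReg_toRat b n q (1 : Laurent (Lat P))
  rw [toRat, map_one] at h1
  exact IsReg.sum _ _ fun w _ ↦ isReg_bar b n q l hγ w h1

lemma exists_simple_conj (k : ι) : ∃ (w : P.weylGroup) (i : b.support), k = perm w⁻¹ i := by
  refine b.induction_reflect k
    (p := fun k ↦ ∃ (w : P.weylGroup) (i : b.support), k = perm w⁻¹ i) ?_ ?_ ?_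
  · rintro k ⟨w, i, rfl⟩
    refine ⟨simpleRefl b i * w, i, ?_⟩
    rw [perm_mul_inv, refl_inv, perm_refl_self, perm_opp]
    rfl
  · intro i hi
    exact ⟨1, ⟨i, hi⟩, by rw [_root_.inv_one, perm_one]⟩
  · rintro k j ⟨w, i, rfl⟩ hj
    refine ⟨w * simpleRefl b ⟨j, hj⟩, i, ?_⟩
    rw [perm_mul_inv, refl_inv, perm_refl]

/-- For a simple root, `barSum` is fixed by an operator that is `-1` modulo `1 - Y_i`, so twice
`barSum` is a multiple of `1 - Y_i`. Applying `bar w` carries this to the root `w⁻¹ α_i`, and every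
root has this form. -/
lemma exists_barSum_eq (hγ : IsGauss n q γ) (k : ι) :
    ∃ z, IsReg b n q z ∧ barSum b n q γ l = toRat (1 - ymRoot b n q k) * z := by
  obtain ⟨w, i, rfl⟩ := exists_simple_conj b k
  obtain ⟨z, hz, h⟩ := exists_bar_simple b n q l hγ i (isReg_barSum b n q l hγ)
  rw [bar_barSum b n q l hγ, eq_sub_iff_add_eq, ← two_mul] at h
  have h1 : toRat (1 - ymRoot b n q i) ∈ basePiece P n := by
    rw [toRat, map_sub, map_one]
    exact sub_mem (one_mem _) (yrRoot_mem b n q i)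
  have h2 := congrArg (bar b n q γ l w) h
  have h3 : (2 : RatFn (Lat P)) ∈ basePiece P n := by
    have := add_mem (one_mem (basePiece P n)) (one_mem _)
    rwa [one_add_one_eq_two] at this
  rw [bar_mul_left b n q l w h3, bar_mul_left b n q l w h1, bar_barSum b n q l hγ, map_ofNat,
    twist_toRat, map_sub, map_one, twistHom_ymRoot] at h2
  refine ⟨toRat (algebraMap ℂ _ (1 / 2)) * bar b n q γ l w z,
    (isReg_bar b n q l hγ w hz).toRat_mul _, ?_⟩
  have h4 : toRat (algebraMap ℂ (Laurent (Lat P)) (1 / 2)) = 1 / 2 := by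
    rw [toRat, ← IsScalarTower.algebraMap_apply, map_div₀, map_one, map_ofNat]
  have h5 : (2 : RatFn (Lat P)) ≠ 0 := by
    rw [← map_ofNat (algebraMap ℂ (RatFn (Lat P))) 2]
    exact (map_ne_zero _).mpr two_ne_zero
  rw [h4, mul_left_comm, ← h2]
  field_simp

/-! ### The numerator of `h` -/

open scoped Classical in
/-- The Laurent polynomial `Δ`. -/
def DeltaL : Laurent (Lat P) := ∏ k with b.IsPos k, (1 - ymRoot b n q k)

open scoped Classical in
/-- The Laurent polynomial `D`. -/
def DL : Laurent (Lat P) := ∏ k with b.IsPos k, (1 - (1 / (q : ℂ)) • ymRoot b n q k)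

lemma toRat_DeltaL : toRat (DeltaL b n q) = Delta b n q := by
  rw [Delta_eq, DeltaL, toRat, map_prod]
  refine Finset.prod_congr rfl fun k _ ↦ ?_
  rw [map_sub, map_one]
  rfl

lemma toRat_DL : toRat (DL b n q) = DFun b n q := by
  rw [DFun_eq, DL, toRat, map_prod]
  exact Finset.prod_congr rfl fun k _ ↦ toRat_one_sub_smul b n q _ k

open scoped Classical in
/-- The factor of `D` complementary to `invDen`. -/
def coinvDen (w : P.weylGroup) : Laurent (Lat P) :=
  ∏ k ∈ (Finset.univ.filter fun k ↦ b.IsPos k) \ inv b w, (1 - (1 / (q : ℂ)) • ymRoot b n q k)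

lemma coinvDen_mul_invDen (w : P.weylGroup) : coinvDen b n q w * invDen b n q w = DL b n q := by
  classical
  refine Finset.prod_sdiff fun k hk ↦ ?_
  simpa using (mem_inv b |>.mp hk).1

/-- The numerator of `j(w, x) (1|w)`. -/
def barNum (hγ : IsGauss n q γ) (w : P.weylGroup) : Laurent (Lat P) :=
  (exists_barNum b n q l hγ w).choose

lemma toRat_barNum (hγ : IsGauss n q γ) (w : P.weylGroup) :
    toRat (barNum b n q l hγ w) = toRat (invDen b n q w) * bar b n q γ l w 1 :=
  (exists_barNum b n q l hγ w).choose_spec.1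

lemma suppGE_barNum (hγ : IsGauss n q γ) (w : P.weylGroup) (ξ : Lat P →+ ℤ) :
    SuppGE ξ (ξ (thetaSub b l w⁻¹) + ∑ k ∈ inv b w, min 0 (ξ (mInt P n k • rt P k)))
      (barNum b n q l hγ w) :=
  (exists_barNum b n q l hγ w).choose_spec.2 ξ

/-- The Laurent polynomial `D` times the sum of the `j(w, x) (1|w)`. -/
def sumNum (hγ : IsGauss n q γ) : Laurent (Lat P) :=
  ∑ w, coinvDen b n q w * barNum b n q l hγ w

lemma toRat_sumNum (hγ : IsGauss n q γ) :
    toRat (sumNum b n q l hγ) = DFun b n q * barSum b n q γ l := by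
  rw [sumNum, toRat, map_sum, barSum, Finset.mul_sum]
  refine Finset.sum_congr rfl fun w _ ↦ ?_
  have h := toRat_barNum b n q l hγ w
  rw [map_mul, ← toRat_DL, ← coinvDen_mul_invDen b n q w]
  simp only [toRat, map_mul] at *
  rw [h, mul_assoc]

lemma one_sub_ymRoot_dvd_of_mem_denSub (hq : q ≠ 1) (k : ι) {c : Laurent (Lat P)}
    (hc : c ∈ denSub b n q) {x : Laurent (Lat P)} (h : 1 - ymRoot b n q k ∣ c * x) :
    1 - ymRoot b n q k ∣ x := by
  induction hc using Submonoid.closure_induction generalizing x with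
  | mem c hc =>
    obtain ⟨j, rfl⟩ := hc
    refine dvd_of_dvd_one_sub_ymRoot_mul b n q j k (one_div_ne_zero (NeZero.ne _))
      (Or.inl fun h1 ↦ hq ?_) h
    have : (q : ℂ) = 1 := by simpa using h1
    exact_mod_cast this
  | one => rwa [one_mul] at h
  | mul c c' _ _ ih ih' => exact ih' (ih (by rwa [mul_assoc] at h))

/-- For `q ≠ 1` the denominators `1 - Y_j / q` are not zero divisors modulo `1 - Y_k`, even when
`α_j = ±α_k`, and can be cancelled. -/
lemma one_sub_ymRoot_dvd_sumNum (hγ : IsGauss n q γ) (hq : q ≠ 1) (k : ι) :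
    1 - ymRoot b n q k ∣ sumNum b n q l hγ := by
  obtain ⟨z, ⟨c, hc, F, hF⟩, hz⟩ := exists_barSum_eq b n q l hγ k
  refine one_sub_ymRoot_dvd_of_mem_denSub b n q hq k hc ⟨DL b n q * F, ?_⟩
  apply toRat_injective
  have h := toRat_sumNum b n q l hγ
  rw [← toRat_DL, hz] at h
  simp only [toRat, map_mul] at *
  rw [h, ← hF]
  ring

/-- For `q = 1` the denominator of the simple operator is `1 - Y_i`, and `starNum_dvd` shows that it
divides the numerator. -/
lemma exists_toRat_eq_bar (hγ : IsGauss n q γ) (hq : q = 1) (w : P.weylGroup) :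
    ∃ F : Laurent (Lat P), toRat F = bar b n q γ l w 1 := by
  induction w using weyl_induction b with
  | one => exact ⟨1, by rw [bar_one b n q l hγ, toRat, map_one]⟩
  | mul w i _ ih =>
    obtain ⟨F, hF⟩ := ih
    have hq' : (1 : ℂ) / q = 1 := by rw [hq, Nat.cast_one, div_one]
    obtain ⟨H, hH⟩ := starNum_dvd b n q γ l i F
    have h1 := toRat_starNum b n q γ l i F
    rw [hq', one_smul] at hH
    refine ⟨H - F, ?_⟩
    rw [bar_mul b n q l hγ, ← hF, bar_simple b n q l hγ]
    rw [hq', map_one, one_mul] at h1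
    have h2 := congrArg toRat hH
    have h3 : toRat (1 - ymRoot b n q i) = 1 - yrRoot b n q i := by
      rw [toRat, map_sub, map_one]
      rfl
    simp only [toRat, map_mul, map_sub] at *
    rw [map_one] at h2
    refine mul_left_cancel₀ (one_sub_yrRoot_ne_zero' b n q (i : ι)) ?_
    rw [map_one] at h3
    rw [h1, h3] at h2
    linear_combination -h2

lemma DeltaL_dvd_sumNum (hγ : IsGauss n q γ) : DeltaL b n q ∣ sumNum b n q l hγ := by
  classical
  by_cases hq : q = 1
  · choose F hF using exists_toRat_eq_bar b n q l hγ hq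
    refine ⟨∑ w, F w, ?_⟩
    have h1 : DL b n q = DeltaL b n q := by
      have hq' : (1 : ℂ) / q = 1 := by rw [hq, Nat.cast_one, div_one]
      simp only [DL, DeltaL, hq', one_smul]
    apply toRat_injective
    rw [toRat_sumNum, ← toRat_DL, h1, barSum, ← Finset.sum_congr rfl fun w _ ↦ hF w]
    simp only [toRat, map_mul, map_sum]
  · exact prod_one_sub_ymRoot_dvd b n q _ (fun k hk ↦ by simpa using hk)
      fun k _ ↦ one_sub_ymRoot_dvd_sumNum b n q l hγ hq k

end Regular

section Polynomiality

/-! ### Polynomials -/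

variable {ι M N : Type*} [Fintype ι] [AddCommGroup M] [Module ℝ M] [AddCommGroup N] [Module ℝ N]
variable {P : RootPairing ι ℝ M N} (b : P.Base)

/-- The coordinate of an element of the root lattice at a simple root. -/
def crd (j : b.support) : Lat P →+ ℤ := (b.toWeightBasisInt.coord j).toAddMonoidHom

lemma crd_rt_self (j : b.support) : crd b j (rt P j) = 1 := by
  have : rt P j = b.toWeightBasisInt j := Subtype.ext (b.coe_toWeightBasisInt_apply j).symm
  rw [this]
  simp [crd]

lemma crd_rt_of_ne {i j : b.support} (h : i ≠ j) : crd b j (rt P i) = 0 := by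
  have : rt P i = b.toWeightBasisInt i := Subtype.ext (b.coe_toWeightBasisInt_apply i).symm
  rw [this]
  simp [crd, h]

lemma sum_crd (β : Lat P) : ∑ j, crd b j β • rt P j = β := by
  conv_rhs => rw [← b.toWeightBasisInt.sum_repr β]
  refine Finset.sum_congr rfl fun j _ ↦ ?_
  have : rt P j = b.toWeightBasisInt j := Subtype.ext (b.coe_toWeightBasisInt_apply j).symm
  rw [this]
  rfl

lemma crd_sum (s : b.support → ℕ) (j : b.support) : crd b j (∑ i, s i • rt P i) = s j := by
  rw [map_sum, Finset.sum_eq_single j]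
  · rw [map_nsmul, crd_rt_self, nsmul_eq_mul, mul_one]
  · intro i _ hi
    rw [map_nsmul, crd_rt_of_ne b hi, smul_zero]
  · simp

lemma crd_nonneg {k : ι} (hk : b.IsPos k) (j : b.support) : 0 ≤ crd b j (rt P k) := by
  obtain ⟨f, hf⟩ := rt_eq_sum_of_isPos b hk
  rw [hf, crd_sum]
  positivity

lemma ht_eq_sum_crd (β : Lat P) : ht b β = ∑ j, crd b j β := by
  rw [ht, LinearMap.sum_apply]
  rfl

lemma one_le_ht {k : ι} (hk : b.IsPos k) : 1 ≤ ht b (rt P k) := by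
  have h0 : 0 ≤ ht b (rt P k) := by
    rw [ht_eq_sum_crd]
    exact Finset.sum_nonneg fun j _ ↦ crd_nonneg b hk j
  rcases h0.eq_or_lt with h | h
  · exfalso
    rw [ht_eq_sum_crd, eq_comm, Finset.sum_eq_zero_iff_of_nonneg fun j _ ↦ crd_nonneg b hk j] at h
    refine P.ne_zero k ?_
    rw [← coe_rt, ← sum_crd b (rt P k), Finset.sum_eq_zero fun j hj ↦ by rw [h j hj, zero_smul]]
    rfl
  · exact h

/-- A positive root with no other coordinate is a multiple of `α_i`, hence equal to `α_i` in a
reduced system. -/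
lemma exists_one_le_crd [P.IsReduced] {k : ι} (hk : b.IsPos k) (i : b.support) (hki : k ≠ i) :
    ∃ j, j ≠ i ∧ 1 ≤ crd b j (rt P k) := by
  by_contra hne
  push Not at hne
  have h1 : rt P k = crd b i (rt P k) • rt P i := by
    conv_lhs => rw [← sum_crd b (rt P k)]
    refine Finset.sum_eq_single i (fun j _ hj ↦ ?_) (by simp)
    have := hne j hj
    have := crd_nonneg b hk j
    rw [show crd b j (rt P k) = 0 by omega, zero_smul]
  have h2 : P.root k = (crd b i (rt P k) : ℝ) • P.root i := by
    rw [Int.cast_smul_eq_zsmul]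
    exact congrArg Subtype.val h1
  have hli : ¬ LinearIndependent ℝ ![P.root k, P.root i] := by
    intro hli
    have := (LinearIndependent.pair_iff.mp hli 1 (-(crd b i (rt P k) : ℝ)) (by
      rw [one_smul, neg_smul, ← h2, add_neg_cancel])).1
    exact one_ne_zero this
  rcases RootPairing.IsReduced.eq_or_eq_neg k i hli with h | h
  · exact hki (P.root.injective h)
  · rw [← root_opp] at h
    rw [P.root.injective h, isPos_opp] at hk
    exact hk (isPos_simple b i)

/-- Polynomials in the variables `x_i` as Laurent polynomials. -/
def polyHom : MvPolynomial b.support ℂ →ₐ[ℂ] Laurent (Lat P) :=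
  MvPolynomial.aeval fun j ↦ AddMonoidAlgebra.single (rt P j) 1

lemma toRat_polyHom (p : MvPolynomial b.support ℂ) :
    toRat (polyHom b p) = MvPolynomial.aeval (var b) p :=
  MvPolynomial.comp_aeval_apply (R := ℂ) (fun j : b.support ↦ (AddMonoidAlgebra.single (rt P j) 1 :
    Laurent (Lat P))) (IsScalarTower.toAlgHom ℂ (Laurent (Lat P)) (RatFn (Lat P))) p

lemma polyHom_monomial (s : b.support →₀ ℕ) (z : ℂ) : polyHom b (MvPolynomial.monomial s z) =
    AddMonoidAlgebra.single (∑ j, s j • rt P j) z := by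
  have h1 : ∀ t : Finset b.support, ∏ j ∈ t, (AddMonoidAlgebra.single (rt P j) (1 : ℂ)) ^ s j =
      AddMonoidAlgebra.single (∑ j ∈ t, s j • rt P j) 1 := fun t ↦ by
    classical
    induction t using Finset.induction_on with
    | empty => rfl
    | insert j t hj ih =>
      rw [Finset.prod_insert hj, ih, Finset.sum_insert hj, AddMonoidAlgebra.single_pow, one_pow,
        AddMonoidAlgebra.single_mul_single, one_mul]
  rw [polyHom, MvPolynomial.aeval_monomial, Finsupp.prod_fintype _ _ fun _ ↦ pow_zero _, h1,
    ← Algebra.smul_def, AddMonoidAlgebra.smul_single, smul_eq_mul, mul_one]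

lemma sum_smul_rt_injective : Function.Injective fun s : b.support →₀ ℕ ↦ ∑ j, s j • rt P j := by
  intro s s' h
  ext j
  have := congrArg (crd b j) h
  simp only [crd_sum] at this
  exact_mod_cast this

lemma coeff_polyHom (p : MvPolynomial b.support ℂ) (s : b.support →₀ ℕ) :
    (polyHom b p).coeff (∑ j, s j • rt P j) = p.coeff s := by
  classical
  induction p using MvPolynomial.induction_on' with
  | monomial s' z =>
    rw [polyHom_monomial, AddMonoidAlgebra.coeff_single, MvPolynomial.coeff_monomial,
      Finsupp.single_apply]
    exact if_congr (sum_smul_rt_injective b).eq_iff rfl rfl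
  | add p p' hp hp' =>
    rw [map_add, AddMonoidAlgebra.coeff_add, Finsupp.add_apply, hp, hp', MvPolynomial.coeff_add]

lemma polyHom_injective : Function.Injective (polyHom b) := by
  intro p p' h
  ext s
  rw [← coeff_polyHom, h, coeff_polyHom]

lemma exists_polyHom_eq {f : Laurent (Lat P)} (hf : ∀ j, SuppGE (crd b j) 0 f) :
    ∃ p, polyHom b p = f := by
  change f ∈ (polyHom b).range
  rw [← AddMonoidAlgebra.sum_coeff_single f, Finsupp.sum]
  refine sum_mem fun β hβ ↦ ?_
  refine ⟨MvPolynomial.monomial (Finsupp.equivFunOnFinite.symm fun j ↦ (crd b j β).toNat)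
    (f.coeff β), ?_⟩
  change polyHom b _ = _
  rw [polyHom_monomial]
  congr 1
  conv_rhs => rw [← sum_crd b β]
  refine Finset.sum_congr rfl fun j _ ↦ ?_
  rw [Finsupp.coe_equivFunOnFinite_symm, ← natCast_zsmul, Int.toNat_of_nonneg (hf j β hβ)]

open scoped Classical in
/-- The restriction of a polynomial to a coordinate line. -/
def resHom (i : b.support) : MvPolynomial b.support ℂ →ₐ[ℂ] Polynomial ℂ :=
  MvPolynomial.aeval fun j ↦ if j = i then Polynomial.X else 0

/-- The Laurent polynomial `f` is a polynomial whose restriction to a coordinate line is `g`. -/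
def ResTo (i : b.support) (f : Laurent (Lat P)) (g : Polynomial ℂ) : Prop :=
  ∃ p, polyHom b p = f ∧ resHom b i p = g

variable {b}

lemma ResTo.unique {i : b.support} {f : Laurent (Lat P)} {g g' : Polynomial ℂ}
    (h : ResTo b i f g) (h' : ResTo b i f g') : g = g' := by
  obtain ⟨p, hp, rfl⟩ := h
  obtain ⟨p', hp', rfl⟩ := h'
  rw [polyHom_injective b (hp.trans hp'.symm)]

lemma ResTo.add {i : b.support} {f f' : Laurent (Lat P)} {g g' : Polynomial ℂ}
    (h : ResTo b i f g) (h' : ResTo b i f' g') : ResTo b i (f + f') (g + g') := by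
  obtain ⟨p, rfl, rfl⟩ := h
  obtain ⟨p', rfl, rfl⟩ := h'
  exact ⟨p + p', map_add _ _ _, map_add _ _ _⟩

lemma ResTo.sub {i : b.support} {f f' : Laurent (Lat P)} {g g' : Polynomial ℂ}
    (h : ResTo b i f g) (h' : ResTo b i f' g') : ResTo b i (f - f') (g - g') := by
  obtain ⟨p, rfl, rfl⟩ := h
  obtain ⟨p', rfl, rfl⟩ := h'
  exact ⟨p - p', map_sub _ _ _, map_sub _ _ _⟩

lemma ResTo.mul {i : b.support} {f f' : Laurent (Lat P)} {g g' : Polynomial ℂ}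
    (h : ResTo b i f g) (h' : ResTo b i f' g') : ResTo b i (f * f') (g * g') := by
  obtain ⟨p, rfl, rfl⟩ := h
  obtain ⟨p', rfl, rfl⟩ := h'
  exact ⟨p * p', map_mul _ _ _, map_mul _ _ _⟩

lemma ResTo.smul {i : b.support} {f : Laurent (Lat P)} {g : Polynomial ℂ} (z : ℂ)
    (h : ResTo b i f g) : ResTo b i (z • f) (Polynomial.C z * g) := by
  obtain ⟨p, rfl, rfl⟩ := h
  exact ⟨z • p, map_smul _ _ _, by rw [map_smul, Polynomial.smul_eq_C_mul]⟩

variable (b)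

lemma resTo_one (i : b.support) : ResTo b i 1 1 := ⟨1, map_one _, map_one _⟩

variable {b} in
lemma ResTo.prod {i : b.support} {κ : Type*} (s : Finset κ) (f : κ → Laurent (Lat P))
    (h : ∀ k ∈ s, ResTo b i (f k) 1) : ResTo b i (∏ k ∈ s, f k) 1 :=
  Finset.prod_induction _ (ResTo b i · 1) (fun _ _ hf hg ↦ by simpa using hf.mul hg)
    (resTo_one b i) h

/-- Every monomial of `f` contains `x_j`, which is set to zero on the line. -/
lemma resTo_zero {i j : b.support} (hij : j ≠ i) {f : Laurent (Lat P)}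
    (hf : ∀ j, SuppGE (crd b j) 0 f) (h : SuppGE (crd b j) 1 f) : ResTo b i f 0 := by
  obtain ⟨p, rfl⟩ := exists_polyHom_eq b hf
  refine ⟨p, rfl, ?_⟩
  rw [resHom, MvPolynomial.aeval_def, MvPolynomial.eval₂_eq']
  refine Finset.sum_eq_zero fun s hs ↦ ?_
  have h1 : (∑ i, s i • rt P i) ∈ (polyHom b p).coeff.support := by
    rw [Finsupp.mem_support_iff, coeff_polyHom]
    exact MvPolynomial.mem_support_iff.mp hs
  have h2 := h _ h1
  rw [crd_sum] at h2
  rw [Finset.prod_eq_zero (Finset.mem_univ j), mul_zero]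
  rw [if_neg hij, zero_pow]
  omega

variable (q : ℕ) [NeZero q]

lemma resTo_ym (i : b.support) (e : ℕ) :
    ResTo b i (ym b q (e • rt P i)) ((Polynomial.C (q : ℂ) * Polynomial.X) ^ e) := by
  have h1 : ym b q (e • rt P i) = ym b q (rt P i) ^ e := by
    rw [ym, ym, AddMonoidAlgebra.single_pow, map_nsmul, nsmul_eq_mul, mul_comm, zpow_mul,
      zpow_natCast]
  refine ⟨(MvPolynomial.C (q : ℂ) * MvPolynomial.X i) ^ e, ?_, ?_⟩
  · rw [h1, map_pow, map_mul, polyHom, MvPolynomial.aeval_X, MvPolynomial.algHom_C, ym,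
      ← Algebra.smul_def, AddMonoidAlgebra.smul_single, smul_eq_mul, mul_one, ht_rt, zpow_one]
  · rw [map_pow, map_mul, resHom, MvPolynomial.aeval_X, MvPolynomial.algHom_C, if_pos rfl]
    rfl

variable [P.IsCrystallographic] (n : ℕ) [NeZero n]

lemma suppGE_ymRoot {k : ι} (ξ : Lat P →+ ℤ) (h : 0 ≤ ξ (rt P k)) :
    SuppGE ξ (ξ (rt P k)) (ymRoot b n q k) := by
  refine SuppGE.single ?_ _
  have h1 : (1 : ℤ) ≤ mInt P n k := by exact_mod_cast mInt_pos (P := P) n k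
  rw [map_nsmul, nsmul_eq_mul]
  nlinarith

lemma suppGE_one_sub_ymRoot {k : ι} (ξ : Lat P →+ ℤ) (h : 0 ≤ ξ (rt P k)) (z : ℂ) :
    SuppGE ξ 0 (1 - z • ymRoot b n q k) :=
  SuppGE.one.sub (((suppGE_ymRoot b q n ξ h).mono h).smul z)

variable [P.IsReduced]

lemma resTo_one_sub_ymRoot_of_ne {k : ι} (hk : b.IsPos k) (i : b.support) (hki : k ≠ i) (z : ℂ) :
    ResTo b i (1 - z • ymRoot b n q k) 1 := by
  obtain ⟨j, hj, h⟩ := exists_one_le_crd b hk i hki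
  have h1 := (resTo_zero b hj (fun j ↦ (suppGE_ymRoot b q n (crd b j) (crd_nonneg b hk j)).mono
    (crd_nonneg b hk j)) ((suppGE_ymRoot b q n (crd b j) (crd_nonneg b hk j)).mono h)).smul z
  simpa using (resTo_one b i).sub h1

lemma resTo_one_sub_ymRoot_self (i : b.support) (z : ℂ) : ResTo b i (1 - z • ymRoot b n q i)
    (1 - Polynomial.C z * (Polynomial.C (q : ℂ) * Polynomial.X) ^ mInt P n i) :=
  (resTo_one b i).sub ((resTo_ym b q i _).smul z)

open scoped Classical in
lemma resTo_prod (i : b.support) (z : ℂ) :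
    ResTo b i (∏ k with b.IsPos k, (1 - z • ymRoot b n q k))
      (1 - Polynomial.C z * (Polynomial.C (q : ℂ) * Polynomial.X) ^ mInt P n i) := by
  have hmem : (i : ι) ∈ Finset.univ.filter fun k ↦ b.IsPos k := by simp [isPos_simple b i]
  rw [← Finset.mul_prod_erase _ _ hmem]
  simpa using (resTo_one_sub_ymRoot_self b q n i z).mul (ResTo.prod _ _ fun k hk ↦ by
    simp only [Finset.mem_erase, Finset.mem_filter, Finset.mem_univ, true_and] at hk
    exact resTo_one_sub_ymRoot_of_ne b q n hk.2 i hk.1 z)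

lemma suppGE_DeltaL (j : b.support) : SuppGE (crd b j) 0 (DeltaL b n q) := by
  classical
  refine SuppGE.prod _ _ fun k hk ↦ ?_
  have := suppGE_one_sub_ymRoot b q n (crd b j) (crd_nonneg b (by simpa using hk) j) 1
  rwa [one_smul] at this

open scoped Classical in
lemma suppGE_one_sub_DeltaL : SuppGE (ht b).toAddMonoidHom 1 (1 - DeltaL b n q) := by
  have key : ∀ s : Finset ι, (∀ k ∈ s, b.IsPos k) →
      SuppGE (ht b).toAddMonoidHom 0 (∏ k ∈ s, (1 - ymRoot b n q k)) ∧
      SuppGE (ht b).toAddMonoidHom 1 (1 - ∏ k ∈ s, (1 - ymRoot b n q k)) := by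
    intro s hs
    induction s using Finset.induction_on with
    | empty =>
      refine ⟨SuppGE.one, ?_⟩
      rw [Finset.prod_empty, sub_self]
      exact SuppGE.zero
    | insert k s hk ih =>
      obtain ⟨h1, h2⟩ := ih fun k hk ↦ hs k (Finset.mem_insert_of_mem hk)
      have h3 := one_le_ht b (hs k (Finset.mem_insert_self k s))
      have h4 : SuppGE (ht b).toAddMonoidHom 1 (ymRoot b n q k) :=
        (suppGE_ymRoot b q n (ht b).toAddMonoidHom (zero_le_one.trans h3)).mono h3
      rw [Finset.prod_insert hk]
      refine ⟨by simpa using (SuppGE.one.sub (h4.mono zero_le_one)).mul h1, ?_⟩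
      have h5 : 1 - (1 - ymRoot b n q k) * ∏ k ∈ s, (1 - ymRoot b n q k) =
          (1 - ∏ k ∈ s, (1 - ymRoot b n q k)) +
            ymRoot b n q k * ∏ k ∈ s, (1 - ymRoot b n q k) := by ring
      rw [h5]
      exact h2.add (by simpa using h4.mul h1)
  exact (key _ fun k hk ↦ by simpa using hk).2

-- Expand `1 / (1 - p)`: `F = (1 + p + ⋯ + p ^ (k - 1)) E + p ^ k F`. For large `k` the last term
-- does not reach a given exponent, and the first satisfies the bound.
variable {b} in
lemma SuppGE.of_mul_one_sub {ξ η : Lat P →+ ℤ} {p E F : Laurent (Lat P)} (hp : SuppGE ξ 1 p)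
    (hp' : SuppGE η 0 p) (hE : SuppGE η 0 E) (h : E = (1 - p) * F) : SuppGE η 0 F := by
  obtain ⟨c, hc⟩ : ∃ c, SuppGE ξ c F := by
    obtain ⟨c, hc⟩ := (F.coeff.support.image ξ).bddBelow
    exact ⟨c, fun β hβ ↦ hc (Finset.mem_coe.mpr (Finset.mem_image_of_mem ξ hβ))⟩
  intro β hβ
  by_contra hneg
  -- With this `k` the support of `p ^ k F` lies in `ξ ≥ k + c`, beyond `ξ β`.
  set k := (ξ β - c + 1).toNat with hk
  have h1 : F = (∑ j ∈ Finset.range k, p ^ j) * E + p ^ k * F := by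
    have := mul_neg_geom_sum p k
    rw [h]
    linear_combination (-F) * this
  have h2 : SuppGE η 0 ((∑ j ∈ Finset.range k, p ^ j) * E) := by
    simpa using (SuppGE.sum _ _ fun j _ ↦ by simpa using hp'.pow j : SuppGE η 0 _).mul hE
  have h3 : SuppGE ξ (k * 1 + c) (p ^ k * F) := (hp.pow k).mul hc
  have h4 : ((∑ j ∈ Finset.range k, p ^ j) * E).coeff β = 0 := by
    by_contra h4
    exact hneg (h2 β (Finsupp.mem_support_iff.mpr h4))
  have h5 : (p ^ k * F).coeff β = 0 := by
    by_contra h5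
    have := h3 β (Finsupp.mem_support_iff.mpr h5)
    omega
  have h6 := congrArg (fun G ↦ G.coeff β) h1
  simp only [AddMonoidAlgebra.coeff_add, Finsupp.add_apply, h4, h5, add_zero] at h6
  exact Finsupp.mem_support_iff.mp hβ h6

end Polynomiality

section Main

/-! ### The numerator and its restrictions to the coordinate lines -/

variable {ι M N : Type*} [Fintype ι] [AddCommGroup M] [Module ℝ M] [AddCommGroup N] [Module ℝ N]
variable {P : RootPairing ι ℝ M N} (b : P.Base) (n q : ℕ) [NeZero q]
variable [P.IsCrystallographic] [P.IsRootSystem] [P.IsReduced] [P.IsIrreducible] [NeZero n]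
variable {γ : ZMod n → ℂ} (l : b.support → ℕ)

lemma thetaSub_mul_simple (w : P.weylGroup) (i : b.support) :
    thetaSub b l (w * simpleRefl b i) = ((l i : ℤ) + 1) • rt P (perm w i) + thetaSub b l w := by
  rw [thetaSub_mul, thetaSub_refl, tau_simple, map_zsmul, rt_perm]

/-- An ascent from `w` to `w σ_i` adds `(l_i + 1) w α_i` to `θ - w θ`, and `w α_i` is a positive
root. -/
lemma crd_thetaSub_nonneg (w : P.weylGroup) (j : b.support) : 0 ≤ crd b j (thetaSub b l w) := by
  induction w using weyl_induction b with
  | one => rw [thetaSub_one, map_zero]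
  | mul w i hw ih =>
    rw [thetaSub_mul_simple, map_add, map_zsmul, smul_eq_mul]
    have := crd_nonneg b hw j
    positivity

/-- Each ascent adds a positive multiple of a positive root, which has a coordinate away from `α_i`
unless it is `α_i`. The latter can be added only at the first step, and that step leads to `σ_i`. -/
lemma exists_one_le_crd_thetaSub (i : b.support) (w : P.weylGroup) :
    w = 1 ∨ w = simpleRefl b i ∨ ∃ j, j ≠ i ∧ 1 ≤ crd b j (thetaSub b l w) := by
  induction w using weyl_induction b with
  | one => exact Or.inl rfl
  | mul w k hw ih =>
    have hmul : ∀ j, crd b j (thetaSub b l (w * simpleRefl b k)) =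
        ((l k : ℤ) + 1) * crd b j (rt P (perm w k)) + crd b j (thetaSub b l w) := fun j ↦ by
      rw [thetaSub_mul_simple, map_add, map_zsmul, smul_eq_mul]
    by_cases hj : ∃ j, j ≠ i ∧ 1 ≤ crd b j (thetaSub b l w)
    · obtain ⟨j, hj, h⟩ := hj
      refine Or.inr (Or.inr ⟨j, hj, ?_⟩)
      have := crd_nonneg b hw j
      rw [hmul]
      have h2 : 0 ≤ ((l k : ℤ) + 1) * crd b j (rt P (perm w k)) := by positivity
      omega
    by_cases hk : perm w k = i
    · rcases ih with rfl | rfl | ih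
      · rw [perm_one] at hk
        rw [Subtype.ext hk, one_mul]
        exact Or.inr (Or.inl rfl)
      · exfalso
        rw [perm_eq_iff, refl_inv, perm_refl_self] at hk
        have := isPos_simple b k
        rw [hk, isPos_opp] at this
        exact this (isPos_simple b i)
      · exact absurd ih hj
    · obtain ⟨j, hj, h⟩ := exists_one_le_crd b hw i hk
      refine Or.inr (Or.inr ⟨j, hj, ?_⟩)
      have h1 := crd_thetaSub_nonneg b l w j
      rw [hmul]
      nlinarith

lemma suppGE_coinvDen (w : P.weylGroup) (j : b.support) :
    SuppGE (crd b j) 0 (coinvDen b n q w) := by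
  classical
  refine SuppGE.prod _ _ fun k hk ↦ suppGE_one_sub_ymRoot b q n (crd b j) (crd_nonneg b ?_ j) _
  simpa using (Finset.mem_sdiff.mp hk).1

/-- For a coordinate functional the minima in `suppGE_barNum` vanish, since inversions are positive
roots. -/
lemma suppGE_term (hγ : IsGauss n q γ) (w : P.weylGroup) (j : b.support) :
    SuppGE (crd b j) (crd b j (thetaSub b l w⁻¹)) (coinvDen b n q w * barNum b n q l hγ w) := by
  have h1 := (suppGE_coinvDen b n q w j).mul (suppGE_barNum b n q l hγ w (crd b j))
  rwa [Finset.sum_eq_zero, add_zero, zero_add] at h1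
  intro k hk
  rw [map_nsmul]
  have := crd_nonneg b ((mem_inv b).mp hk).1 j
  exact min_eq_left (by positivity)

lemma suppGE_sumNum (hγ : IsGauss n q γ) (j : b.support) :
    SuppGE (crd b j) 0 (sumNum b n q l hγ) :=
  SuppGE.sum _ _ fun w _ ↦ (suppGE_term b n q l hγ w j).mono (crd_thetaSub_nonneg b l _ j)

/-- The numerator of `h` is a polynomial. -/
lemma exists_numerator (hγ : IsGauss n q γ) : ∃ p : MvPolynomial b.support ℂ,
    MvPolynomial.aeval (var b) p = hFun b n q γ l * DFun b n q ∧
      sumNum b n q l hγ = DeltaL b n q * polyHom b p := by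
  obtain ⟨F, hF⟩ := DeltaL_dvd_sumNum b n q l hγ
  have hs : ∀ j, SuppGE (crd b j) 0 F := fun j ↦
    SuppGE.of_mul_one_sub (suppGE_one_sub_DeltaL b q n)
      (SuppGE.one.sub (suppGE_DeltaL b q n j)) (suppGE_sumNum b n q l hγ j)
      (by rw [sub_sub_cancel, hF])
  obtain ⟨p, rfl⟩ := exists_polyHom_eq b hs
  refine ⟨p, ?_, hF⟩
  have h1 := toRat_sumNum b n q l hγ
  have h2 : toRat (DeltaL b n q * polyHom b p) = toRat (DeltaL b n q) * toRat (polyHom b p) :=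
    map_mul _ _ _
  rw [hF, h2, toRat_DeltaL, toRat_polyHom] at h1
  rw [hFun_eq_div, div_mul_eq_mul_div, eq_div_iff (Delta_ne_zero b n q)]
  linear_combination h1

lemma invDen_one : invDen b n q (1 : P.weylGroup) = 1 := by
  rw [invDen, inv_one, Finset.prod_empty]

lemma inv_simple (i : b.support) : inv b (simpleRefl b i) = {(i : ι)} := by
  ext k
  rw [mem_inv, Finset.mem_singleton]
  refine ⟨fun h ↦ ?_, fun h ↦ ?_⟩
  · by_contra hk
    exact h.2 (isPos_perm_simple b i h.1 hk)
  · rw [h, perm_refl_self, isPos_opp]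
    exact ⟨isPos_simple b i, not_not.mpr (isPos_simple b i)⟩

lemma barNum_one (hγ : IsGauss n q γ) : barNum b n q l hγ 1 = 1 := by
  apply toRat_injective
  rw [toRat_barNum, invDen_one, bar_one b n q l hγ, mul_one]

lemma barNum_simple (hγ : IsGauss n q γ) (i : b.support) :
    barNum b n q l hγ (simpleRefl b i) = -monoNum b n q γ l i 0 := by
  apply toRat_injective
  have h1 := toRat_monoNum b n q γ l i 0
  have h2 : toRat (-monoNum b n q γ l i 0) = -toRat (monoNum b n q γ l i 0) := map_neg _ _
  rw [toRat_barNum, invDen, inv_simple, Finset.prod_singleton, bar_simple b n q l hγ,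
    toRat_one_sub_smul, h2, h1, yr_zero]
  ring

lemma resTo_coinvDen_simple (i : b.support) : ResTo b i (coinvDen b n q (simpleRefl b i)) 1 := by
  classical
  refine ResTo.prod _ _ fun k hk ↦ ?_
  rw [inv_simple, Finset.mem_sdiff, Finset.mem_singleton, Finset.mem_filter] at hk
  exact resTo_one_sub_ymRoot_of_ne b q n hk.1.2 i hk.2 _

lemma refl_ne_one (k : ι) : refl (P := P) k ≠ 1 := by
  intro h
  have := perm_refl_self (P := P) k
  rw [h, perm_one] at this
  exact opp_ne k this.symm

/-- Only two terms contribute to the restriction of the numerator to a coordinate line. -/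
lemma resTo_sumNum (hγ : IsGauss n q γ) (i : b.support) {g : Polynomial ℂ}
    (hg : ResTo b i (monoNum b n q γ l i 0) g) : ResTo b i (sumNum b n q l hγ)
      (1 - Polynomial.C (1 / (q : ℂ)) * (Polynomial.C (q : ℂ) * Polynomial.X) ^ mInt P n i - g) := by
  classical
  have h1 : (simpleRefl b i) ∈ (Finset.univ : Finset P.weylGroup).erase 1 := by
    simp [refl_ne_one]
  have h2 : ResTo b i (∑ w ∈ ((Finset.univ : Finset P.weylGroup).erase 1).erase (simpleRefl b i),
      coinvDen b n q w * barNum b n q l hγ w) 0 := by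
    refine Finset.sum_induction _ (ResTo b i · 0) (fun _ _ hf hg ↦ by simpa using hf.add hg)
      ⟨0, map_zero _, map_zero _⟩ fun w hw ↦ ?_
    simp only [Finset.mem_erase, Finset.mem_univ, and_true] at hw
    rcases exists_one_le_crd_thetaSub b l i w⁻¹ with h | h | ⟨j, hj, h⟩
    · exact absurd (inv_eq_one.mp h) hw.2
    · rw [inv_eq_iff_eq_inv, refl_inv] at h
      exact absurd h hw.1
    · exact resTo_zero b hj (fun j ↦ (suppGE_term b n q l hγ w j).mono
        (crd_thetaSub_nonneg b l _ j)) ((suppGE_term b n q l hγ w j).mono h)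
  have h3 : coinvDen b n q (1 : P.weylGroup) = DL b n q := by
    rw [← coinvDen_mul_invDen b n q 1, invDen_one, mul_one]
  have h4 := (resTo_prod b q n i (1 / (q : ℂ))).add
    ((((resTo_coinvDen_simple b n q i).mul hg).smul (-1)).add h2)
  rw [sumNum, ← Finset.add_sum_erase _ _ (Finset.mem_univ 1), ← Finset.add_sum_erase _ _ h1,
    barNum_one, barNum_simple, h3, mul_one, mul_neg]
  convert h4 using 1
  · rw [neg_one_smul]
    rfl
  · simp
    ring

lemma resTo_monoNum (i : b.support) (hl : l i = 0) (e : ℕ) (he : resExp b n l i 0 = e) :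
    ResTo b i (monoNum b n q γ l i 0)
      ((Polynomial.C (1 - 1 / (q : ℂ)) * (Polynomial.C (q : ℂ) * Polynomial.X) ^ e -
        Polynomial.C (γ (normSq P i)) *
          (1 - (Polynomial.C (q : ℂ) * Polynomial.X) ^ mInt P n i)) *
        (Polynomial.C (q : ℂ) * Polynomial.X)) := by
  have h1 : dot b l i 0 = 1 • rt P i := by
    rw [dot, map_zero, zero_add, hl, Nat.cast_zero, zero_add, one_smul, one_smul]
  have h2 : shp b l i 0 = -1 := by
    rw [shp, map_zero, tau_simple, hl]
    norm_num
  have h3 : (-(normSq P i * shp b l i 0 : ℤ) : ZMod n) = normSq P i := by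
    rw [h2]
    push_cast
    ring
  have h4 := resTo_ym b q i 1
  rw [pow_one] at h4
  rw [monoNum, he, h1, natCast_zsmul]
  refine ResTo.mul (ResTo.sub ((resTo_ym b q i e).smul _) ?_) h4
  rw [← Int.cast_neg, Int.cast_neg, h3]
  exact ((resTo_one b i).sub (resTo_ym b q i _)).smul _

/-- The value is `m - 1` for `m > 1` but `1` for `m = 1`, which is the origin of the two cases in
the restriction formula. -/
lemma resExp_zero (i : b.support) (hl : l i = 0) :
    resExp b n l i 0 = (mInt P n i : ℤ) - 1 % mInt P n i := by
  rw [resExp, shp, map_zero, tau_simple, hl]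
  norm_num

lemma one_sub_pow_ne_zero (z : ℂ) {m : ℕ} (hm : 0 < m) :
    (1 - Polynomial.C z * (Polynomial.C (q : ℂ) * Polynomial.X) ^ m : Polynomial ℂ) ≠ 0 := by
  intro h
  have := congrArg (Polynomial.eval 0) h
  simp [hm.ne'] at this

/-- Put `y = q x_i` and `Y = y ^ m`. For `m > 1` the two terms give `1 - Y/q - (1 - 1/q) Y +
γ(‖α_i‖²) (1 - Y) y`, which is `(1 - Y) (1 + γ(‖α_i‖²) y)`. For `m = 1` the value of `γ` is `-1` and
they give `(1 - y) (1 - y/q)`. The factor `1 - Y` is the restriction of `Δ`. -/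
lemma resTo_numerator (hγ : IsGauss n q γ) (i : b.support) (hl : l i = 0)
    {p : MvPolynomial b.support ℂ} (hp : sumNum b n q l hγ = DeltaL b n q * polyHom b p) :
    resHom b i p = if mInt P n i = 1 then
        1 - Polynomial.C (1 / (q : ℂ)) * (Polynomial.C (q : ℂ) * Polynomial.X) ^ mInt P n i
      else 1 + Polynomial.C (γ (normSq P i)) * (Polynomial.C (q : ℂ) * Polynomial.X) := by
  have hm := mInt_pos (P := P) n i
  have hD : ResTo b i (DeltaL b n q) (1 - (Polynomial.C (q : ℂ) * Polynomial.X) ^ mInt P n i) := by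
    have := resTo_prod b q n i 1
    simp only [one_smul, map_one, one_mul] at this
    exact this
  have h0 : (1 - (Polynomial.C (q : ℂ) * Polynomial.X) ^ mInt P n i : Polynomial ℂ) ≠ 0 := by
    simpa using one_sub_pow_ne_zero q 1 hm
  have h1 : ResTo b i (sumNum b n q l hγ) _ := hp ▸ hD.mul ⟨p, rfl, rfl⟩
  apply mul_left_cancel₀ h0
  split_ifs with hm1
  · have he : resExp b n l i 0 = (1 : ℕ) := by rw [resExp_zero b n l i hl, hm1]; norm_num
    have hγ1 : γ (normSq P i) = -1 := by
      have h2 := dvd_normSq_mul_mInt (P := P) n i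
      rw [hm1, mul_one] at h2
      rw [(ZMod.natCast_eq_zero_iff _ _).mpr h2, hγ.zero]
    have h2 := resTo_sumNum b n q l hγ i (resTo_monoNum b n q l i hl 1 he)
    rw [h1.unique h2, hγ1, hm1]
    simp only [map_sub, map_neg, map_one]
    ring
  · have he : resExp b n l i 0 = (mInt P n i - 1 : ℕ) := by
      rw [resExp_zero b n l i hl, Int.emod_eq_of_lt zero_le_one (by omega)]
      omega
    have h2 := resTo_sumNum b n q l hγ i (resTo_monoNum b n q l i hl _ he)
    rw [h1.unique h2]
    have h3 : (Polynomial.C (q : ℂ) * Polynomial.X) ^ mInt P n i =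
        (Polynomial.C (q : ℂ) * Polynomial.X) ^ (mInt P n i - 1) *
          (Polynomial.C (q : ℂ) * Polynomial.X) := by
      rw [← pow_succ, Nat.sub_add_cancel hm]
    rw [h3]
    simp only [map_sub, map_one]
    ring

/-- Use `h = N / D`: both are polynomials, and `D` restricts to `1 - Y_i / q`, whose constant term
is `1`. -/
lemma restrictsTo_hFun (hγ : IsGauss n q γ) (i : b.support) (hl : l i = 0) :
    RestrictsTo b i (hFun b n q γ l)
      (algebraMap (Polynomial ℂ) (RatFunc ℂ) (if mInt P n i = 1 then
          1 - Polynomial.C (1 / (q : ℂ)) * (Polynomial.C (q : ℂ) * Polynomial.X) ^ mInt P n i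
        else 1 + Polynomial.C (γ (normSq P i)) * (Polynomial.C (q : ℂ) * Polynomial.X)) /
        algebraMap (Polynomial ℂ) (RatFunc ℂ)
          (1 - Polynomial.C (1 / (q : ℂ)) *
            (Polynomial.C (q : ℂ) * Polynomial.X) ^ mInt P n i)) := by
  obtain ⟨p, hp, hp'⟩ := exists_numerator b n q l hγ
  obtain ⟨c, hc, hc'⟩ := resTo_prod b q n i (1 / (q : ℂ))
  refine ⟨p, c, ?_, ?_, ?_⟩
  · change resHom b i c ≠ 0
    rw [hc']
    exact one_sub_pow_ne_zero q _ (mInt_pos n _)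
  · have h1 : MvPolynomial.aeval (var b) c = DFun b n q := by
      rw [← toRat_polyHom, hc, ← toRat_DL]
      rfl
    rw [hp, h1, mul_div_cancel_right₀ _ (DFun_ne_zero b n q)]
  · change _ = algebraMap _ _ (resHom b i p) / algebraMap _ _ (resHom b i c)
    rw [hc', resTo_numerator b n q l hγ i hl hp']

lemma algebraMap_denominator {m : ℕ} (hm : 0 < m) : algebraMap (Polynomial ℂ) (RatFunc ℂ)
    (1 - Polynomial.C (1 / (q : ℂ)) * (Polynomial.C (q : ℂ) * Polynomial.X) ^ m) =
      1 - (q : RatFunc ℂ) ^ (m - 1) * RatFunc.X ^ m := by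
  have h1 : (Polynomial.C (1 / (q : ℂ)) * (Polynomial.C (q : ℂ) * Polynomial.X) ^ m) =
      (q : Polynomial ℂ) ^ (m - 1) * Polynomial.X ^ m := by
    obtain ⟨k, rfl⟩ := Nat.exists_eq_succ_of_ne_zero hm.ne'
    rw [mul_pow, ← mul_assoc, ← map_pow, ← map_mul, Nat.succ_eq_add_one, Nat.add_sub_cancel,
      pow_succ', ← mul_assoc, one_div_mul_cancel (NeZero.ne (q : ℂ)), one_mul, map_pow, map_natCast]
  rw [h1, map_sub, map_one, map_mul, map_pow, map_pow, map_natCast, RatFunc.algebraMap_X]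

end Main

end ChintaGunnells

end

theorem theorem3p5 {ι M N : Type*} [Fintype ι] [AddCommGroup M] [Module ℝ M]
    [AddCommGroup N] [Module ℝ N] (P : RootPairing ι ℝ M N) [P.IsRootSystem]
    [P.IsCrystallographic] [P.IsReduced] [P.IsIrreducible] (b : P.Base)
    (n q : ℕ) [NeZero n] [NeZero q] (γ : ZMod n → ℂ) (hγ0 : γ 0 = -1)
    (hγ : ∀ k : ZMod n, k ≠ 0 → γ k * γ (-k) = 1 / (q : ℂ)) (l : b.support → ℕ) :
    (∀ (L : List b.support) (f : ChintaGunnells.RatFn (ChintaGunnells.Lat P)),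
      ChintaGunnells.slash b n q γ l (L.map (ChintaGunnells.simpleRefl b)).prod f =
        ChintaGunnells.slashWord b n q γ l L f) ∧
    (∀ w : P.weylGroup, ChintaGunnells.slash b n q γ l w (ChintaGunnells.hFun b n q γ l) =
      ChintaGunnells.hFun b n q γ l) ∧
    (∃ p : MvPolynomial b.support ℂ, MvPolynomial.aeval (ChintaGunnells.var b) p =
      ChintaGunnells.hFun b n q γ l * ChintaGunnells.DFun b n q) ∧
    ((∀ i, l i = 0) → ∀ i : b.support,
      (ChintaGunnells.mInt P n i ≠ 1 → ChintaGunnells.RestrictsTo b i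
        (ChintaGunnells.hFun b n q γ l)
        ((1 + RatFunc.C (γ (ChintaGunnells.normSq P i)) * (q : RatFunc ℂ) * RatFunc.X) /
          (1 - (q : RatFunc ℂ) ^ (ChintaGunnells.mInt P n i - 1) *
            RatFunc.X ^ ChintaGunnells.mInt P n i))) ∧
      (ChintaGunnells.mInt P n i = 1 → ChintaGunnells.RestrictsTo b i
        (ChintaGunnells.hFun b n q γ l) 1)) := by
  have hG : ChintaGunnells.IsGauss n q γ := ⟨hγ0, hγ⟩
  refine ⟨ChintaGunnells.slash_word b n q l hG, ChintaGunnells.slash_hFun b n q l hG, ?_,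
    fun hl i ↦ ⟨fun hm ↦ ?_, fun hm ↦ ?_⟩⟩
  · obtain ⟨p, hp, -⟩ := ChintaGunnells.exists_numerator b n q l hG
    exact ⟨p, hp⟩
  · have h := ChintaGunnells.restrictsTo_hFun b n q l hG i (hl i)
    rw [if_neg hm, ChintaGunnells.algebraMap_denominator q (ChintaGunnells.mInt_pos n _), map_add,
      map_one, map_mul, map_mul, RatFunc.algebraMap_C, RatFunc.algebraMap_C, RatFunc.algebraMap_X,
      map_natCast, ← mul_assoc] at h
    exact h
  -- For `m = 1` the restricted numerator equals the restricted denominator.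
  · have h := ChintaGunnells.restrictsTo_hFun b n q l hG i (hl i)
    rwa [if_pos hm, div_self] at h
    exact (map_ne_zero_iff _ (RatFunc.algebraMap_injective ℂ)).mpr
      (ChintaGunnells.one_sub_pow_ne_zero q _ (ChintaGunnells.mInt_pos n _))
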